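/- **Notation.** Let $\langle\xi\rangle=(1+|\xi|^2)^{1/2}$ and $\widehat f(\xi)=(2\pi)^{-d/2}\int_{\mathbf R^d} f(x)e^{-i\langle x,\xi\rangle}\,dx$, extended to $\mathscr S'(\mathbf R^d)$ by duality. A *cone* is a subset of $\mathbf R^d\setminus 0$ that is invariant under multiplication by positive numbers. *Weights and symbols.* $\mathscr P(\mathbf R^n)$ is the set of positive measurable functions $\omega$ on $\mathbf R^n$ such that, for some constants $C,N$, $\omega(x+y)\le C\omega(x)(1+|y|)^N$ for all $x,y\in\mathbf R^n$ (such functions are automatically locally bounded). For $\rho,\delta\in\mathbf R$ and $\omega\in\mathscr P(\mathbf R^{2d})$, $S^{(\omega)}_{\rho,\delta}(\mathbf R^{2d})$ is the set of $a\in C^\infty(\mathbf R^{2d})$ such that for all multi-indices $\alpha,\beta$ there is a constant $C_{\alpha,\beta}$ with $$|\partial_x^\alpha\partial_\xi^\beta a(x,\xi)|\le C_{\alpha,\beta}\,\omega(x,\xi)\langle\xi\rangle^{-\rho|\beta|+\delta|\alpha|},\qquad x,\xi\in\mathbf R^d,$$ and $\mathscr P_{\rho,\delta}(\mathbf R^{2d})$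 is the set of $\omega\in\mathscr P(\mathbf R^{2d})\cap C^\infty(\mathbf R^{2d})$ with $\omega\in S^{(\omega)}_{\rho,\delta}(\mathbf R^{2d})$. *BF-spaces.* A Banach space $\mathscr B$ of (classes modulo a.e. equality of) complex-valued measurable functions on $\mathbf R^d$ is a *translation invariant BF-space* if there are an even $v\in\mathscr P(\mathbf R^d)$ with $v(x+y)\le Cv(x)v(y)$ and a constant $C$ such that: (1) $\mathscr S(\mathbf R^d)\subseteq\mathscr B\subseteq\mathscr S'(\mathbf R^d)$ with continuous embeddings; (2) if $f\in\mathscr B$ and $x\in\mathbf R^d$, then $f(\cdot-x)\in\mathscr B$ and $\|f(\cdot-x)\|_{\mathscr B}\le Cv(x)\|f\|_{\mathscr B}$; (3) if $f,g\in L^1_{loc}(\mathbf R^d)$, $g\in\mathscr B$ and $|f|\le|g|$ a.e., then $f\in\mathscr B$ and $\|f\|_{\mathscr B}\le C\|g\|_{\mathscr B}$. *Wave-front sets.* Let $\mathscr B$ be a translation invariant BF-space on $\mathbf R^d$ and $\omega\in\mathscr P(\mathbf R^{2d})$. For a compactly supported distribution $u$ and an open cone $\Gamma$, let $|u|_{\mathscr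 F\mathscr B(\omega,\Gamma)}=\|\widehat u\,\omega(y,\cdot)\,\chi_\Gamma\|_{\mathscr B}$, interpreted as $+\infty$ if $\widehat u\,\omega(y,\cdot)\,\chi_\Gamma\notin\mathscr B$; whether this is finite does not depend on $y\in\mathbf R^d$. Let $\Sigma_{\mathscr F\mathscr B(\omega)}(u)$ be the set of $\xi\in\mathbf R^d\setminus0$ such that $|u|_{\mathscr F\mathscr B(\omega,\Gamma)}=\infty$ for every open cone $\Gamma\ni\xi$. For $f\in\mathscr S'(\mathbf R^d)$, $\operatorname{WF}_{\mathscr F\mathscr B(\omega)}(f)$ is the set of $(x_0,\xi_0)\in\mathbf R^d\times(\mathbf R^d\setminus0)$ such that $\xi_0\in\Sigma_{\mathscr F\mathscr B(\omega)}(\varphi f)$ for every $\varphi\in C_0^\infty(\mathbf R^d)$ with $\varphi(x_0)\ne0$. *Operators and characteristic sets.* For $\rho>0$, $\omega_0\in\mathscr P_{\rho,0}(\mathbf R^{2d})$ and $a\in S^{(\omega_0)}_{\rho,0}(\mathbf R^{2d})$, $\operatorname{Op}(a)$ is the unique continuous operator on $\mathscr S'(\mathbf R^d)$ such that $$(\operatorname{Op}(a)f)(x)=(2\pi)^{-d/2}\int_{\mathbf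 R^d}a(x,\xi)\widehat f(\xi)e^{i\langle x,\xi\rangle}\,d\xi,\qquad f\in\mathscr S(\mathbf R^d).$$ $\operatorname{Char}_{(\omega_0)}(a)$ is the set of $(x_0,\xi_0)\in\mathbf R^d\times(\mathbf R^d\setminus0)$ for which there are **no** neighbourhood $X$ of $x_0$, open cone $\Gamma\ni\xi_0$ and constants $R,C>0$ such that $|a(x,\xi)|\ge C\omega_0(x,\xi)$ whenever $x\in X$, $\xi\in\Gamma$ and $|\xi|\ge R$. **Theorem.** Let $\rho>0$, $\omega\in\mathscr P(\mathbf R^{2d})$, $\omega_0\in\mathscr P_{\rho,0}(\mathbf R^{2d})$, $a\in S^{(\omega_0)}_{\rho,0}(\mathbf R^{2d})$ and $f\in\mathscr S'(\mathbf R^d)$, and let $\mathscr B$ be a translation invariant BF-space on $\mathbf R^d$. Then $$\operatorname{WF}_{\mathscr F\mathscr B(\omega/\omega_0)}(\operatorname{Op}(a)f)\subseteq\operatorname{WF}_{\mathscr F\mathscr B(\omega)}(f)\subseteq\operatorname{WF}_{\mathscr F\mathscr B(\omega/\omega_0)}(\operatorname{Op}(a)f)\cup\operatorname{Char}_{(\omega_0)}(a).$$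 -/

import Mathlib

open MeasureTheory
open scoped Topology SchwartzMap FourierTransform ENNReal

noncomputable section

namespace FourierBF

section smoothness

open scoped ContDiff

/-! ### Symbols of uniform temperate growth

Functions all of whose derivatives are bounded by constants times one fixed power of `1 + ‖z‖`.
For such a symbol `a`, the map `φ ↦ ∫ e^{i⟨x,ξ⟩} a(x,ξ) φ(x) dx` is shown to be continuous on the
Schwartz space; this is what is needed to let `Op(a)` act on tempered distributions. -/

/-- A smooth function such that, for some `N` independent of the order, every derivative is
`O((1 + ‖z‖) ^ N)`. -/
def HasUniformTemperateGrowth {F V : Type*} [NormedAddCommGroup F] [NormedSpace ℝ F]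
    [NormedAddCommGroup V] [NormedSpace ℝ V] (a : F → V) : Prop :=
  ContDiff ℝ ∞ a ∧ ∃ N : ℕ, ∀ k : ℕ, ∃ C : ℝ, 0 ≤ C ∧ ∀ z, ‖iteratedFDeriv ℝ k a z‖ ≤ C * (1 + ‖z‖) ^ N

namespace HasUniformTemperateGrowth

section basic
variable {F V W X : Type*} [NormedAddCommGroup F] [NormedSpace ℝ F]
    [NormedAddCommGroup V] [NormedSpace ℝ V] [NormedAddCommGroup W] [NormedSpace ℝ W]
    [NormedAddCommGroup X] [NormedSpace ℝ X]

theorem add {a b : F → V} (ha : HasUniformTemperateGrowth a) (hb : HasUniformTemperateGrowth b) :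
    HasUniformTemperateGrowth (fun z => a z + b z) := by
  obtain ⟨ha, N, hN⟩ := ha
  obtain ⟨hb, M, hM⟩ := hb
  refine ⟨ha.add hb, max N M, fun k => ?_⟩
  obtain ⟨C, hC, h1⟩ := hN k
  obtain ⟨D, hD, h2⟩ := hM k
  refine ⟨C + D, by positivity, fun z => ?_⟩
  have e : iteratedFDeriv ℝ k (fun z => a z + b z) z
      = iteratedFDeriv ℝ k a z + iteratedFDeriv ℝ k b z :=
    iteratedFDeriv_add_apply (ha.contDiffAt.of_le (mod_cast le_top))
      (hb.contDiffAt.of_le (mod_cast le_top))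
  have h1z : (1 : ℝ) ≤ 1 + ‖z‖ := by linarith [norm_nonneg z]
  rw [e, add_mul]
  refine (norm_add_le _ _).trans (add_le_add ((h1 z).trans ?_) ((h2 z).trans ?_))
  · gcongr
    exact le_max_left _ _
  · gcongr
    exact le_max_right _ _

theorem bilin {a : F → V} {b : F → W} (B : V →L[ℝ] W →L[ℝ] X)
    (ha : HasUniformTemperateGrowth a) (hb : HasUniformTemperateGrowth b) :
    HasUniformTemperateGrowth (fun z => B (a z) (b z)) := by
  obtain ⟨ha, N, hN⟩ := ha
  obtain ⟨hb, M, hM⟩ := hb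
  choose C hC h1 using hN
  choose D hD h2 using hM
  refine ⟨B.isBoundedBilinearMap.contDiff.comp (ha.prodMk hb), N + M, fun k => ?_⟩
  refine ⟨‖B‖ * ∑ i ∈ Finset.range (k + 1), (k.choose i : ℝ) * C i * D (k - i), ?_, fun z => ?_⟩
  · refine mul_nonneg (norm_nonneg B) (Finset.sum_nonneg fun i _ => ?_)
    have := hC i
    have := hD (k - i)
    positivity
  refine (B.norm_iteratedFDeriv_le_of_bilinear ha hb z (n := k) (mod_cast le_top)).trans ?_
  rw [mul_assoc, Finset.sum_mul]
  refine mul_le_mul_of_nonneg_left (Finset.sum_le_sum fun i _ => ?_) (norm_nonneg B)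
  have := hC i
  have := hD (k - i)
  calc (k.choose i : ℝ) * ‖iteratedFDeriv ℝ i a z‖ * ‖iteratedFDeriv ℝ (k - i) b z‖
      ≤ (k.choose i : ℝ) * (C i * (1 + ‖z‖) ^ N) * (D (k - i) * (1 + ‖z‖) ^ M) := by
        gcongr
        · exact h1 i z
        · exact h2 _ z
    _ = _ := by rw [pow_add]; ring

theorem const (c : V) : HasUniformTemperateGrowth (fun _ : F => c) := by
  refine ⟨contDiff_const, 0, fun k => ⟨‖c‖, norm_nonneg _, fun z => ?_⟩⟩
  cases k with
  | zero => simp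
  | succ k => simp [iteratedFDeriv_const_of_ne]

theorem clm (l : F →L[ℝ] V) : HasUniformTemperateGrowth (fun z => l z) := by
  refine ⟨l.contDiff, 1, fun k => ⟨‖l‖, norm_nonneg _, fun z => ?_⟩⟩
  cases k with
  | zero =>
    simp only [norm_iteratedFDeriv_zero, pow_one]
    refine (l.le_opNorm z).trans ?_
    gcongr
    linarith
  | succ k =>
    rw [← norm_iteratedFDeriv_fderiv]
    have : fderiv ℝ (fun z => l z) = fun _ => l := by
      ext1 z
      exact l.fderiv
    rw [this]
    have h1z : (1 : ℝ) ≤ (1 + ‖z‖) ^ 1 := by simp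
    refine le_trans ?_ (le_mul_of_one_le_right (norm_nonneg _) h1z)
    cases k with
    | zero => simp
    | succ k => simp [iteratedFDeriv_const_of_ne]

theorem fderiv {a : F → V} (ha : HasUniformTemperateGrowth a) :
    HasUniformTemperateGrowth (fun z => _root_.fderiv ℝ a z) := by
  obtain ⟨ha, N, hN⟩ := ha
  refine ⟨ha.fderiv_right (m := ∞) (by simp), N, fun k => ?_⟩
  obtain ⟨C, hC, h⟩ := hN (k + 1)
  refine ⟨C, hC, fun z => ?_⟩
  have := h z
  rwa [← norm_iteratedFDeriv_fderiv] at this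

theorem slice {E V : Type*} [NormedAddCommGroup E] [NormedSpace ℝ E]
    [NormedAddCommGroup V] [NormedSpace ℝ V] {a : E × E → V} (ha : HasUniformTemperateGrowth a) :
    ∃ N : ℕ, ∀ k : ℕ, ∃ C : ℝ, 0 ≤ C ∧ ∀ x ξ : E,
      ‖iteratedFDeriv ℝ k (fun x => a (x, ξ)) x‖ ≤ C * (1 + ‖ξ‖) ^ N * (1 + ‖x‖) ^ N := by
  obtain ⟨ha, N, hN⟩ := ha
  refine ⟨N, fun k => ?_⟩
  obtain ⟨C, hC, h⟩ := hN k
  refine ⟨C, hC, fun x ξ => ?_⟩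
  have e : (fun x => a (x, ξ))
      = (fun z => a (z + (0, ξ))) ∘ (ContinuousLinearMap.inl ℝ E E) := by
    ext x
    simp
  have hs : ContDiff ℝ ∞ (fun z => a (z + (0, ξ))) := ha.comp (contDiff_id.add contDiff_const)
  rw [e, ContinuousLinearMap.iteratedFDeriv_comp_right _ hs x (i := k) (mod_cast le_top)]
  refine (ContinuousMultilinearMap.norm_compContinuousLinearMap_le _ _).trans ?_
  rw [iteratedFDeriv_comp_add_right]
  have h1 : ∏ _i : Fin k, ‖ContinuousLinearMap.inl ℝ E E‖ ≤ 1 := by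
    refine Finset.prod_le_one (fun _ _ => norm_nonneg _) fun _ _ => ?_
    exact ContinuousLinearMap.norm_inl_le_one ℝ E E
  have hx : ‖ContinuousLinearMap.inl ℝ E E x + (0, ξ)‖ ≤ ‖x‖ + ‖ξ‖ := by
    simp [Prod.norm_def]
  calc _ ≤ C * (1 + ‖ContinuousLinearMap.inl ℝ E E x + (0, ξ)‖) ^ N * 1 := by
        gcongr
        exact h _
    _ ≤ C * ((1 + ‖ξ‖) * (1 + ‖x‖)) ^ N * 1 := by
        gcongr
        nlinarith [norm_nonneg x, norm_nonneg ξ]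
    _ = _ := by rw [mul_pow]; ring

theorem slice_hasTemperateGrowth {E V : Type*} [NormedAddCommGroup E] [NormedSpace ℝ E]
    [NormedAddCommGroup V] [NormedSpace ℝ V] {a : E × E → V} (ha : HasUniformTemperateGrowth a)
    (ξ : E) : (fun x => a (x, ξ)).HasTemperateGrowth := by
  refine ⟨ha.1.comp (contDiff_id.prodMk contDiff_const), fun k => ?_⟩
  obtain ⟨N, hN⟩ := ha.slice
  obtain ⟨C, _, h⟩ := hN k
  exact ⟨N, C * (1 + ‖ξ‖) ^ N, fun x => h x ξ⟩

end basic

section osc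

set_option linter.unusedSectionVars false
variable {E : Type} [NormedAddCommGroup E] [InnerProductSpace ℝ E] [FiniteDimensional ℝ E]
  [MeasurableSpace E] [BorelSpace E]
variable {V : Type} [NormedAddCommGroup V] [NormedSpace ℂ V]

/-- `φ ↦ (x ↦ φ(x) a(x,ξ))` as a continuous linear map between Schwartz spaces. -/
def sliceMul {a : E × E → V} (ha : HasUniformTemperateGrowth a) (ξ : E) : 𝓢(E, ℂ) →L[ℂ] 𝓢(E, V) :=
  SchwartzMap.bilinLeftCLM (ContinuousLinearMap.lsmul ℂ ℂ) (ha.slice_hasTemperateGrowth ξ)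

theorem sliceMul_apply {a : E × E → V} (ha : HasUniformTemperateGrowth a) (ξ : E) (φ : 𝓢(E, ℂ))
    (x : E) : ha.sliceMul ξ φ x = φ x • a (x, ξ) := rfl

theorem seminorm_sliceMul_le {a : E × E → V} (ha : HasUniformTemperateGrowth a) :
    ∃ N : ℕ, ∀ m : ℕ × ℕ, ∃ (s : Finset (ℕ × ℕ)) (C : ℝ), 0 ≤ C ∧ ∀ (φ : 𝓢(E, ℂ)) (ξ : E),
      schwartzSeminormFamily ℂ E V m (ha.sliceMul ξ φ) ≤
        C * (1 + ‖ξ‖) ^ N * s.sup (schwartzSeminormFamily ℂ E ℂ) φ := by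
  obtain ⟨N, hN⟩ := ha.slice
  choose C hC h using hN
  refine ⟨N, fun ⟨k, n⟩ => ⟨Finset.Iic (k + N, n),
    ∑ i ∈ Finset.range (n + 1), (n.choose i : ℝ) * C (n - i) * 2 ^ (k + N), ?_, fun φ ξ => ?_⟩⟩
  · refine Finset.sum_nonneg fun i _ => ?_
    have := hC (n - i)
    positivity
  · set S := (Finset.Iic (k + N, n)).sup (schwartzSeminormFamily ℂ E ℂ) φ with hS
    have hS0 : 0 ≤ S := apply_nonneg _ _
    have hsum : 0 ≤ ∑ i ∈ Finset.range (n + 1), (n.choose i : ℝ) * C (n - i) * 2 ^ (k + N) := by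
      refine Finset.sum_nonneg fun i _ => ?_
      have := hC (n - i)
      positivity
    refine SchwartzMap.seminorm_le_bound ℂ k n _ (by positivity) fun x => ?_
    have hb := (ContinuousLinearMap.lsmul ℝ ℂ : ℂ →L[ℝ] V →L[ℝ] V).norm_iteratedFDeriv_le_of_bilinear
      (φ.smooth ⊤) (ha.slice_hasTemperateGrowth ξ).1 x (n := n) (mod_cast le_top)
    have hl : ‖(ContinuousLinearMap.lsmul ℝ ℂ : ℂ →L[ℝ] V →L[ℝ] V)‖ ≤ 1 :=
      ContinuousLinearMap.opNorm_lsmul_le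
    have hb' : ‖iteratedFDeriv ℝ n (ha.sliceMul ξ φ) x‖ ≤
        ∑ i ∈ Finset.range (n + 1), (n.choose i : ℝ) * ‖iteratedFDeriv ℝ i φ x‖ *
          ‖iteratedFDeriv ℝ (n - i) (fun x => a (x, ξ)) x‖ :=
      hb.trans (mul_le_of_le_one_left (Finset.sum_nonneg fun i _ => by positivity) hl)
    calc ‖x‖ ^ k * ‖iteratedFDeriv ℝ n (ha.sliceMul ξ φ) x‖
        ≤ ‖x‖ ^ k * ∑ i ∈ Finset.range (n + 1), (n.choose i : ℝ) * ‖iteratedFDeriv ℝ i φ x‖ *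
          ‖iteratedFDeriv ℝ (n - i) (fun x => a (x, ξ)) x‖ := by gcongr
      _ ≤ ∑ i ∈ Finset.range (n + 1), (n.choose i : ℝ) * C (n - i) * 2 ^ (k + N) *
            ((1 + ‖ξ‖) ^ N * S) := by
          rw [Finset.mul_sum]
          refine Finset.sum_le_sum fun i hi => ?_
          have hin : i ≤ n := by
            have := Finset.mem_range.1 hi
            omega
          have h1 := SchwartzMap.one_add_le_sup_seminorm_apply (𝕜 := ℂ) (m := (k + N, n))
            (k := k + N) (n := i) le_rfl hin φ x
          have h2 := h (n - i) x ξ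
          have h3 : ‖x‖ ^ k ≤ (1 + ‖x‖) ^ k := by
            gcongr
            linarith
          have := hC (n - i)
          calc ‖x‖ ^ k * ((n.choose i : ℝ) * ‖iteratedFDeriv ℝ i φ x‖ *
                ‖iteratedFDeriv ℝ (n - i) (fun x => a (x, ξ)) x‖)
              ≤ (1 + ‖x‖) ^ k * ((n.choose i : ℝ) * ‖iteratedFDeriv ℝ i φ x‖ *
                (C (n - i) * (1 + ‖ξ‖) ^ N * (1 + ‖x‖) ^ N)) := by gcongr
            _ = (n.choose i : ℝ) * C (n - i) * (1 + ‖ξ‖) ^ N *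
                ((1 + ‖x‖) ^ (k + N) * ‖iteratedFDeriv ℝ i φ x‖) := by rw [pow_add]; ring
            _ ≤ (n.choose i : ℝ) * C (n - i) * (1 + ‖ξ‖) ^ N * (2 ^ (k + N) * S) :=
                mul_le_mul_of_nonneg_left h1 (by positivity)
            _ = _ := by ring
      _ = _ := by rw [← Finset.sum_mul]; ring

/-- `ξ ↦ ∫ e^{i⟨x,ξ⟩} φ(x) a(x,ξ) dx`. -/
def oscIntegral (a : E × E → V) (φ : E → ℂ) (ξ : E) : V :=
  ∫ x, (Complex.exp (Complex.I * (inner ℝ x ξ : ℝ)) * φ x) • a (x, ξ)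

theorem oscIntegral_eq {a : E × E → V} (ha : HasUniformTemperateGrowth a) (φ : 𝓢(E, ℂ)) (ξ : E) :
    oscIntegral a φ ξ = (𝓕 (ha.sliceMul ξ φ)) (-((2 * Real.pi)⁻¹ • ξ)) := by
  rw [SchwartzMap.fourier_coe, Real.fourier_eq, oscIntegral]
  congr 1
  ext x
  rw [sliceMul_apply, mul_smul, Real.fourierChar.eq_1]
  rw [Circle.smul_def, AddChar.coe_mk, Circle.coe_exp]
  congr 2
  simp only [inner_neg_right, inner_smul_right]
  push_cast
  have : (Real.pi : ℂ) ≠ 0 := by exact_mod_cast Real.pi_ne_zero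
  field_simp

theorem clm_comp {F V W : Type*} [NormedAddCommGroup F] [NormedSpace ℝ F]
    [NormedAddCommGroup V] [NormedSpace ℝ V] [NormedAddCommGroup W] [NormedSpace ℝ W]
    {a : F → V} (l : V →L[ℝ] W) (ha : HasUniformTemperateGrowth a) :
    HasUniformTemperateGrowth (fun z => l (a z)) :=
  bilin (ContinuousLinearMap.id ℝ (V →L[ℝ] W)) (const l) ha

/-- The symbol that arises when `oscIntegral a φ` is differentiated. -/
def derivSymbol (a : E × E → V) (z : E × E) : E →L[ℝ] V :=
  (_root_.fderiv ℝ a z).comp (ContinuousLinearMap.inr ℝ E E) +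
    (innerSL ℝ z.1).smulRight (Complex.I • a z)

theorem derivSymbol_growth {a : E × E → V} (ha : HasUniformTemperateGrowth a) :
    HasUniformTemperateGrowth (derivSymbol a) := by
  refine add ?_ ?_
  · exact clm_comp ((ContinuousLinearMap.compL ℝ E (E × E) V).flip (ContinuousLinearMap.inr ℝ E E))
      ha.fderiv
  · exact bilin (ContinuousLinearMap.smulRightL ℝ E V)
      (clm ((innerSL ℝ).comp (ContinuousLinearMap.fst ℝ E E)))
      (clm_comp (Complex.I • ContinuousLinearMap.id ℝ V) ha)

theorem norm_exp_I (r : ℝ) : ‖Complex.exp (Complex.I * r)‖ = 1 := by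
  rw [mul_comm]
  exact Complex.norm_exp_ofReal_mul_I r

theorem continuous_integrand {a : E × E → V} (ha : HasUniformTemperateGrowth a) (φ : 𝓢(E, ℂ))
    (ξ : E) : Continuous fun x : E =>
      (Complex.exp (Complex.I * (inner ℝ x ξ : ℝ)) * φ x) • a (x, ξ) := by
  have h1 := ha.1.continuous
  have h2 := φ.continuous
  fun_prop

theorem integrable_integrand {a : E × E → V} (ha : HasUniformTemperateGrowth a) (φ : 𝓢(E, ℂ))
    (ξ : E) : Integrable fun x : E =>
      (Complex.exp (Complex.I * (inner ℝ x ξ : ℝ)) * φ x) • a (x, ξ) := by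
  refine ((ha.sliceMul ξ φ).integrable (μ := volume)).mono
    (ha.continuous_integrand φ ξ).aestronglyMeasurable (Filter.Eventually.of_forall fun x => ?_)
  rw [sliceMul_apply, mul_smul, norm_smul, norm_exp_I, one_mul]

theorem integrable_weight_mul (φ : 𝓢(E, ℂ)) (N : ℕ) :
    Integrable (fun x => (1 + ‖x‖) ^ N * ‖φ x‖) (volume : Measure E) := by
  have h0 : Integrable (fun x => 2 ^ N * (‖φ x‖ + ‖x‖ ^ N * ‖φ x‖)) (volume : Measure E) :=
    (((φ.integrable).norm).add (φ.integrable_pow_mul volume N)).const_mul _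
  refine h0.mono' (by have := φ.continuous; fun_prop) (Filter.Eventually.of_forall fun x => ?_)
  rw [Real.norm_of_nonneg (by positivity)]
  have h1 : (1 + ‖x‖) ^ N ≤ 2 ^ N * (1 + ‖x‖ ^ N) := by
    have := add_pow_le (zero_le_one (α := ℝ)) (norm_nonneg x) N
    rw [one_pow] at this
    refine this.trans ?_
    gcongr
    · norm_num
    · omega
  calc (1 + ‖x‖) ^ N * ‖φ x‖ ≤ 2 ^ N * (1 + ‖x‖ ^ N) * ‖φ x‖ := by gcongr
    _ = _ := by ring

theorem hasFDerivAt_oscIntegral {a : E × E → V} (ha : HasUniformTemperateGrowth a) (φ : 𝓢(E, ℂ))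
    (ξ₀ : E) : HasFDerivAt (oscIntegral a φ) (oscIntegral (derivSymbol a) φ ξ₀) ξ₀ := by
  have hd := ha.derivSymbol_growth
  obtain ⟨hs, N, hN⟩ := hd
  obtain ⟨C, hC, hb⟩ := hN 0
  simp only [norm_iteratedFDeriv_zero] at hb
  refine hasFDerivAt_integral_of_dominated_of_fderiv_le (𝕜 := ℝ)
    (F' := fun ξ x => (Complex.exp (Complex.I * (inner ℝ x ξ : ℝ)) * φ x) • derivSymbol a (x, ξ))
    (bound := fun x => (C * (2 + ‖ξ₀‖) ^ N) * ((1 + ‖x‖) ^ N * ‖φ x‖))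
    (Metric.ball_mem_nhds ξ₀ one_pos)
    (Filter.Eventually.of_forall fun ξ => (ha.continuous_integrand φ ξ).aestronglyMeasurable)
    (ha.integrable_integrand φ ξ₀)
    (ha.derivSymbol_growth.continuous_integrand φ ξ₀).aestronglyMeasurable
    (Filter.Eventually.of_forall fun x ξ hξ => ?_) (Integrable.const_mul ?_ _)
    (Filter.Eventually.of_forall fun x ξ hξ => ?_)
  · rw [mul_smul, norm_smul, norm_exp_I, one_mul, norm_smul]
    have h1 : ‖ξ‖ ≤ 1 + ‖ξ₀‖ := by
      have h2 : ‖ξ - ξ₀‖ < 1 := by simpa [dist_eq_norm] using hξ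
      have h3 : ‖ξ‖ ≤ ‖ξ - ξ₀‖ + ‖ξ₀‖ := by simpa using norm_add_le (ξ - ξ₀) ξ₀
      linarith
    have h2 : 1 + ‖(x, ξ)‖ ≤ (2 + ‖ξ₀‖) * (1 + ‖x‖) := by
      have h3 : ‖(x, ξ)‖ ≤ ‖x‖ + ‖ξ‖ := by simp [Prod.norm_def]
      nlinarith [norm_nonneg x, norm_nonneg ξ₀]
    calc ‖φ x‖ * ‖derivSymbol a (x, ξ)‖ ≤ ‖φ x‖ * (C * (1 + ‖(x, ξ)‖) ^ N) := by
          gcongr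
          exact hb _
      _ ≤ ‖φ x‖ * (C * ((2 + ‖ξ₀‖) * (1 + ‖x‖)) ^ N) := by gcongr
      _ = _ := by rw [mul_pow]; ring
  · exact integrable_weight_mul φ N
  · have hp : HasFDerivAt (fun ξ : E => ((x, ξ) : E × E)) (ContinuousLinearMap.inr ℝ E E) ξ :=
      hasFDerivAt_prodMk_right x ξ
    have hA : HasFDerivAt (fun ξ : E => a (x, ξ))
        ((_root_.fderiv ℝ a (x, ξ)).comp (ContinuousLinearMap.inr ℝ E E)) ξ :=
      ((ha.1.differentiable (by simp)).differentiableAt.hasFDerivAt).comp ξ hp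
    have hi : HasFDerivAt (fun ξ : E => Complex.I * ((innerSL ℝ x ξ : ℝ) : ℂ))
        (Complex.I • (Complex.ofRealCLM.comp (innerSL ℝ x))) ξ :=
      ((Complex.ofRealCLM.comp (innerSL ℝ x)).hasFDerivAt).const_mul Complex.I
    have hE := (hi.cexp.mul_const (φ x)).smul hA
    refine hE.congr_fderiv ?_
    ext v
    simp [derivSymbol, smul_smul]
    ring_nf
    module

theorem decay_zero {a : E × E → V} (ha : HasUniformTemperateGrowth a) (k : ℕ) :
    ∃ (s : Finset (ℕ × ℕ)) (C : ℝ), 0 ≤ C ∧ ∀ (φ : 𝓢(E, ℂ)) (ξ : E),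
      ‖ξ‖ ^ k * ‖oscIntegral a φ ξ‖ ≤ C * s.sup (schwartzSeminormFamily ℂ E ℂ) φ := by
  obtain ⟨N, hN⟩ := ha.seminorm_sliceMul_le
  let q : Seminorm ℂ 𝓢(E, V) :=
    (Finset.Iic (k + N, 0)).sup (schwartzSeminormFamily ℂ E V)
  have hq : Continuous (q.comp (SchwartzMap.fourierTransformCLM ℂ (E := V) (V := E)).toLinearMap) := by
    refine Continuous.comp (g := q) ?_ (SchwartzMap.fourierTransformCLM ℂ).continuous
    refine Finset.sup_induction (p := fun r : Seminorm ℂ 𝓢(E, V) => Continuous r) ?_ ?_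
      fun i _ => (schwartz_withSeminorms ℂ E V).continuous_seminorm i
    · rw [Seminorm.coe_bot]
      exact continuous_const
    · intro r₁ h₁ r₂ h₂
      rw [Seminorm.coe_sup]
      exact h₁.sup h₂
  obtain ⟨t, C₁, -, h₁⟩ := Seminorm.bound_of_continuous (schwartz_withSeminorms ℂ E V) _ hq
  choose s C₂ hC₂ h₂ using hN
  refine ⟨t.sup s, (2 * Real.pi) ^ (k + N) * (2 ^ (k + N) * (C₁ * ∑ m ∈ t, C₂ m)), ?_, fun φ ξ => ?_⟩
  · have : 0 ≤ ∑ m ∈ t, C₂ m := Finset.sum_nonneg fun m _ => hC₂ m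
    positivity
  set S := (t.sup s).sup (schwartzSeminormFamily ℂ E ℂ) φ with hS
  have hS0 : 0 ≤ S := apply_nonneg _ _
  set u := ha.sliceMul ξ φ with hu
  set η : E := -((2 * Real.pi)⁻¹ • ξ) with hη
  have hη' : ‖ξ‖ = 2 * Real.pi * ‖η‖ := by
    have : (0 : ℝ) < 2 * Real.pi := by positivity
    rw [hη, norm_neg, norm_smul, norm_inv, Real.norm_of_nonneg this.le]
    field_simp
  have hdec := SchwartzMap.one_add_le_sup_seminorm_apply (𝕜 := ℂ) (m := (k + N, 0))
    (k := k + N) (n := 0) le_rfl le_rfl (𝓕 u) η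
  rw [norm_iteratedFDeriv_zero, ← oscIntegral_eq ha φ ξ] at hdec
  have hb : q (𝓕 u) ≤ C₁ * ((∑ m ∈ t, C₂ m) * (1 + ‖ξ‖) ^ N * S) := by
    have h3 := Seminorm.le_def.1 h₁ u
    refine (show q (𝓕 u) ≤ C₁ * (t.sup (schwartzSeminormFamily ℂ E V) u) from h3).trans ?_
    gcongr
    refine Seminorm.finset_sup_apply_le (by
      have : 0 ≤ ∑ m ∈ t, C₂ m := Finset.sum_nonneg fun m _ => hC₂ m
      positivity) fun m hm => ?_
    refine (h₂ m φ ξ).trans ?_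
    have h4 : C₂ m ≤ ∑ m ∈ t, C₂ m := Finset.single_le_sum (fun i _ => hC₂ i) hm
    have h5 : (s m).sup (schwartzSeminormFamily ℂ E ℂ) φ ≤ S :=
      Seminorm.le_def.1 (Finset.sup_mono (Finset.le_sup (f := s) hm)) φ
    have := hC₂ m
    have h9 : 0 ≤ ∑ m ∈ t, C₂ m := this.trans h4
    gcongr
  have h6 : (1 + ‖ξ‖) ^ (k + N) ≤ (2 * Real.pi) ^ (k + N) * (1 + ‖η‖) ^ (k + N) := by
    rw [← mul_pow, hη']
    have : (1 : ℝ) ≤ 2 * Real.pi := by nlinarith [Real.pi_gt_three]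
    gcongr
    linarith
  have h7 : (1 + ‖ξ‖) ^ N * ((1 + ‖ξ‖) ^ k * ‖oscIntegral a φ ξ‖) ≤ (1 + ‖ξ‖) ^ N *
      ((2 * Real.pi) ^ (k + N) * (2 ^ (k + N) * (C₁ * ∑ m ∈ t, C₂ m)) * S) := by
    calc (1 + ‖ξ‖) ^ N * ((1 + ‖ξ‖) ^ k * ‖oscIntegral a φ ξ‖)
        = (1 + ‖ξ‖) ^ (k + N) * ‖oscIntegral a φ ξ‖ := by rw [pow_add]; ring
      _ ≤ (2 * Real.pi) ^ (k + N) * (1 + ‖η‖) ^ (k + N) * ‖oscIntegral a φ ξ‖ := by gcongr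
      _ = (2 * Real.pi) ^ (k + N) * ((1 + ‖η‖) ^ (k + N) * ‖oscIntegral a φ ξ‖) := by ring
      _ ≤ (2 * Real.pi) ^ (k + N) * (2 ^ (k + N) * q (𝓕 u)) :=
          mul_le_mul_of_nonneg_left hdec (by positivity)
      _ ≤ (2 * Real.pi) ^ (k + N) * (2 ^ (k + N) *
            (C₁ * ((∑ m ∈ t, C₂ m) * (1 + ‖ξ‖) ^ N * S))) := by gcongr
      _ = _ := by ring
  have h8 := le_of_mul_le_mul_left h7 (by positivity)
  refine le_trans ?_ h8
  gcongr
  linarith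

theorem contDiff_oscIntegral (φ : 𝓢(E, ℂ)) (n : ℕ) :
    ∀ {V : Type} [NormedAddCommGroup V] [NormedSpace ℂ V] {a : E × E → V},
      HasUniformTemperateGrowth a → ContDiff ℝ n (oscIntegral a φ) := by
  induction n with
  | zero =>
    intro V _ _ a ha
    exact contDiff_zero.2 (continuous_iff_continuousAt.2 fun ξ =>
      (ha.hasFDerivAt_oscIntegral φ ξ).continuousAt)
  | succ n ih =>
    intro V _ _ a ha
    exact contDiff_succ_iff_hasFDerivAt.2
      ⟨oscIntegral (derivSymbol a) φ, ih ha.derivSymbol_growth, ha.hasFDerivAt_oscIntegral φ⟩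

theorem decay (k n : ℕ) :
    ∀ {V : Type} [NormedAddCommGroup V] [NormedSpace ℂ V] {a : E × E → V},
      HasUniformTemperateGrowth a → ∃ (s : Finset (ℕ × ℕ)) (C : ℝ), 0 ≤ C ∧
        ∀ (φ : 𝓢(E, ℂ)) (ξ : E), ‖ξ‖ ^ k * ‖iteratedFDeriv ℝ n (oscIntegral a φ) ξ‖ ≤
          C * s.sup (schwartzSeminormFamily ℂ E ℂ) φ := by
  induction n with
  | zero =>
    intro V _ _ a ha
    simpa only [norm_iteratedFDeriv_zero] using ha.decay_zero k
  | succ n ih =>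
    intro V _ _ a ha
    obtain ⟨s, C, hC, h⟩ := ih ha.derivSymbol_growth
    refine ⟨s, C, hC, fun φ ξ => ?_⟩
    have e : _root_.fderiv ℝ (oscIntegral a φ) = oscIntegral (derivSymbol a) φ :=
      funext fun ξ => (ha.hasFDerivAt_oscIntegral φ ξ).fderiv
    rw [← norm_iteratedFDeriv_fderiv, e]
    exact h φ ξ

/-- `φ ↦ ∫ e^{i⟨x,ξ⟩} a(x,ξ) φ(x) dx` as a continuous linear map on Schwartz space. -/
def oscIntegralCLM (a : E × E → ℂ) (ha : HasUniformTemperateGrowth a) : 𝓢(E, ℂ) →L[ℂ] 𝓢(E, ℂ) :=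
  SchwartzMap.mkCLM (fun φ => oscIntegral a φ)
    (fun φ ψ ξ => by
      simp only [oscIntegral, _root_.add_apply, mul_add, add_smul]
      exact integral_add (ha.integrable_integrand φ ξ) (ha.integrable_integrand ψ ξ))
    (fun c φ ξ => by
      simp only [oscIntegral, _root_.smul_apply, smul_eq_mul, RingHom.id_apply]
      rw [← integral_const_mul]
      congr 1
      ext x
      ring)
    (fun φ => contDiff_infty.2 fun n => contDiff_oscIntegral φ n ha)
    (fun n => ha.decay n.1 n.2)

end osc
end HasUniformTemperateGrowth

end smoothness

/-- The Euclidean space `ℝ^d`. -/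
abbrev Rd (d : ℕ) : Type := EuclideanSpace ℝ (Fin d)

section fourier
variable {d : ℕ}

/-- `(2π)^{-d/2}`. -/
def fourierConst (d : ℕ) : ℝ := (2 * Real.pi) ^ (-(d : ℝ) / 2)

/-- The dilation `ξ ↦ ξ / (2π)`. -/
def scaling (d : ℕ) : Rd d ≃L[ℝ] Rd d :=
  ContinuousLinearEquiv.smulLeft (Units.mk0 (2 * Real.pi)⁻¹ (by positivity))

/-- The Fourier transform `φ̂(ξ) = (2π)^{-d/2} ∫ φ(x) e^{-i⟨x,ξ⟩} dx` on the Schwartz space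
(see `angularFourier_apply`). Mathlib's transform has the phase `e^{-2πi⟨x,ξ⟩}`, which accounts for
the dilation. -/
def angularFourier : 𝓢(Rd d, ℂ) →L[ℂ] 𝓢(Rd d, ℂ) :=
  (fourierConst d : ℂ) • (SchwartzMap.compCLMOfContinuousLinearEquiv ℂ (scaling d) ∘L
    SchwartzMap.fourierTransformCLM ℂ)

theorem angularFourier_apply (φ : 𝓢(Rd d, ℂ)) (ξ : Rd d) :
    angularFourier φ ξ =
      fourierConst d * ∫ x, Complex.exp (-Complex.I * (inner ℝ x ξ : ℝ)) * φ x := by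
  have h : angularFourier φ ξ = fourierConst d * (𝓕 φ) ((2 * Real.pi)⁻¹ • ξ) := rfl
  rw [h, SchwartzMap.fourier_coe, Real.fourier_eq]
  congr 2
  ext x
  rw [Circle.smul_def, smul_eq_mul]
  congr 1
  rw [Real.fourierChar_apply]
  congr 1
  simp only [inner_smul_right]
  push_cast
  have : (Real.pi : ℂ) ≠ 0 := by exact_mod_cast Real.pi_ne_zero
  field_simp

/-- The Fourier transform on tempered distributions, `⟨û, φ⟩ = ⟨u, φ̂⟩`. -/
def distFourier : 𝓢'(Rd d, ℂ) →L[ℂ] 𝓢'(Rd d, ℂ) :=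
  PointwiseConvergenceCLM.precomp ℂ angularFourier

/-- The transpose of the operator `Op(a)`,
`φ ↦ (y ↦ (2π)^{-d} ∬ a(x,ξ) φ(x) e^{i⟨x-y,ξ⟩} dx dξ)`, as a continuous map on the Schwartz space. -/
def opTranspose (a : Rd d × Rd d → ℂ) (ha : HasUniformTemperateGrowth a) :
    𝓢(Rd d, ℂ) →L[ℂ] 𝓢(Rd d, ℂ) :=
  angularFourier ∘L ((fourierConst d : ℂ) • ha.oscIntegralCLM a)

/-- The pseudo-differential operator `Op(a)` (Kohn-Nirenberg quantization) as a continuous operator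
on tempered distributions, `⟨Op(a) u, φ⟩ = ⟨u, Op(a)ᵗ φ⟩`. By `op_toTemperedDistribution` it extends
the operator `(Op(a)ψ)(x) = (2π)^{-d/2} ∫ a(x,ξ) ψ̂(ξ) e^{i⟨x,ξ⟩} dξ` from Schwartz functions, and
such a continuous extension is unique since Schwartz functions are dense. -/
def op (a : Rd d × Rd d → ℂ) (ha : HasUniformTemperateGrowth a) :
    𝓢'(Rd d, ℂ) →L[ℂ] 𝓢'(Rd d, ℂ) :=
  PointwiseConvergenceCLM.precomp ℂ (opTranspose a ha)

theorem integral_angularFourier_mul (φ ψ : 𝓢(Rd d, ℂ)) :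
    ∫ x, angularFourier φ x * ψ x = ∫ x, φ x * angularFourier ψ x := by
  let L : Rd d →ₗ[ℝ] Rd d →ₗ[ℝ] ℝ := (2 * Real.pi)⁻¹ • innerₗ (Rd d)
  have hL : ∀ (φ : 𝓢(Rd d, ℂ)) (ξ : Rd d), angularFourier φ ξ =
      fourierConst d * VectorFourier.fourierIntegral Real.fourierChar volume L φ ξ := by
    intro φ ξ
    have h : angularFourier φ ξ = fourierConst d * (𝓕 φ) ((2 * Real.pi)⁻¹ • ξ) := rfl
    rw [h, SchwartzMap.fourier_coe, Real.fourier_eq]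
    simp [VectorFourier.fourierIntegral, L, inner_smul_right]
  have h := VectorFourier.integral_fourierIntegral_smul_eq_flip (e := Real.fourierChar)
    (μ := volume) (ν := volume) (L := L) Real.continuous_fourierChar
    (by simp only [L, LinearMap.smul_apply, innerₗ_apply_apply]; fun_prop) (f := φ) (g := ψ) φ.integrable ψ.integrable
  have hflip : L.flip = L := by
    ext x y
    simp [L, real_inner_comm]
  rw [hflip] at h
  simp only [hL, mul_assoc, smul_eq_mul, mul_left_comm _ (fourierConst d : ℂ)] at h ⊢
  rw [integral_const_mul, integral_const_mul, h]

/-- On a Schwartz function `ψ`, the distribution `Op(a)ψ` is given by the usual integral formula. -/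
theorem op_toTemperedDistribution (a : Rd d × Rd d → ℂ) (ha : HasUniformTemperateGrowth a)
    (ψ φ : 𝓢(Rd d, ℂ)) :
    op a ha (SchwartzMap.toTemperedDistributionCLM (Rd d) ℂ volume ψ) φ =
      ∫ x, φ x * (fourierConst d * ∫ ξ, Complex.exp (Complex.I * (inner ℝ x ξ : ℝ)) *
        a (x, ξ) * angularFourier ψ ξ) := by
  have h : op a ha (SchwartzMap.toTemperedDistributionCLM (Rd d) ℂ volume ψ) φ =
      ∫ x, angularFourier ((fourierConst d : ℂ) • ha.oscIntegralCLM a φ) x * ψ x :=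
    SchwartzMap.toTemperedDistributionCLM_apply_apply volume ψ _
  rw [h, integral_angularFourier_mul]
  have h2 : ∀ ξ, ((fourierConst d : ℂ) • ha.oscIntegralCLM a φ) ξ * angularFourier ψ ξ =
      ∫ x, fourierConst d * φ x * (Complex.exp (Complex.I * (inner ℝ x ξ : ℝ)) *
        a (x, ξ) * angularFourier ψ ξ) := by
    intro ξ
    have : ((fourierConst d : ℂ) • ha.oscIntegralCLM a φ) ξ =
      fourierConst d * ∫ x, (Complex.exp (Complex.I * (inner ℝ x ξ : ℝ)) * φ x) • a (x, ξ) := rfl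
    rw [this, ← integral_const_mul, ← integral_mul_const]
    congr 1
    ext x
    simp only [smul_eq_mul]
    ring
  simp only [h2]
  rw [integral_integral_swap]
  · congr 1
    ext x
    rw [integral_const_mul]
    ring
  · obtain ⟨hs, N, hN⟩ := ha
    obtain ⟨C, hC, hb⟩ := hN 0
    simp only [norm_iteratedFDeriv_zero] at hb
    have h3 := ((HasUniformTemperateGrowth.integrable_weight_mul (angularFourier ψ) N).mul_prod
      (HasUniformTemperateGrowth.integrable_weight_mul φ N)).const_mul
      (‖(fourierConst d : ℂ)‖ * C)
    have c1 := hs.continuous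
    have c2 := φ.continuous
    have c3 := (angularFourier ψ).continuous
    refine h3.mono' ?_ (Filter.Eventually.of_forall fun z => ?_)
    · refine Continuous.aestronglyMeasurable ?_
      fun_prop
    · obtain ⟨ξ, x⟩ := z
      simp only [Function.uncurry_apply_pair, norm_mul, HasUniformTemperateGrowth.norm_exp_I, one_mul]
      have h4 : 1 + ‖(x, ξ)‖ ≤ (1 + ‖x‖) * (1 + ‖ξ‖) := by
        have h5 : ‖(x, ξ)‖ ≤ ‖x‖ + ‖ξ‖ := by simp [Prod.norm_def]
        nlinarith [norm_nonneg x, norm_nonneg ξ]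
      calc ‖(fourierConst d : ℂ)‖ * ‖φ x‖ * (‖a (x, ξ)‖ * ‖angularFourier ψ ξ‖)
          ≤ ‖(fourierConst d : ℂ)‖ * ‖φ x‖ *
            (C * ((1 + ‖x‖) * (1 + ‖ξ‖)) ^ N * ‖angularFourier ψ ξ‖) := by
            gcongr
            refine (hb _).trans ?_
            gcongr
        _ = _ := by rw [mul_pow]; ring

end fourier

/-! ### Weights and symbol classes -/

/-- The class `𝒫` of polynomially moderate weights. Boundedness on bounded sets is automatic:
`ω y ≤ C * ω 0 * (1 + ‖y‖) ^ N`. -/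
structure IsPolyModerate {F : Type*} [NormedAddCommGroup F] [MeasurableSpace F] (ω : F → ℝ) :
    Prop where
  measurable : Measurable ω
  pos : ∀ x, 0 < ω x
  moderate : ∃ (C : ℝ) (N : ℕ), ∀ x y, ω (x + y) ≤ C * ω x * (1 + ‖y‖) ^ N

/-- Even submultiplicative weights in `𝒫`. -/
structure IsSubmultiplicativeWeight {F : Type*} [NormedAddCommGroup F] [MeasurableSpace F]
    (v : F → ℝ) : Prop where
  polyModerate : IsPolyModerate v
  even : ∀ x, v (-x) = v x
  submul : ∃ C : ℝ, ∀ x y, v (x + y) ≤ C * v x * v y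

/-- `⟨ξ⟩ = (1 + |ξ|²)^{1/2}`. -/
def japaneseBracket {d : ℕ} (ξ : Rd d) : ℝ := √(1 + ‖ξ‖ ^ 2)

/-- The coordinate directions of phase space: `inl i` is the `i`-th position direction and `inr j`
the `j`-th frequency direction. -/
def coordDir {d : ℕ} : Fin d ⊕ Fin d → Rd d × Rd d
  | Sum.inl i => (EuclideanSpace.single i 1, 0)
  | Sum.inr j => (0, EuclideanSpace.single j 1)

/-- The symbol class of order `(ρ, δ)` with weight `ω`: smooth functions with
`|∂_x^α ∂_ξ^β a(x,ξ)| ≤ C_{αβ} ω(x,ξ) ⟨ξ⟩^{-ρ|β| + δ|α|}` for all multi-indices. A list `r` of `k`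
coordinate directions encodes the partial derivative `∂_x^α ∂_ξ^β` with `|α|` the number of position
directions and `|β|` the number of frequency directions in `r`. -/
def SymbolClass {d : ℕ} {V : Type*} [NormedAddCommGroup V] [NormedSpace ℝ V] (ρ δ : ℝ)
    (ω : Rd d × Rd d → ℝ) (a : Rd d × Rd d → V) : Prop :=
  ContDiff ℝ (⊤ : ℕ∞) a ∧ ∀ (k : ℕ) (r : Fin k → Fin d ⊕ Fin d), ∃ C : ℝ, ∀ x ξ : Rd d,
    ‖iteratedFDeriv ℝ k a (x, ξ) (fun l => coordDir (r l))‖ ≤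
      C * ω (x, ξ) * japaneseBracket ξ ^
        (-ρ * (Finset.univ.filter fun l => (r l).isRight).card +
          δ * (Finset.univ.filter fun l => (r l).isLeft).card)

/-- The class `𝒫_{ρ,δ}`: smooth weights in `𝒫` which satisfy the symbol estimates with respect to
themselves. -/
def WeightClass {d : ℕ} (ρ δ : ℝ) (ω : Rd d × Rd d → ℝ) : Prop :=
  IsPolyModerate ω ∧ SymbolClass ρ δ ω ω

theorem one_le_japaneseBracket {d : ℕ} (ξ : Rd d) : 1 ≤ japaneseBracket ξ :=
  Real.one_le_sqrt.2 (by nlinarith [sq_nonneg ‖ξ‖])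

/-- The coordinate of `z` in the direction `coordDir s`. -/
def phaseCoord {d : ℕ} (z : Rd d × Rd d) : Fin d ⊕ Fin d → ℝ
  | Sum.inl i => z.1 i
  | Sum.inr j => z.2 j

theorem abs_phaseCoord_le {d : ℕ} (z : Rd d × Rd d) (s : Fin d ⊕ Fin d) :
    |phaseCoord z s| ≤ ‖z‖ := by
  cases s with
  | inl i => exact (PiLp.norm_apply_le z.1 i).trans (norm_fst_le z)
  | inr j => exact (PiLp.norm_apply_le z.2 j).trans (norm_snd_le z)

theorem sum_phaseCoord {d : ℕ} (z : Rd d × Rd d) : ∑ s, phaseCoord z s • coordDir s = z := by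
  ext i
  · simp [phaseCoord, coordDir, Fintype.sum_sum_type, Prod.fst_sum, Finset.sum_apply,
      Pi.single_apply]
  · simp [phaseCoord, coordDir, Fintype.sum_sum_type, Prod.snd_sum, Finset.sum_apply,
      Pi.single_apply]

theorem norm_multilinear_le {d k : ℕ} {V : Type*} [NormedAddCommGroup V] [NormedSpace ℝ V]
    (D : (Rd d × Rd d) [×k]→L[ℝ] V) :
    ‖D‖ ≤ ∑ r : Fin k → Fin d ⊕ Fin d, ‖D fun l => coordDir (r l)‖ := by
  refine D.opNorm_le_bound (Finset.sum_nonneg fun _ _ => norm_nonneg _) fun u => ?_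
  have e : D u = ∑ r : Fin k → Fin d ⊕ Fin d,
      (∏ l, phaseCoord (u l) (r l)) • D fun l => coordDir (r l) := by
    conv_lhs => rw [← funext fun l => sum_phaseCoord (u l)]
    rw [D.map_sum]
    simp only [D.map_smul_univ]
  rw [e, Finset.sum_mul]
  refine (norm_sum_le _ _).trans (Finset.sum_le_sum fun r _ => ?_)
  rw [norm_smul, mul_comm, norm_prod]
  gcongr with l
  exact abs_phaseCoord_le _ _

theorem SymbolClass.hasUniformTemperateGrowth {d : ℕ} {V : Type*} [NormedAddCommGroup V]
    [NormedSpace ℝ V] {ρ : ℝ} {ω : Rd d × Rd d → ℝ} {a : Rd d × Rd d → V}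
    (ha : SymbolClass ρ 0 ω a) (hρ : 0 ≤ ρ) (hω : IsPolyModerate ω) :
    HasUniformTemperateGrowth a := by
  obtain ⟨C₀, N, hN⟩ := hω.moderate
  refine ⟨ha.1, N, fun k => ?_⟩
  choose C hC using ha.2 k
  have hC₀ : 0 < C₀ * ω 0 := by
    have h := hN 0 0
    simp only [add_zero, norm_zero, one_pow, mul_one] at h
    exact (hω.pos 0).trans_le h
  refine ⟨∑ r, |C r| * (C₀ * ω 0), by positivity, fun z => ?_⟩
  rw [Finset.sum_mul]
  refine (norm_multilinear_le _).trans (Finset.sum_le_sum fun r _ => ?_)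
  refine (hC r z.1 z.2).trans ?_
  have h1 : ω z ≤ C₀ * ω 0 * (1 + ‖z‖) ^ N := by simpa using hN 0 z
  have h2 : japaneseBracket z.2 ^
        (-ρ * ((Finset.univ.filter fun l => (r l).isRight).card : ℝ) +
          0 * (Finset.univ.filter fun l => (r l).isLeft).card) ≤ 1 := by
    refine Real.rpow_le_one_of_one_le_of_nonpos (one_le_japaneseBracket _) ?_
    have := mul_nonneg hρ (Nat.cast_nonneg (α := ℝ) (Finset.univ.filter fun l => (r l).isRight).card)
    linarith
  have h0 : 0 ≤ japaneseBracket z.2 := zero_le_one.trans (one_le_japaneseBracket _)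
  have h3 := (hω.pos z).le
  calc C r * ω z * _ ≤ |C r| * ω z * 1 := by
        gcongr
        exact le_abs_self _
    _ ≤ |C r| * (C₀ * ω 0 * (1 + ‖z‖) ^ N) * 1 := by gcongr
    _ = _ := by ring

/-! ### Translation invariant BF-spaces -/

/-- The tempered distribution `u` is the function `g`. -/
def IsRepresentedBy {d : ℕ} (u : 𝓢'(Rd d, ℂ)) (g : Rd d → ℂ) : Prop :=
  ∀ ψ : 𝓢(Rd d, ℂ), Integrable (fun x => g x * ψ x) volume ∧ u ψ = ∫ x, g x * ψ x

/-- A Banach space of (classes of) complex-valued measurable functions is a Banach space `B` with an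
injective linear map `ι` into the measurable functions modulo equality almost everywhere. It is a
translation invariant BF-space with respect to `v` if `𝓢 ⊆ B ⊆ 𝓢'` continuously, if translations act
on it with norm at most `C v(x)`, and if it is solid. -/
structure IsTranslationInvariantBFSpace {d : ℕ} {B : Type*} [NormedAddCommGroup B]
    [NormedSpace ℂ B] [CompleteSpace B] (v : Rd d → ℝ)
    (ι : B →ₗ[ℂ] (Rd d →ₘ[(volume : Measure (Rd d))] ℂ)) : Prop where
  weight : IsSubmultiplicativeWeight v
  injective : Function.Injective ι
  schwartz_embedding : ∃ j : 𝓢(Rd d, ℂ) →L[ℂ] B, ∀ φ, ι (j φ) =ᵐ[volume] φ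
  tempered_embedding : ∃ k : B →L[ℂ] 𝓢'(Rd d, ℂ), ∀ g, IsRepresentedBy (k g) (ι g)
  translation : ∃ C : ℝ, ∀ (g : B) (x : Rd d), ∃ h : B,
    ι h =ᵐ[volume] (fun y => ι g (y - x)) ∧ ‖h‖ ≤ C * v x * ‖g‖
  solid : ∃ C : ℝ, ∀ (f : Rd d → ℂ) (g : B), LocallyIntegrable f volume →
    (∀ᵐ x ∂volume, ‖f x‖ ≤ ‖ι g x‖) → ∃ h : B, ι h =ᵐ[volume] f ∧ ‖h‖ ≤ C * ‖g‖

/-! ### Wave-front sets and characteristic sets -/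

/-- Open cones in `ℝ^d \ 0`. -/
structure IsOpenCone {d : ℕ} (Γ : Set (Rd d)) : Prop where
  isOpen : IsOpen Γ
  zero_notMem : (0 : Rd d) ∉ Γ
  smul_mem : ∀ ξ ∈ Γ, ∀ t : ℝ, 0 < t → t • ξ ∈ Γ

section wavefront

variable {d : ℕ} {B : Type*} [NormedAddCommGroup B] [NormedSpace ℂ B]

/-- The seminorm `|u|_{𝓕B(ω,Γ)_y} = ‖û ω(y,·) χ_Γ‖_B`, which is `∞` if the function
`û ω(y,·) χ_Γ` does not belong to `B`. -/
def coneSeminorm (ι : B →ₗ[ℂ] (Rd d →ₘ[(volume : Measure (Rd d))] ℂ)) (ω : Rd d × Rd d → ℝ)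
    (Γ : Set (Rd d)) (y : Rd d) (u : 𝓢'(Rd d, ℂ)) : ℝ≥0∞ :=
  ⨅ (g : Rd d → ℂ) (_ : IsRepresentedBy (distFourier u) g) (h : B)
    (_ : ι h =ᵐ[volume] Γ.indicator fun ξ => g ξ * (ω (y, ξ) : ℂ)), ‖h‖ₑ

/-- The regular directions `Θ(u)`. For moderate `ω`, finiteness of the seminorm does not depend on
the base point `y`. -/
def regularDirections (ι : B →ₗ[ℂ] (Rd d →ₘ[(volume : Measure (Rd d))] ℂ))
    (ω : Rd d × Rd d → ℝ) (u : 𝓢'(Rd d, ℂ)) : Set (Rd d) :=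
  {ξ | ∃ Γ, IsOpenCone Γ ∧ ξ ∈ Γ ∧ ∀ y, coneSeminorm ι ω Γ y u < ∞}

/-- The complement `Σ(u)` of `Θ(u)` in `ℝ^d \ 0`. -/
def singularDirections (ι : B →ₗ[ℂ] (Rd d →ₘ[(volume : Measure (Rd d))] ℂ))
    (ω : Rd d × Rd d → ℝ) (u : 𝓢'(Rd d, ℂ)) : Set (Rd d) :=
  {0}ᶜ \ regularDirections ι ω u

/-- The wave-front set `WF_{𝓕B(ω)}(f)`: the pairs `(x₀, ξ₀)`, `ξ₀ ≠ 0`, such that `ξ₀ ∈ Σ(φ f)` for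
every `φ ∈ C_0^∞` with `φ(x₀) ≠ 0`. -/
def waveFrontSet (ι : B →ₗ[ℂ] (Rd d →ₘ[(volume : Measure (Rd d))] ℂ))
    (ω : Rd d × Rd d → ℝ) (f : 𝓢'(Rd d, ℂ)) : Set (Rd d × Rd d) :=
  {p | p.2 ≠ 0 ∧ ∀ φ : Rd d → ℂ, ContDiff ℝ (⊤ : ℕ∞) φ → HasCompactSupport φ → φ p.1 ≠ 0 →
    p.2 ∈ singularDirections ι ω (TemperedDistribution.smulLeftCLM ℂ φ f)}

/-- `a` is `ψ`-invertible with respect to `ω₀` at `(x₀, ξ₀)`. -/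
def IsPsiInvertible (ω₀ : Rd d × Rd d → ℝ) (a : Rd d × Rd d → ℂ) (x₀ ξ₀ : Rd d) : Prop :=
  ∃ X ∈ 𝓝 x₀, ∃ Γ, IsOpenCone Γ ∧ ξ₀ ∈ Γ ∧ ∃ R C : ℝ, 0 < R ∧ 0 < C ∧
    ∀ x ∈ X, ∀ ξ ∈ Γ, R ≤ ‖ξ‖ → C * ω₀ (x, ξ) ≤ ‖a (x, ξ)‖

/-- The characteristic set `Char_{(ω₀)}(a)`. -/
def charSet (ω₀ : Rd d × Rd d → ℝ) (a : Rd d × Rd d → ℂ) : Set (Rd d × Rd d) :=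
  {p | p.2 ≠ 0 ∧ ¬ IsPsiInvertible ω₀ a p.1 p.2}

end wavefront

end FourierBF

end

/-! Solidity of `B` turns finiteness of a cone seminorm into a pointwise statement: `û ω(0,·) χ_Γ`
is bounded almost everywhere by the modulus of an element of `B` (`IsDominated`,
`mem_regularDirections_iff`). For `u = φ f` with `φ` a test function, `û` is the function
`localFourier φ f` (`localFourier_spec`), so the theorem reduces to pointwise estimates between such
functions.

These estimates have the form `|∫ g(η) k(ξ,η) dη|` with `g = localFourier χ f` and `k` rapidly
decreasing in `ξ - η`, and such an integral is at most a constant times the Peetre maximal function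
of `g` at `ξ`. The analytic core is `IsDominated.peetre`: domination of `g w` on a cone passes to
its maximal function on a smaller cone. Since `χ f` has compact support, `g` reproduces itself by
convolution with a Schwartz function and hardly oscillates at small scale. Its maximal function at
`ξ` is therefore controlled by one value `g(ξ + q)` with `q` in a fine lattice, and weighted lattice
translates can be summed in `B` (`IsDominated.of_translates`). If `ξ + q` leaves the larger cone,
then `1 + |ξ|` is bounded by a constant times `1 + |q|`, and the factor `(1 + |q|)^{-N}` beats the
polynomial growth of `g`.

First inclusion (`isDominated_op`): by pseudolocality (`FiniteOrder.op_sub_op_cutoff_decay`) `f` may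
be replaced by `χ f` with `χ = 1` near the support of the test function. The Fourier transform of
the localized `Op(a)(χ f)` is then an integral as above, with a kernel of size `ω₀(0,ξ)`.

Second inclusion: no operator inverse to `Op(a)` is built. For each elliptic frequency `ξ` one takes
a test function `b_ξ` with `b_ξ(x) a(x,ξ) = ω₀(0,ξ) φ(x)`, uniformly smooth in `ξ` after
normalization by the weight (`SymbolClass.exists_parametrix`). Testing `Op(a)(χ f)` on `e^{-i⟨x,ξ⟩}
b_ξ` gives a multiple of `ω₀(0,ξ)` times the Fourier transform of `φ f`, plus an error from `a(x,η)
- a(x,ξ)` which is smaller by `(1 + |ξ|)^{-min ρ 1}` (`exists_norm_localFourier_le`). Thus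
regularity of `f` with a loss of `s + min ρ 1` orders improves to a loss of `s`
(`IsRegularNear.improve`). Every tempered distribution is regular with some finite loss, so finitely
many improvements suffice. -/

noncomputable section

namespace FourierBF

open scoped ContDiff

/-! ### Coordinate derivatives -/

section coordinate
variable {d : ℕ} {V : Type*} [NormedAddCommGroup V] [NormedSpace ℝ V]

/-- The partial derivative in the `j`-th coordinate direction. -/
def partialDeriv (j : Fin d) (F : Rd d → V) (x : Rd d) : V :=
  fderiv ℝ F x (EuclideanSpace.single j 1)

theorem sum_coord_smul_single (v : Rd d) : ∑ j, v j • EuclideanSpace.single j (1 : ℝ) = v := by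
  ext i
  simp [Finset.sum_apply, Pi.single_apply]

theorem _root_.ContDiff.partialDeriv {F : Rd d → V} (hF : ContDiff ℝ ∞ F) (j : Fin d) :
    ContDiff ℝ ∞ (partialDeriv j F) :=
  (hF.fderiv_right (m := ∞) (by simp)).clm_apply contDiff_const

theorem iteratedFDeriv_partialDeriv {F : Rd d → V} (hF : ContDiff ℝ ∞ F) (n : ℕ) (j : Fin d)
    (x : Rd d) (m : Fin n → Rd d) :
    iteratedFDeriv ℝ n (partialDeriv j F) x m =
      iteratedFDeriv ℝ n (fderiv ℝ F) x m (EuclideanSpace.single j 1) := by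
  have h : ContDiff ℝ ∞ (fderiv ℝ F) := hF.fderiv_right (m := ∞) (by simp)
  exact iteratedFDeriv_clm_apply_const_apply h (i := n) (mod_cast le_top)

/-- Expanding the last argument of the multilinear map in the standard basis gives the bound. It
drives the inductions on the order of differentiation below: only first partial derivatives need to
be computed. -/
theorem norm_iteratedFDeriv_succ_le_sum {F : Rd d → V} (hF : ContDiff ℝ ∞ F) (n : ℕ) (x : Rd d) :
    ‖iteratedFDeriv ℝ (n + 1) F x‖ ≤ ∑ j, ‖iteratedFDeriv ℝ n (partialDeriv j F) x‖ := by
  refine ContinuousMultilinearMap.opNorm_le_bound (Finset.sum_nonneg fun _ _ => norm_nonneg _)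
    fun m => ?_
  rw [iteratedFDeriv_succ_apply_right]
  conv_lhs => rw [← sum_coord_smul_single (m (Fin.last n)), map_sum]
  rw [Finset.sum_mul]
  refine (norm_sum_le _ _).trans (Finset.sum_le_sum fun j _ => ?_)
  rw [map_smul, ← iteratedFDeriv_partialDeriv hF, norm_smul, Fin.prod_univ_castSucc]
  calc ‖m (Fin.last n) j‖ * ‖iteratedFDeriv ℝ n (partialDeriv j F) x (Fin.init m)‖
      ≤ ‖m (Fin.last n)‖ * (‖iteratedFDeriv ℝ n (partialDeriv j F) x‖ * ∏ i, ‖Fin.init m i‖) := by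
        gcongr
        · exact PiLp.norm_apply_le _ _
        · exact ContinuousMultilinearMap.le_opNorm _ _
    _ = _ := by simp only [Fin.init]; ring

theorem norm_iteratedFDeriv_partialDeriv_le {F : Rd d → V} (hF : ContDiff ℝ ∞ F) (n : ℕ)
    (j : Fin d) (x : Rd d) :
    ‖iteratedFDeriv ℝ n (partialDeriv j F) x‖ ≤ ‖iteratedFDeriv ℝ (n + 1) F x‖ := by
  refine ContinuousMultilinearMap.opNorm_le_bound (norm_nonneg _) fun m => ?_
  rw [iteratedFDeriv_partialDeriv hF, ← norm_iteratedFDeriv_fderiv]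
  refine (ContinuousLinearMap.le_opNorm _ _).trans ?_
  simp only [PiLp.norm_single, norm_one, mul_one]
  exact ContinuousMultilinearMap.le_opNorm _ _

end coordinate

/-! ### Families of smooth functions with uniform bounds -/

section families
variable {d : ℕ} {P : Type*}

/-- A family of smooth functions whose derivatives up to order `N` are bounded uniformly in the
parameter. -/
structure UnifSmoothUpTo (N : ℕ) (H : P → Rd d → ℂ) : Prop where
  smooth : ∀ p, ContDiff ℝ ∞ (H p)
  bound : ∀ n ≤ N, ∃ C, ∀ p x, ‖iteratedFDeriv ℝ n (H p) x‖ ≤ C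

/-- A family of smooth functions whose derivatives are bounded uniformly in the parameter. -/
def UnifSmooth (H : P → Rd d → ℂ) : Prop := ∀ N, UnifSmoothUpTo N H

theorem UnifSmooth.smooth {H : P → Rd d → ℂ} (h : UnifSmooth H) (p : P) : ContDiff ℝ ∞ (H p) :=
  (h 0).smooth p

theorem UnifSmooth.exists_bound {H : P → Rd d → ℂ} (h : UnifSmooth H) (n : ℕ) :
    ∃ C, 0 ≤ C ∧ ∀ p x, ‖iteratedFDeriv ℝ n (H p) x‖ ≤ C := by
  obtain ⟨C, hC⟩ := (h n).bound n le_rfl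
  exact ⟨|C|, abs_nonneg _, fun p x => (hC p x).trans (le_abs_self _)⟩

theorem UnifSmooth.mk' {H : P → Rd d → ℂ} (hs : ∀ p, ContDiff ℝ ∞ (H p))
    (hb : ∀ n, ∃ C, ∀ p x, ‖iteratedFDeriv ℝ n (H p) x‖ ≤ C) : UnifSmooth H :=
  fun _ => ⟨hs, fun n _ => hb n⟩

theorem UnifSmoothUpTo.mul {N : ℕ} {H K : P → Rd d → ℂ} (hH : UnifSmoothUpTo N H)
    (hK : UnifSmoothUpTo N K) : UnifSmoothUpTo N (fun p x => H p x * K p x) := by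
  refine ⟨fun p => (hH.smooth p).mul (hK.smooth p), fun n hn => ?_⟩
  have h1 : ∀ i, ∃ C, i ≤ N → ∀ p x, ‖iteratedFDeriv ℝ i (H p) x‖ ≤ C := fun i => by
    by_cases h : i ≤ N
    · obtain ⟨C, hC⟩ := hH.bound i h
      exact ⟨C, fun _ => hC⟩
    · exact ⟨0, fun h' => absurd h' h⟩
  have h2 : ∀ i, ∃ C, i ≤ N → ∀ p x, ‖iteratedFDeriv ℝ i (K p) x‖ ≤ C := fun i => by
    by_cases h : i ≤ N
    · obtain ⟨C, hC⟩ := hK.bound i h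
      exact ⟨C, fun _ => hC⟩
    · exact ⟨0, fun h' => absurd h' h⟩
  choose C hC using h1
  choose D hD using h2
  refine ⟨∑ i ∈ Finset.range (n + 1), (n.choose i : ℝ) * C i * D (n - i), fun p x => ?_⟩
  refine (norm_iteratedFDeriv_mul_le (hH.smooth p) (hK.smooth p) x (n := n)
    (mod_cast le_top)).trans (Finset.sum_le_sum fun i hi => ?_)
  have hi' : i ≤ n := by
    have := Finset.mem_range.1 hi
    omega
  have a1 := hC i (hi'.trans hn) p x
  have a2 := hD (n - i) (by omega) p x
  have := (norm_nonneg _).trans a1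
  gcongr

theorem UnifSmooth.mul {H K : P → Rd d → ℂ} (hH : UnifSmooth H) (hK : UnifSmooth K) :
    UnifSmooth (fun p x => H p x * K p x) := fun N => (hH N).mul (hK N)

theorem UnifSmoothUpTo.partialDeriv {N : ℕ} {H : P → Rd d → ℂ} (hH : UnifSmoothUpTo (N + 1) H)
    (j : Fin d) : UnifSmoothUpTo N (fun p => FourierBF.partialDeriv j (H p)) := by
  refine ⟨fun p => (hH.smooth p).partialDeriv j, fun n hn => ?_⟩
  obtain ⟨C, hC⟩ := hH.bound (n + 1) (by omega)
  exact ⟨C, fun p x => (norm_iteratedFDeriv_partialDeriv_le (hH.smooth p) n j x).trans (hC p x)⟩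

theorem UnifSmooth.partialDeriv {H : P → Rd d → ℂ} (hH : UnifSmooth H) (j : Fin d) :
    UnifSmooth (fun p => FourierBF.partialDeriv j (H p)) := fun N => (hH (N + 1)).partialDeriv j

theorem UnifSmoothUpTo.neg {N : ℕ} {H : P → Rd d → ℂ} (hH : UnifSmoothUpTo N H) :
    UnifSmoothUpTo N (fun p x => -H p x) := by
  refine ⟨fun p => (hH.smooth p).neg, fun n hn => ?_⟩
  obtain ⟨C, hC⟩ := hH.bound n hn
  refine ⟨C, fun p x => ?_⟩
  have : iteratedFDeriv ℝ n (fun x => -H p x) x = -iteratedFDeriv ℝ n (H p) x :=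
    iteratedFDeriv_neg_apply
  rw [this, norm_neg]
  exact hC p x

theorem UnifSmooth.neg {H : P → Rd d → ℂ} (hH : UnifSmooth H) : UnifSmooth (fun p x => -H p x) :=
  fun N => (hH N).neg

theorem UnifSmooth.add {H K : P → Rd d → ℂ} (hH : UnifSmooth H) (hK : UnifSmooth K) :
    UnifSmooth (fun p x => H p x + K p x) := by
  refine .mk' (fun p => (hH.smooth p).add (hK.smooth p)) fun n => ?_
  obtain ⟨C, -, hC⟩ := hH.exists_bound n
  obtain ⟨D, -, hD⟩ := hK.exists_bound n
  refine ⟨C + D, fun p x => ?_⟩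
  have : iteratedFDeriv ℝ n (fun x => H p x + K p x) x
      = iteratedFDeriv ℝ n (H p) x + iteratedFDeriv ℝ n (K p) x :=
    iteratedFDeriv_add_apply ((hH.smooth p).contDiffAt.of_le (mod_cast le_top))
      ((hK.smooth p).contDiffAt.of_le (mod_cast le_top))
  rw [this]
  exact (norm_add_le _ _).trans (add_le_add (hC p x) (hD p x))

theorem UnifSmooth.star {H : P → Rd d → ℂ} (hH : UnifSmooth H) :
    UnifSmooth (fun p x => (starRingEnd ℂ) (H p x)) := by
  refine .mk' (fun p => Complex.conjCLE.contDiff.comp (hH.smooth p)) fun n => ?_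
  obtain ⟨C, -, hC⟩ := hH.exists_bound n
  refine ⟨C, fun p x => ?_⟩
  have := Complex.conjLIE.norm_iteratedFDeriv_comp_left (f := H p) x n
  exact (le_of_eq this).trans (hC p x)

theorem UnifSmooth.comp {Q : Type*} {H : P → Rd d → ℂ} (hH : UnifSmooth H) (g : Q → P) :
    UnifSmooth (fun q => H (g q)) :=
  .mk' (fun q => hH.smooth (g q)) fun n =>
    let ⟨C, _, hC⟩ := hH.exists_bound n
    ⟨C, fun q x => hC (g q) x⟩

theorem UnifSmooth.of_hasCompactSupport {h : Rd d → ℂ} (hs : ContDiff ℝ ∞ h)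
    (hc : HasCompactSupport h) : UnifSmooth (fun _ : P => h) := by
  refine .mk' (fun _ => hs) fun n => ?_
  obtain ⟨C, hC⟩ := (hs.of_le (mod_cast le_top)).continuous_iteratedFDeriv'
    (m := n) |>.bounded_above_of_compact_support (hc.iteratedFDeriv n)
  exact ⟨C, fun _ => hC⟩

theorem UnifSmooth.const (c : ℂ) : UnifSmooth (fun (_ : P) (_ : Rd d) => c) := by
  refine .mk' (fun _ => contDiff_const) fun n => ⟨‖c‖, fun p x => ?_⟩
  cases n with
  | zero => simp
  | succ k => simp [iteratedFDeriv_const_of_ne]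

/-- The formula `∂_j(1/H) = -(1/H)² ∂_j H` bounds derivatives of order `N + 1` of `1/H` by those of
order at most `N`. This induction is the reason for the truncated class `UnifSmoothUpTo`. -/
theorem UnifSmooth.inv {H : P → Rd d → ℂ} (hH : UnifSmooth H) {c : ℝ} (hc : 0 < c)
    (hb : ∀ p x, c ≤ ‖H p x‖) : UnifSmooth (fun p x => (H p x)⁻¹) := by
  have h0 : ∀ p x, H p x ≠ 0 := fun p x h => by
    have := hb p x
    rw [h, norm_zero] at this
    linarith
  have hs : ∀ p, ContDiff ℝ ∞ (fun x => (H p x)⁻¹) := fun p => (hH.smooth p).inv (h0 p)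
  intro N
  induction N with
  | zero =>
    refine ⟨hs, fun n hn => ⟨c⁻¹, fun p x => ?_⟩⟩
    obtain rfl : n = 0 := by omega
    rw [norm_iteratedFDeriv_zero, norm_inv]
    exact inv_anti₀ hc (hb p x)
  | succ N ih =>
    refine ⟨hs, fun n hn => ?_⟩
    rcases n with _ | n
    · exact ih.bound 0 (by omega)
    have hd : ∀ j, UnifSmoothUpTo N (fun p => FourierBF.partialDeriv j (fun x => (H p x)⁻¹)) := by
      intro j
      have e : (fun p => FourierBF.partialDeriv j (fun x => (H p x)⁻¹)) =
          fun p x => -((H p x)⁻¹ * (H p x)⁻¹ * FourierBF.partialDeriv j (H p) x) := by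
        ext p x
        have hd := ((hH.smooth p).differentiable (by simp)).differentiableAt (x := x) |>.hasFDerivAt
        have := (hasFDerivAt_inv' (𝕜 := ℝ) (h0 p x)).comp x hd
        have h := congrArg (fun l => l (EuclideanSpace.single j (1 : ℝ))) this.fderiv
        refine Eq.trans h ?_
        simp only [FourierBF.partialDeriv, ContinuousLinearMap.comp_apply, _root_.neg_apply,
          ContinuousLinearMap.mulLeftRight_apply]
        ring
      rw [e]
      exact ((ih.mul ih).mul ((hH.partialDeriv j) N)).neg
    have : ∀ j, ∃ C, ∀ p x,
        ‖iteratedFDeriv ℝ n (FourierBF.partialDeriv j (fun x => (H p x)⁻¹)) x‖ ≤ C :=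
      fun j => (hd j).bound n (by omega)
    choose C hC using this
    exact ⟨∑ j, C j, fun p x => (norm_iteratedFDeriv_succ_le_sum (hs p) n x).trans
      (Finset.sum_le_sum fun j _ => hC j p x)⟩

end families

/-! ### Exponentials -/

section phase
variable {d : ℕ}

/-- `x ↦ e^{i⟨x,ξ⟩}`. -/
def phase (ξ x : Rd d) : ℂ := Complex.exp (Complex.I * (inner ℝ x ξ : ℝ))

theorem norm_phase (ξ x : Rd d) : ‖phase ξ x‖ = 1 := HasUniformTemperateGrowth.norm_exp_I _

theorem phase_add (ξ η x : Rd d) : phase (ξ + η) x = phase ξ x * phase η x := by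
  simp only [phase, inner_add_right, ← Complex.exp_add]
  push_cast
  ring_nf

theorem contDiff_phase (ξ : Rd d) : ContDiff ℝ ∞ (phase ξ) := by
  unfold phase
  have h : ContDiff ℝ ∞ (fun x : Rd d => ((inner ℝ x ξ : ℝ) : ℂ)) :=
    Complex.ofRealCLM.contDiff.comp (contDiff_id.inner ℝ contDiff_const)
  exact (contDiff_const.mul h).cexp

theorem continuous_phase_uncurry : Continuous fun p : Rd d × Rd d => phase p.1 p.2 := by
  unfold phase
  fun_prop

theorem partialDeriv_phase (ξ : Rd d) (j : Fin d) :
    partialDeriv j (phase ξ) = fun x => Complex.I * (ξ j : ℂ) * phase ξ x := by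
  ext x
  have h1 : HasFDerivAt (fun x : Rd d => Complex.I * ((innerSL ℝ ξ x : ℝ) : ℂ))
      (Complex.I • (Complex.ofRealCLM.comp (innerSL ℝ ξ))) x :=
    ((Complex.ofRealCLM.comp (innerSL ℝ ξ)).hasFDerivAt).const_mul Complex.I
  have h2 : phase ξ = fun x => Complex.exp (Complex.I * ((innerSL ℝ ξ x : ℝ) : ℂ)) := by
    ext x
    simp only [phase, innerSL_apply_apply]
    rw [real_inner_comm]
  rw [h2, partialDeriv, h1.cexp.fderiv]
  simp [EuclideanSpace.inner_single_right]
  ring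

theorem hasTemperateGrowth_phase (ξ : Rd d) : (phase ξ).HasTemperateGrowth := by
  refine ⟨contDiff_phase ξ, fun n => ?_⟩
  suffices h : ∃ C, ∀ x, ‖iteratedFDeriv ℝ n (phase ξ) x‖ ≤ C by
    obtain ⟨C, hC⟩ := h
    exact ⟨0, C, fun x => by simpa using hC x⟩
  induction n with
  | zero => exact ⟨1, fun x => by simp [norm_phase]⟩
  | succ n ih =>
    obtain ⟨C, hC⟩ := ih
    refine ⟨∑ j, ‖Complex.I * (ξ j : ℂ)‖ * C, fun x => ?_⟩
    refine (norm_iteratedFDeriv_succ_le_sum (contDiff_phase ξ) n x).trans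
      (Finset.sum_le_sum fun j _ => ?_)
    rw [partialDeriv_phase]
    have : iteratedFDeriv ℝ n (fun x => Complex.I * (ξ j : ℂ) * phase ξ x) x =
        (Complex.I * (ξ j : ℂ)) • iteratedFDeriv ℝ n (phase ξ) x :=
      iteratedFDeriv_const_smul_apply (a := Complex.I * (ξ j : ℂ)) (f := phase ξ)
        ((contDiff_phase ξ).contDiffAt.of_le (mod_cast le_top))
    rw [this, norm_smul]
    gcongr
    exact hC x

/-- Multiplication of a Schwartz function by `e^{-i⟨x,ξ⟩}`. -/
def modulate (ξ : Rd d) (φ : 𝓢(Rd d, ℂ)) : 𝓢(Rd d, ℂ) := SchwartzMap.smulLeftCLM ℂ (phase (-ξ)) φ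

@[simp] theorem modulate_apply (ξ : Rd d) (φ : 𝓢(Rd d, ℂ)) (x : Rd d) :
    modulate ξ φ x = phase (-ξ) x * φ x :=
  SchwartzMap.smulLeftCLM_apply_apply (hasTemperateGrowth_phase _) _ _

end phase

/-! ### Fourier inversion and decay of Fourier transforms -/

section inversion
variable {d : ℕ}

theorem fourierConst_pos (d : ℕ) : 0 < fourierConst d := by
  unfold fourierConst
  positivity

theorem fourierConst_sq (d : ℕ) : fourierConst d * fourierConst d * (2 * Real.pi) ^ d = 1 := by
  have h : (0 : ℝ) < 2 * Real.pi := by positivity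
  rw [fourierConst, ← Real.rpow_add h, ← Real.rpow_natCast, ← Real.rpow_add h]
  ring_nf
  simp

/-- The inverse of `angularFourier`. -/
def angularFourierInv (φ : 𝓢(Rd d, ℂ)) : 𝓢(Rd d, ℂ) :=
  SchwartzMap.compCLMOfContinuousLinearEquiv ℂ (ContinuousLinearEquiv.neg ℝ) (angularFourier φ)

theorem angularFourierInv_eq (φ : 𝓢(Rd d, ℂ)) (ξ : Rd d) :
    angularFourierInv φ ξ = angularFourier φ (-ξ) := rfl

theorem angularFourierInv_apply (φ : 𝓢(Rd d, ℂ)) (ξ : Rd d) :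
    angularFourierInv φ ξ = fourierConst d * ∫ x, phase ξ x * φ x := by
  rw [angularFourierInv_eq, angularFourier_apply]
  simp [phase]

/-- The substitution `y = -x/(2π)` reduces this to inversion for the transform with phase
`e^{-2πi⟨x,ξ⟩}`; its Jacobian `(2π)^d` cancels `fourierConst d ^ 2`. -/
theorem angularFourier_angularFourierInv (φ : 𝓢(Rd d, ℂ)) :
    angularFourier (angularFourierInv φ) = φ := by
  ext ξ
  have h : ∀ x, angularFourierInv φ x = fourierConst d * (𝓕 φ) (-((2 * Real.pi)⁻¹ • x)) := by
    intro x
    rw [angularFourierInv_eq]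
    have : angularFourier φ (-x) = fourierConst d * (𝓕 φ) ((2 * Real.pi)⁻¹ • (-x)) := rfl
    rw [this, smul_neg]
  have hp : (0 : ℝ) < 2 * Real.pi := by positivity
  rw [angularFourier_apply]
  have e : (fun x => Complex.exp (-Complex.I * (inner ℝ x ξ : ℝ)) * angularFourierInv φ x) =
      fun x => (fun y => (fourierConst d : ℂ) * (Complex.exp (2 * Real.pi * Complex.I *
        (inner ℝ y ξ : ℝ)) * (𝓕 φ) y)) ((-(2 * Real.pi)⁻¹) • x) := by
    ext x
    rw [h]
    simp only [neg_smul, inner_neg_left, inner_smul_left]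
    have : (Real.pi : ℂ) ≠ 0 := by exact_mod_cast Real.pi_ne_zero
    have h3 : -Complex.I * ((inner ℝ x ξ : ℝ) : ℂ) = 2 * Real.pi * Complex.I *
        ((-((starRingEnd ℝ) (2 * Real.pi)⁻¹ * inner ℝ x ξ) : ℝ) : ℂ) := by
      simp only [conj_trivial]
      push_cast
      field_simp
    rw [h3]
    ring
  rw [e]
  refine (congrArg (fun t => (fourierConst d : ℂ) * t) (Measure.integral_comp_smul volume
    (fun y => (fourierConst d : ℂ) * (Complex.exp (2 * Real.pi * Complex.I *
      (inner ℝ y ξ : ℝ)) * (𝓕 φ) y)) (-(2 * Real.pi)⁻¹))).trans ?_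
  rw [integral_const_mul]
  have hinv : ∫ y, Complex.exp (2 * Real.pi * Complex.I * (inner ℝ y ξ : ℝ)) * (𝓕 φ) y = φ ξ := by
    have h1 : 𝓕⁻ (𝓕 φ) = φ := FourierTransform.fourierInv_fourier_eq φ
    have h2 := congrArg (fun f : 𝓢(Rd d, ℂ) => f ξ) h1
    rw [SchwartzMap.fourierInv_coe, Real.fourierInv_eq] at h2
    rw [← h2]
    congr 1
    ext y
    rw [Circle.smul_def, smul_eq_mul, Real.fourierChar_apply]
    congr 2
    push_cast
    ring
  rw [hinv, finrank_euclideanSpace_fin]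
  have h4 : |((-(2 * Real.pi)⁻¹) ^ d)⁻¹| = (2 * Real.pi) ^ d := by
    rw [abs_inv, abs_pow, abs_neg, abs_of_pos (inv_pos.2 hp), inv_pow, inv_inv]
  rw [h4, Complex.real_smul]
  have h5 := fourierConst_sq d
  have h6 : (fourierConst d : ℂ) * fourierConst d * ((2 * Real.pi) ^ d : ℝ) = 1 := by
    exact_mod_cast h5
  calc _ = (fourierConst d : ℂ) * fourierConst d * ((2 * Real.pi) ^ d : ℝ) * φ ξ := by ring
    _ = φ ξ := by rw [h6, one_mul]

theorem one_add_pow_le (N : ℕ) {t : ℝ} (ht : 0 ≤ t) : (1 + t) ^ N ≤ 2 ^ N * (1 + t ^ N) := by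
  have := add_pow_le (zero_le_one (α := ℝ)) ht N
  rw [one_pow] at this
  refine this.trans ?_
  gcongr
  · norm_num
  · omega

/-- A family of test functions with uniform bounds and supports in a fixed set. -/
structure TestFamily {P : Type*} (K : Set (Rd d)) (H : P → 𝓢(Rd d, ℂ)) : Prop where
  unif : UnifSmooth (fun p x => H p x)
  supp : ∀ p x, x ∉ K → H p x = 0

/-- Integration by parts. The `L¹` norms of the derivatives are at most their uniform sup bounds
times the volume of `K`, so the decay is uniform in the parameter. This is the source of all
off-diagonal decay of kernels. -/
theorem UnifSmooth.integral_phase_decay {P : Type*} {H : P → Rd d → ℂ} (hH : UnifSmooth H)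
    {K : Set (Rd d)} (hK : IsCompact K) (hsupp : ∀ p x, x ∉ K → H p x = 0) (N : ℕ) :
    ∃ C, 0 ≤ C ∧ ∀ p ζ, (1 + ‖ζ‖) ^ N * ‖∫ x, phase ζ x * H p x‖ ≤ C := by
  choose D hD0 hD using hH.exists_bound
  set A : ℕ → ℝ := fun n => 2 ^ n * ∑ m ∈ Finset.range (n + 1), D m * volume.real K with hA
  have hA0 : ∀ n, 0 ≤ A n := fun n => by
    have : ∀ m, 0 ≤ D m * volume.real K := fun m => mul_nonneg (hD0 m) measureReal_nonneg
    exact mul_nonneg (by positivity) (Finset.sum_nonneg fun m _ => this m)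
  have key : ∀ n p (ζ : Rd d), ‖ζ‖ ^ n * ‖∫ x, phase ζ x * H p x‖ ≤ (2 * Real.pi) ^ n * A n := by
    intro n p ζ
    have hcs : HasCompactSupport (H p) := HasCompactSupport.intro hK (hsupp p)
    set S : 𝓢(Rd d, ℂ) := hcs.toSchwartzMap (hH.smooth p) with hS
    have h1 := Real.pow_mul_norm_iteratedFDeriv_fourier_le (f := H p) (K := 0) (N := n)
      ((hH.smooth p).of_le (mod_cast le_top))
      (fun k m _ _ => S.integrable_pow_mul_iteratedFDeriv volume k m)
      (k := 0) (n := n) le_rfl le_rfl (-((2 * Real.pi)⁻¹ • ζ))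
    simp only [norm_iteratedFDeriv_zero] at h1
    have h2 : 𝓕 (H p) (-((2 * Real.pi)⁻¹ • ζ)) = ∫ x, phase ζ x * H p x := by
      rw [Real.fourier_eq]
      congr 1
      ext x
      rw [Circle.smul_def, smul_eq_mul, Real.fourierChar_apply, phase]
      congr 2
      simp only [inner_neg_right, inner_smul_right]
      push_cast
      have : (Real.pi : ℂ) ≠ 0 := by exact_mod_cast Real.pi_ne_zero
      field_simp
    have hp : (0 : ℝ) < 2 * Real.pi := by positivity
    have h3 : ∀ m, ∫ v, ‖iteratedFDeriv ℝ m (H p) v‖ ≤ D m * volume.real K := by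
      intro m
      have hz : ∀ x, x ∉ K → ‖iteratedFDeriv ℝ m (H p) x‖ = 0 := by
        intro x hx
        have h4 : tsupport (H p) ⊆ K := closure_minimal (fun y hy => by
          by_contra h
          exact hy (hsupp p y h)) hK.isClosed
        have := Set.notMem_subset ((support_iteratedFDeriv_subset (𝕜 := ℝ) (f := H p) m).trans h4) hx
        rw [Function.notMem_support.1 this, norm_zero]
      rw [← setIntegral_eq_integral_of_forall_compl_eq_zero hz]
      have := norm_setIntegral_le_of_norm_le_const (μ := volume) (s := K) (C := D m)
        (f := fun v => ‖iteratedFDeriv ℝ m (H p) v‖) hK.measure_lt_top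
        (fun x _ => by simpa using hD m p x)
      exact (le_abs_self _).trans this
    rw [h2, norm_neg, norm_smul, norm_inv, Real.norm_of_nonneg hp.le, mul_pow, inv_pow] at h1
    have h5 : ‖ζ‖ ^ n * ‖∫ x, phase ζ x * H p x‖ =
        (2 * Real.pi) ^ n * (((2 * Real.pi) ^ n)⁻¹ * ‖ζ‖ ^ n * ‖∫ x, phase ζ x * H p x‖) := by
      field_simp
    rw [h5]
    refine mul_le_mul_of_nonneg_left (h1.trans ?_) (by positivity)
    rw [hA]
    simp only [pow_zero, one_mul, CharP.cast_eq_zero, mul_zero, zero_add, Finset.range_one,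
      Finset.sum_product, Finset.sum_singleton]
    gcongr with m hm
    exact h3 m
  refine ⟨2 ^ N * ((2 * Real.pi) ^ 0 * A 0 + (2 * Real.pi) ^ N * A N), ?_, fun p ζ => ?_⟩
  · have := hA0 0
    have := hA0 N
    positivity
  have h0 := key 0 p ζ
  have hN := key N p ζ
  calc (1 + ‖ζ‖) ^ N * ‖∫ x, phase ζ x * H p x‖
      ≤ 2 ^ N * (1 + ‖ζ‖ ^ N) * ‖∫ x, phase ζ x * H p x‖ := by
        gcongr
        exact one_add_pow_le N (norm_nonneg _)
    _ = 2 ^ N * (‖ζ‖ ^ 0 * ‖∫ x, phase ζ x * H p x‖ + ‖ζ‖ ^ N * ‖∫ x, phase ζ x * H p x‖) := by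
        ring
    _ ≤ _ := by gcongr

end inversion

end FourierBF

end

noncomputable section

namespace FourierBF

open scoped ContDiff

/-! ### Elementary inequalities for `1 + ‖ξ‖` -/

section peetre
variable {F : Type*} [NormedAddCommGroup F]

theorem one_add_norm_pos (x : F) : 0 < 1 + ‖x‖ := by positivity

theorem one_le_one_add_norm (x : F) : 1 ≤ 1 + ‖x‖ := by linarith [norm_nonneg x]

theorem one_add_norm_add_le (x y : F) : 1 + ‖x + y‖ ≤ (1 + ‖x‖) * (1 + ‖y‖) := by
  nlinarith [norm_nonneg x, norm_nonneg y, norm_add_le x y]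

theorem one_add_norm_le_sub (x y : F) : 1 + ‖x‖ ≤ (1 + ‖x - y‖) * (1 + ‖y‖) := by
  simpa using one_add_norm_add_le (x - y) y

theorem one_add_norm_le_sub' (x y : F) : 1 + ‖x‖ ≤ (1 + ‖y - x‖) * (1 + ‖y‖) := by
  rw [norm_sub_rev]
  exact one_add_norm_le_sub x y

end peetre

/-! ### The order of a tempered distribution -/

section order
variable {d : ℕ}

/-- The distribution `f` is bounded by the Schwartz seminorms of order `m`. -/
def DistOrderLE (f : 𝓢'(Rd d, ℂ)) (m : ℕ) : Prop :=
  ∃ C, 0 ≤ C ∧ ∀ (ψ : 𝓢(Rd d, ℂ)) (A : ℝ), 0 ≤ A →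
    (∀ i ≤ m, ∀ x, (1 + ‖x‖) ^ m * ‖iteratedFDeriv ℝ i ψ x‖ ≤ A) → ‖f ψ‖ ≤ C * A

theorem exists_distOrderLE (f : 𝓢'(Rd d, ℂ)) : ∃ m, DistOrderLE f m := by
  let q : Seminorm ℂ 𝓢(Rd d, ℂ) := (normSeminorm ℂ ℂ).comp f.toLinearMap
  have hq : Continuous q := (continuous_norm).comp f.continuous
  obtain ⟨s, C, -, hC⟩ := Seminorm.bound_of_continuous (schwartz_withSeminorms ℝ (Rd d) ℂ)
    (q.restrictScalars ℝ) hq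
  -- Any number exceeding both indices of every seminorm in `s` serves as the order; the sum is such
  -- a number.
  refine ⟨∑ p ∈ s, (p.1 + p.2), C, C.2, fun ψ A hA h => ?_⟩
  refine (Seminorm.le_def.1 hC ψ).trans ?_
  refine mul_le_mul_of_nonneg_left ?_ C.2
  refine Seminorm.finset_sup_apply_le hA fun p hp => ?_
  have hp' : p.1 + p.2 ≤ ∑ p ∈ s, (p.1 + p.2) :=
    Finset.single_le_sum (f := fun p : ℕ × ℕ => p.1 + p.2) (fun _ _ => Nat.zero_le _) hp
  refine SchwartzMap.seminorm_le_bound ℝ p.1 p.2 ψ hA fun x => ?_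
  refine le_trans ?_ (h p.2 (by omega) x)
  gcongr
  calc ‖x‖ ^ p.1 ≤ (1 + ‖x‖) ^ p.1 := by
        gcongr
        linarith
    _ ≤ _ := pow_le_pow_right₀ (one_le_one_add_norm x) (by omega)

/-- The fixed Schwartz function `φ` absorbs the polynomial weights, so only unweighted sup norms of
finitely many derivatives of `g` remain. It is applied with `g` an exponential and with `g` the
Fourier transform of a Schwartz function. -/
theorem DistOrderLE.exists_bound_smul {f : 𝓢'(Rd d, ℂ)} {m : ℕ} (hf : DistOrderLE f m)
    (φ : 𝓢(Rd d, ℂ)) : ∃ C, 0 ≤ C ∧ ∀ g : Rd d → ℂ, g.HasTemperateGrowth → ∀ A, 0 ≤ A →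
      (∀ i ≤ m, ∀ x, ‖iteratedFDeriv ℝ i g x‖ ≤ A) →
      ‖f (SchwartzMap.smulLeftCLM ℂ g φ)‖ ≤ C * A := by
  obtain ⟨C, hC, h⟩ := hf
  set D : ℝ := 2 ^ m * ((Finset.Iic (m, m)).sup (schwartzSeminormFamily ℝ (Rd d) ℂ) φ) with hD
  have hφ : ∀ i ≤ m, ∀ x, (1 + ‖x‖) ^ m * ‖iteratedFDeriv ℝ i φ x‖ ≤ D := fun i hi x =>
    SchwartzMap.one_add_le_sup_seminorm_apply (𝕜 := ℝ) (m := (m, m)) (k := m) (n := i) le_rfl hi φ x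
  have hD0 : 0 ≤ D := by
    have : 0 ≤ (Finset.Iic (m, m)).sup (schwartzSeminormFamily ℝ (Rd d) ℂ) φ := apply_nonneg _ _
    positivity
  refine ⟨C * (2 ^ m * D), by positivity, fun g hg A hA hgA => ?_⟩
  rw [mul_assoc]
  refine h _ _ (by positivity) fun i hi x => ?_
  have h1 := norm_iteratedFDeriv_mul_le hg.1 (φ.smooth ⊤) x (n := i) (mod_cast le_top)
  have e : ((SchwartzMap.smulLeftCLM ℂ g φ : 𝓢(Rd d, ℂ)) : Rd d → ℂ) = fun y => g y * φ y := by
    ext y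
    exact SchwartzMap.smulLeftCLM_apply_apply hg φ y
  rw [e]
  calc (1 + ‖x‖) ^ m * ‖iteratedFDeriv ℝ i (fun y => g y * φ y) x‖
      ≤ (1 + ‖x‖) ^ m * ∑ j ∈ Finset.range (i + 1), (i.choose j : ℝ) *
        ‖iteratedFDeriv ℝ j g x‖ * ‖iteratedFDeriv ℝ (i - j) φ x‖ := by gcongr
    _ = ∑ j ∈ Finset.range (i + 1), (i.choose j : ℝ) * (‖iteratedFDeriv ℝ j g x‖ *
          ((1 + ‖x‖) ^ m * ‖iteratedFDeriv ℝ (i - j) φ x‖)) := by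
        rw [Finset.mul_sum]
        exact Finset.sum_congr rfl fun j _ => by ring
    _ ≤ ∑ j ∈ Finset.range (i + 1), (i.choose j : ℝ) * (A * D) := by
        refine Finset.sum_le_sum fun j hj => ?_
        have := Finset.mem_range.1 hj
        gcongr
        · exact hgA j (by omega) x
        · exact hφ (i - j) (by omega) x
    _ = 2 ^ i * (A * D) := by
        rw [← Finset.sum_mul]
        have : ∑ j ∈ Finset.range (i + 1), (i.choose j : ℝ) = 2 ^ i := by
          exact_mod_cast Nat.sum_range_choose i
        rw [this]
    _ ≤ 2 ^ m * (A * D) := by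
        gcongr
        norm_num
    _ = _ := by ring

theorem norm_iteratedFDeriv_phase_le (ξ : Rd d) (n : ℕ) (x : Rd d) :
    ‖iteratedFDeriv ℝ n (phase ξ) x‖ ≤ (d * ‖ξ‖) ^ n := by
  induction n with
  | zero => simp [norm_phase]
  | succ n ih =>
    refine (norm_iteratedFDeriv_succ_le_sum (contDiff_phase ξ) n x).trans ?_
    have h : ∀ j, ‖iteratedFDeriv ℝ n (partialDeriv j (phase ξ)) x‖ ≤ ‖ξ‖ * (d * ‖ξ‖) ^ n := by
      intro j
      rw [partialDeriv_phase]
      have : iteratedFDeriv ℝ n (fun x => Complex.I * (ξ j : ℂ) * phase ξ x) x =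
          (Complex.I * (ξ j : ℂ)) • iteratedFDeriv ℝ n (phase ξ) x :=
        iteratedFDeriv_const_smul_apply (a := Complex.I * (ξ j : ℂ)) (f := phase ξ)
          ((contDiff_phase ξ).contDiffAt.of_le (mod_cast le_top))
      rw [this, norm_smul, norm_mul, Complex.norm_I, one_mul, Complex.norm_real]
      have := PiLp.norm_apply_le ξ j
      gcongr
    refine (Finset.sum_le_sum fun j _ => h j).trans (le_of_eq ?_)
    simp
    ring

/-- The function `ξ ↦ (2π)^{-d/2} f(φ e^{-i⟨·,ξ⟩})`, the Fourier transform of `φ f`. -/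
def localFourier (φ : 𝓢(Rd d, ℂ)) (f : 𝓢'(Rd d, ℂ)) (ξ : Rd d) : ℂ :=
  fourierConst d * f (modulate ξ φ)

theorem DistOrderLE.localFourier_le {f : 𝓢'(Rd d, ℂ)} {m : ℕ} (hf : DistOrderLE f m)
    (φ : 𝓢(Rd d, ℂ)) : ∃ C, 0 ≤ C ∧ ∀ ξ, ‖localFourier φ f ξ‖ ≤ C * (1 + ‖ξ‖) ^ m := by
  obtain ⟨C, hC, h⟩ := hf.exists_bound_smul φ
  refine ⟨fourierConst d * (C * (1 + d) ^ m), ?_, fun ξ => ?_⟩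
  · have := (fourierConst_pos d).le
    positivity
  have h1 : ‖f (modulate ξ φ)‖ ≤ C * ((1 + d) ^ m * (1 + ‖ξ‖) ^ m) := by
    refine h _ (hasTemperateGrowth_phase _) _ (by positivity) fun i hi x => ?_
    refine (norm_iteratedFDeriv_phase_le _ i x).trans ?_
    rw [norm_neg, ← mul_pow]
    calc ((d : ℝ) * ‖ξ‖) ^ i ≤ ((1 + d) * (1 + ‖ξ‖)) ^ i := by
          gcongr <;> linarith
      _ ≤ _ := by
          refine pow_le_pow_right₀ ?_ hi
          have : (1 : ℝ) ≤ 1 + d := by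
            have : (0 : ℝ) ≤ d := Nat.cast_nonneg d
            linarith
          nlinarith [norm_nonneg ξ]
  rw [localFourier, norm_mul, Complex.norm_real, Real.norm_of_nonneg (fourierConst_pos d).le]
  calc _ ≤ fourierConst d * (C * ((1 + d) ^ m * (1 + ‖ξ‖) ^ m)) :=
        mul_le_mul_of_nonneg_left h1 (fourierConst_pos d).le
    _ = _ := by ring

theorem integrable_weight_mul_norm (ψ : 𝓢(Rd d, ℂ)) (N : ℕ) :
    Integrable fun x => (1 + ‖x‖) ^ N * ‖ψ x‖ :=
  HasUniformTemperateGrowth.integrable_weight_mul ψ N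

theorem exists_norm_iteratedFDeriv_angularFourier_le (n : ℕ) :
    ∃ C, 0 ≤ C ∧ ∀ (ψ : 𝓢(Rd d, ℂ)) (x : Rd d),
      ‖iteratedFDeriv ℝ n (angularFourier ψ) x‖ ≤ C * ∫ ξ, (1 + ‖ξ‖) ^ n * ‖ψ ξ‖ := by
  set L : Rd d →L[ℝ] Rd d := (scaling d : Rd d →L[ℝ] Rd d) with hL
  refine ⟨fourierConst d * (((2 * Real.pi) ^ n * (n + 1)) * ‖L‖ ^ n), ?_, fun ψ x => ?_⟩
  · have := (fourierConst_pos d).le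
    positivity
  have hs : ContDiff ℝ ∞ (𝓕 ψ : 𝓢(Rd d, ℂ)) := (𝓕 ψ : 𝓢(Rd d, ℂ)).smooth ⊤
  have e : (angularFourier ψ : Rd d → ℂ) = (fourierConst d : ℂ) • ((𝓕 ψ : 𝓢(Rd d, ℂ)) ∘ L) := rfl
  have hsL : ContDiff ℝ ∞ ((𝓕 ψ : 𝓢(Rd d, ℂ)) ∘ L) := hs.comp L.contDiff
  rw [e, iteratedFDeriv_const_smul_apply (hsL.contDiffAt.of_le (mod_cast le_top)), norm_smul,
    L.iteratedFDeriv_comp_right hs x (i := n) (mod_cast le_top), Complex.norm_real,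
    Real.norm_of_nonneg (fourierConst_pos d).le, mul_assoc]
  refine mul_le_mul_of_nonneg_left ?_ (fourierConst_pos d).le
  refine (ContinuousMultilinearMap.norm_compContinuousLinearMap_le _ _).trans ?_
  rw [Finset.prod_const, Finset.card_univ, Fintype.card_fin, mul_right_comm]
  refine mul_le_mul_of_nonneg_right ?_ (by positivity)
  have h1 := Real.pow_mul_norm_iteratedFDeriv_fourier_le (f := ψ) (K := n) (N := 0)
      ((ψ.smooth ⊤).of_le (mod_cast le_top))
      (fun k m _ _ => ψ.integrable_pow_mul_iteratedFDeriv volume k m)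
      (k := n) (n := 0) le_rfl le_rfl (L x)
  rw [pow_zero, one_mul, pow_zero, mul_one] at h1
  refine h1.trans ?_
  rw [mul_assoc]
  refine mul_le_mul_of_nonneg_left ?_ (by positivity)
  simp only [zero_add, Finset.range_one, Finset.sum_product, Finset.sum_singleton,
    norm_iteratedFDeriv_zero]
  have : ∀ p ∈ Finset.range (n + 1), ∫ v, ‖v‖ ^ p * ‖ψ v‖ ≤ ∫ ξ, (1 + ‖ξ‖) ^ n * ‖ψ ξ‖ := by
    intro p hp
    have := Finset.mem_range.1 hp
    refine integral_mono (ψ.integrable_pow_mul volume p) (integrable_weight_mul_norm ψ n)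
      fun v => ?_
    dsimp only
    gcongr
    calc ‖v‖ ^ p ≤ (1 + ‖v‖) ^ p := by
          gcongr
          linarith
      _ ≤ _ := pow_le_pow_right₀ (one_le_one_add_norm v) (by omega)
  refine (Finset.sum_le_sum this).trans (le_of_eq ?_)
  simp

/-- The pairing equals `f(ψ̂ φ)`, in which `φ` is fixed and `ψ̂` is the variable multiplier; its
derivatives are bounded by weighted `L¹` norms of `ψ`. -/
theorem DistOrderLE.exists_bound_fourier {f : 𝓢'(Rd d, ℂ)} {m : ℕ} (hf : DistOrderLE f m)
    (φ : 𝓢(Rd d, ℂ)) : ∃ C, 0 ≤ C ∧ ∀ ψ : 𝓢(Rd d, ℂ),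
      ‖distFourier (TemperedDistribution.smulLeftCLM ℂ φ f) ψ‖ ≤
        C * ∫ ξ, (1 + ‖ξ‖) ^ m * ‖ψ ξ‖ := by
  obtain ⟨C, hC, h⟩ := hf.exists_bound_smul φ
  choose D hD0 hD using exists_norm_iteratedFDeriv_angularFourier_le (d := d)
  refine ⟨C * ∑ i ∈ Finset.range (m + 1), D i, ?_, fun ψ => ?_⟩
  · exact mul_nonneg hC (Finset.sum_nonneg fun i _ => hD0 i)
  have e : distFourier (TemperedDistribution.smulLeftCLM ℂ φ f) ψ =
      f (SchwartzMap.smulLeftCLM ℂ (angularFourier ψ) φ) := by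
    have h1 : distFourier (TemperedDistribution.smulLeftCLM ℂ φ f) ψ =
      f (SchwartzMap.smulLeftCLM ℂ φ (angularFourier ψ)) := rfl
    rw [h1]
    congr 1
    ext x
    rw [SchwartzMap.smulLeftCLM_apply_apply φ.hasTemperateGrowth,
      SchwartzMap.smulLeftCLM_apply_apply (SchwartzMap.hasTemperateGrowth _)]
    simp [mul_comm]
  have hI : 0 ≤ ∫ ξ, (1 + ‖ξ‖) ^ m * ‖ψ ξ‖ := integral_nonneg fun ξ => by positivity
  rw [e, mul_assoc]
  refine h _ (SchwartzMap.hasTemperateGrowth _) _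
    (mul_nonneg (Finset.sum_nonneg fun i _ => hD0 i) hI) fun i hi x => ?_
  refine (hD i ψ x).trans ?_
  have h2 : D i ≤ ∑ i ∈ Finset.range (m + 1), D i :=
    Finset.single_le_sum (fun i _ => hD0 i) (Finset.mem_range.2 (by omega))
  have h3 : ∫ ξ, (1 + ‖ξ‖) ^ i * ‖ψ ξ‖ ≤ ∫ ξ, (1 + ‖ξ‖) ^ m * ‖ψ ξ‖ := by
    refine integral_mono (integrable_weight_mul_norm ψ i) (integrable_weight_mul_norm ψ m)
      fun v => ?_
    dsimp only
    gcongr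
    exact one_le_one_add_norm v
  have h4 : 0 ≤ ∫ ξ, (1 + ‖ξ‖) ^ i * ‖ψ ξ‖ := integral_nonneg fun ξ => by positivity
  exact mul_le_mul h2 h3 h4 (Finset.sum_nonneg fun i _ => hD0 i)

end order

/-! ### Functionals bounded by weighted integrals are functions -/

section riesz
variable {d : ℕ}

theorem one_add_norm_rpow_le (x : Rd d) {r : ℝ} (hr : 0 ≤ r) :
    (1 + ‖x‖ ^ 2) ^ (-r) ≤ 2 ^ r * (1 + ‖x‖) ^ (-(2 * r)) := by
  have h1 : (1 + ‖x‖) ^ (2 : ℝ) ≤ 2 * (1 + ‖x‖ ^ 2) := by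
    rw [Real.rpow_two]
    nlinarith [sq_nonneg (1 - ‖x‖)]
  have h2 : ((1 + ‖x‖) ^ (2 : ℝ)) ^ r ≤ (2 * (1 + ‖x‖ ^ 2)) ^ r :=
    Real.rpow_le_rpow (by positivity) h1 hr
  rw [← Real.rpow_mul (by positivity), Real.mul_rpow (by norm_num) (by positivity)] at h2
  rw [Real.rpow_neg (by positivity), Real.rpow_neg (by positivity)]
  rw [inv_le_iff_one_le_mul₀ (by positivity)]
  have h3 : 0 < (1 + ‖x‖) ^ (2 * r) := by positivity
  calc (1 : ℝ) = (1 + ‖x‖) ^ (2 * r) * ((1 + ‖x‖) ^ (2 * r))⁻¹ := (mul_inv_cancel₀ h3.ne').symm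
    _ ≤ (2 ^ r * (1 + ‖x‖ ^ 2) ^ r) * ((1 + ‖x‖) ^ (2 * r))⁻¹ := by gcongr
    _ = _ := by ring

theorem memLp_two_of_decay {g : Rd d → ℝ} (hg : Continuous g) {C : ℝ}
    (h : ∀ x, |g x| ≤ C * (1 + ‖x‖) ^ (-(d + 1 : ℝ))) : MemLp g 2 (volume : Measure (Rd d)) := by
  rw [memLp_two_iff_integrable_sq hg.aestronglyMeasurable]
  have hi : Integrable (fun x : Rd d => (1 + ‖x‖) ^ (-(d + 1 : ℝ))) :=
    integrable_one_add_norm (by simp)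
  refine (hi.const_mul (C * C)).mono' (by fun_prop) (Filter.Eventually.of_forall fun x => ?_)
  have hC : 0 ≤ C := by
    have := (abs_nonneg _).trans (h 0)
    simpa using this
  have h1 : (1 + ‖x‖) ^ (-(d + 1 : ℝ)) ≤ 1 :=
    Real.rpow_le_one_of_one_le_of_nonpos (one_le_one_add_norm x) (by
      have : (0 : ℝ) ≤ d := Nat.cast_nonneg d
      linarith)
  have h2 : 0 ≤ (1 + ‖x‖) ^ (-(d + 1 : ℝ)) := by positivity
  rw [Real.norm_of_nonneg (sq_nonneg _), ← sq_abs]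
  calc |g x| ^ 2 ≤ (C * (1 + ‖x‖) ^ (-(d + 1 : ℝ))) ^ 2 := by
        gcongr
        exact h x
    _ = C * C * (1 + ‖x‖) ^ (-(d + 1 : ℝ)) * (1 + ‖x‖) ^ (-(d + 1 : ℝ)) := by ring
    _ ≤ C * C * (1 + ‖x‖) ^ (-(d + 1 : ℝ)) * 1 := by gcongr
    _ = _ := by ring

/-- A tempered distribution that is bounded by a weighted `L¹` norm is given by a function whose
product with a negative power of `1 + ‖x‖` is integrable. -/
theorem exists_function_of_bound (u : 𝓢'(Rd d, ℂ)) (m : ℕ) (C : ℝ) (hC : 0 ≤ C)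
    (hu : ∀ ψ : 𝓢(Rd d, ℂ), ‖u ψ‖ ≤ C * ∫ ξ, (1 + ‖ξ‖) ^ m * ‖ψ ξ‖) :
    ∃ (g : Rd d → ℂ) (L : ℕ), AEStronglyMeasurable g volume ∧
      Integrable (fun x => ‖g x‖ * ((1 + ‖x‖) ^ L)⁻¹) ∧ ∀ ψ : 𝓢(Rd d, ℂ), u ψ = ∫ x, g x * ψ x := by
  -- The weight `W` behaves like `(1 + |x|)^{-2r}`, and `m - 2r ≤ -(d + 1)` makes `(1 + |x|)^m W`
  -- square integrable.
  set r : ℝ := m + d + 1 with hr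
  have hr0 : 0 ≤ r := by positivity
  set W : Rd d → ℝ := fun x => (1 + ‖x‖ ^ 2) ^ (-r) with hW
  have hWt : W.HasTemperateGrowth := Function.hasTemperateGrowth_one_add_norm_sq_rpow (Rd d) (-r)
  have hWc : (fun x => (W x : ℂ)).HasTemperateGrowth :=
    Function.HasTemperateGrowth.comp (g := Complex.ofReal)
      Complex.ofRealCLM.hasTemperateGrowth hWt
  have hW't : (fun x : Rd d => (1 + ‖x‖ ^ 2) ^ r).HasTemperateGrowth :=
    Function.hasTemperateGrowth_one_add_norm_sq_rpow (Rd d) r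
  have hW'c : (fun x : Rd d => (((1 + ‖x‖ ^ 2) ^ r : ℝ) : ℂ)).HasTemperateGrowth :=
    Function.HasTemperateGrowth.comp (g := Complex.ofReal)
      Complex.ofRealCLM.hasTemperateGrowth hW't
  have hWpos : ∀ x, 0 < W x := fun x => by
    simp only [hW]
    positivity
  set b : Rd d → ℝ := fun x => (1 + ‖x‖) ^ m * W x with hb
  have hbc : Continuous b := by
    have := hWt.1.continuous
    fun_prop
  have hb2 : MemLp b 2 (volume : Measure (Rd d)) := by
    refine memLp_two_of_decay hbc (C := 2 ^ r) fun x => ?_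
    rw [abs_of_nonneg (by have := (hWpos x).le; positivity)]
    calc b x ≤ (1 + ‖x‖) ^ m * (2 ^ r * (1 + ‖x‖) ^ (-(2 * r))) := by
          simp only [hb, hW]
          gcongr
          exact one_add_norm_rpow_le x hr0
      _ = 2 ^ r * (1 + ‖x‖) ^ ((m : ℝ) + -(2 * r)) := by
          have := Real.rpow_add (x := 1 + ‖x‖) (by positivity) (m : ℝ) (-(2 * r))
          rw [this, Real.rpow_natCast]
          ring
      _ ≤ _ := by
          gcongr
          · exact one_le_one_add_norm x
          · rw [hr]
            have : (0 : ℝ) ≤ m := Nat.cast_nonneg m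
            have : (0 : ℝ) ≤ d := Nat.cast_nonneg d
            linarith
  let A : 𝓢(Rd d, ℂ) →ₗ[ℂ] ℂ := u.toLinearMap ∘ₗ (SchwartzMap.smulLeftCLM ℂ
    (fun x => (W x : ℂ))).toLinearMap
  have hA : ∀ ψ, A ψ = u (SchwartzMap.smulLeftCLM ℂ (fun x => (W x : ℂ)) ψ) := fun ψ => rfl
  let e : 𝓢(Rd d, ℂ) →ₗ[ℂ] Lp ℂ 2 (volume : Measure (Rd d)) :=
    (SchwartzMap.toLpCLM ℂ ℂ 2 volume).toLinearMap
  have hdense : DenseRange e := SchwartzMap.denseRange_toLpCLM (F := ℂ) (by simp)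
  have hnorm : ∃ D, ∀ ψ, ‖A ψ‖ ≤ D * ‖e ψ‖ := by
    -- By Cauchy–Schwarz the functional `ψ ↦ u(W ψ)` is bounded in the `L²` norm.
    refine ⟨C * (∫ x, ‖b x‖ ^ (2 : ℝ)) ^ (1 / 2 : ℝ), fun ψ => ?_⟩
    rw [hA]
    refine (hu _).trans ?_
    rw [mul_assoc]
    refine mul_le_mul_of_nonneg_left ?_ hC
    have h1 : ∀ ξ, (1 + ‖ξ‖) ^ m * ‖SchwartzMap.smulLeftCLM ℂ (fun x => (W x : ℂ)) ψ ξ‖ =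
        ‖b ξ‖ * ‖ψ ξ‖ := by
      intro ξ
      rw [SchwartzMap.smulLeftCLM_apply_apply hWc, smul_eq_mul, norm_mul, Complex.norm_real,
        Real.norm_of_nonneg (hWpos ξ).le, Real.norm_of_nonneg]
      · simp only [hb]
        ring
      · have := (hWpos ξ).le
        positivity
    simp only [h1]
    have h2 := integral_mul_norm_le_Lp_mul_Lq (μ := (volume : Measure (Rd d))) (f := b)
      (g := fun x => ‖ψ x‖) (p := 2) (q := 2) Real.HolderConjugate.two_two (by simpa using hb2)
      (by simpa using (ψ.memLp 2).norm)
    simp only [norm_norm] at h2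
    refine h2.trans (le_of_eq ?_)
    congr 1
    have h3 : ‖e ψ‖ = _ := SchwartzMap.norm_toLp' (f := ψ) (p := 2)
      (μ := (volume : Measure (Rd d))) (by simp) (by simp)
    rw [h3]
    simp
  -- Extension by density to `L²`, followed by the Riesz representation theorem.
  set T := A.extendOfNorm e with hT
  have hTe : ∀ ψ, T (e ψ) = A ψ := LinearMap.extendOfNorm_eq hdense hnorm
  set g₁ := (InnerProductSpace.toDual ℂ (Lp ℂ 2 (volume : Measure (Rd d)))).symm T with hg₁
  have hg₁m : MemLp g₁ 2 volume := Lp.memLp g₁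
  have hrep : ∀ ψ : 𝓢(Rd d, ℂ), A ψ = ∫ x, (starRingEnd ℂ) (g₁ x) * ψ x := by
    intro ψ
    rw [← hTe, ← InnerProductSpace.toDual_symm_apply, L2.inner_def]
    refine integral_congr_ae ?_
    filter_upwards [ψ.coeFn_toLp 2 volume] with x hx
    have : (e ψ : Rd d → ℂ) x = ψ x := hx
    rw [this, RCLike.inner_apply, mul_comm]
  -- The representing function of `u` is that of `u ∘ W` divided by `W`. Of the exponent `L`, the
  -- part `2(m + d + 1)` cancels `1/W` and the part `d + 1` leaves an `L²` factor, so that a product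
  -- of two `L²` functions is integrated.
  refine ⟨fun x => (starRingEnd ℂ) (g₁ x) * (((1 + ‖x‖ ^ 2) ^ r : ℝ) : ℂ), 2 * (m + d + 1) + (d + 1),
    ?_, ?_, fun ψ => ?_⟩
  · have h1 : AEStronglyMeasurable (fun x => (starRingEnd ℂ) (g₁ x)) volume :=
      Complex.continuous_conj.comp_aestronglyMeasurable hg₁m.1
    exact h1.mul hW'c.1.continuous.aestronglyMeasurable
  · have h1 : MemLp (fun x : Rd d => (1 + ‖x‖) ^ (-(d + 1 : ℝ))) 2 volume := by
      refine memLp_two_of_decay ?_ (C := 1) fun x => ?_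
      · refine Continuous.rpow_const (by fun_prop) fun x => Or.inl ?_
        positivity
      · rw [one_mul, abs_of_nonneg (by positivity)]
    have h2 := (hg₁m.norm).integrable_mul h1
    have h1c : Continuous fun x : Rd d => ‖(((1 + ‖x‖ ^ 2) ^ r : ℝ) : ℂ)‖ *
        ((1 + ‖x‖) ^ (2 * (m + d + 1) + (d + 1)))⁻¹ := by
      refine (hW'c.1.continuous.norm).mul (Continuous.inv₀ (by fun_prop) fun x => ?_)
      positivity
    refine h2.mono' ?_ (Filter.Eventually.of_forall fun x => ?_)
    · have := hg₁m.1.norm.mul h1c.aestronglyMeasurable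
      refine this.congr (Filter.Eventually.of_forall fun x => ?_)
      simp only [Pi.mul_apply, norm_mul, RCLike.norm_conj]
      ring
    · have hx : (0 : ℝ) < 1 + ‖x‖ := by positivity
      have h3 : (1 + ‖x‖ ^ 2) ^ r ≤ (1 + ‖x‖) ^ (2 * (m + d + 1)) := by
        calc (1 + ‖x‖ ^ 2) ^ r ≤ ((1 + ‖x‖) ^ 2) ^ r := by
              refine Real.rpow_le_rpow (by positivity) ?_ hr0
              nlinarith [norm_nonneg x]
          _ = _ := by
              have : r = ((m + d + 1 : ℕ) : ℝ) := by
                rw [hr]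
                push_cast
                ring
              rw [this, Real.rpow_natCast, pow_mul]
      have h4 : (1 + ‖x‖) ^ (-(d + 1 : ℝ)) = ((1 + ‖x‖) ^ (d + 1))⁻¹ := by
        rw [Real.rpow_neg hx.le]
        congr 1
        rw [← Real.rpow_natCast]
        push_cast
        rfl
      simp only [Pi.mul_apply]
      rw [h4, Real.norm_of_nonneg (by positivity), norm_mul, RCLike.norm_conj, Complex.norm_real,
        Real.norm_of_nonneg (by positivity), pow_add]
      rw [mul_inv, mul_assoc, ← mul_assoc ((1 + ‖x‖ ^ 2) ^ r)]
      refine mul_le_mul_of_nonneg_left ?_ (norm_nonneg _)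
      refine mul_le_of_le_one_left (by positivity) ?_
      rw [← div_eq_mul_inv, div_le_one (by positivity)]
      exact h3
  · have h1 := hrep (SchwartzMap.smulLeftCLM ℂ (fun x : Rd d => (((1 + ‖x‖ ^ 2) ^ r : ℝ) : ℂ)) ψ)
    rw [hA, SchwartzMap.smulLeftCLM_smulLeftCLM_apply hWc hW'c] at h1
    have h2 : (SchwartzMap.smulLeftCLM ℂ ((fun x => (W x : ℂ)) *
        fun x : Rd d => (((1 + ‖x‖ ^ 2) ^ r : ℝ) : ℂ)) ψ : 𝓢(Rd d, ℂ)) = ψ := by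
      ext x
      rw [SchwartzMap.smulLeftCLM_apply_apply (hWc.mul hW'c)]
      simp only [Pi.mul_apply, hW, smul_eq_mul]
      rw [← Complex.ofReal_mul, ← Real.rpow_add (by positivity)]
      simp
    rw [h2] at h1
    rw [h1]
    congr 1
    ext x
    rw [SchwartzMap.smulLeftCLM_apply_apply hW'c, smul_eq_mul]
    ring

end riesz

end FourierBF

end

noncomputable section

namespace FourierBF

open scoped ContDiff

/-! ### Cutoff functions -/

section cutoff
variable {d : ℕ}

open scoped Manifold in
theorem exists_cutoff {K T : Set (Rd d)} (hK : IsCompact K) (hT : IsCompact T)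
    (h : K ⊆ interior T) :
    ∃ θ : 𝓢(Rd d, ℂ), (∀ᶠ x in 𝓝ˢ K, θ x = 1) ∧ ∀ x, x ∉ T → θ x = 0 := by
  obtain ⟨f, h1, h2, -⟩ := exists_contMDiffMap_one_nhds_of_subset_interior (n := (⊤ : ℕ∞)) 𝓘(ℝ, Rd d)
    hK.isClosed h
  have hs : ContDiff ℝ ∞ (fun x => ((f x : ℝ) : ℂ)) :=
    Complex.ofRealCLM.contDiff.comp f.contMDiff.contDiff
  have hc : HasCompactSupport (fun x => ((f x : ℝ) : ℂ)) :=
    HasCompactSupport.intro hT fun x hx => by simp [h2 x hx]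
  refine ⟨hc.toSchwartzMap hs, ?_, fun x hx => ?_⟩
  · filter_upwards [h1] with x hx
    simp [hx]
  · simp [h2 x hx]

theorem hasCompactSupport_of_eq_zero {K : Set (Rd d)} (hK : IsCompact K) {φ : 𝓢(Rd d, ℂ)}
    (h : ∀ x, x ∉ K → φ x = 0) : HasCompactSupport φ := HasCompactSupport.intro hK h

theorem exists_cutoff_of_hasCompactSupport {φ : 𝓢(Rd d, ℂ)} (hφ : HasCompactSupport φ) :
    ∃ θ : 𝓢(Rd d, ℂ), HasCompactSupport θ ∧ ∀ x, θ x * φ x = φ x := by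
  obtain ⟨T, hT, hKT⟩ := exists_compact_superset hφ
  obtain ⟨θ, h1, h2⟩ := exists_cutoff hφ hT hKT
  refine ⟨θ, hasCompactSupport_of_eq_zero hT h2, fun x => ?_⟩
  by_cases hx : x ∈ tsupport φ
  · rw [h1.self_of_nhdsSet x hx, one_mul]
  · rw [image_eq_zero_of_notMem_tsupport hx, mul_zero]

end cutoff

/-! ### The Fourier transform of a compactly supported distribution -/

section representation
variable {d : ℕ}

theorem angularFourier_eq_phase (φ : 𝓢(Rd d, ℂ)) (ξ : Rd d) :
    angularFourier φ ξ = fourierConst d * ∫ x, phase (-ξ) x * φ x := by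
  rw [angularFourier_apply]
  simp [phase]

theorem phase_neg_comm (ξ x : Rd d) : phase (-ξ) x = phase (-x) ξ := by
  simp only [phase, inner_neg_right]
  rw [real_inner_comm]

theorem angularFourierInv_modulate (θ : 𝓢(Rd d, ℂ)) (ξ η : Rd d) :
    angularFourierInv (modulate ξ θ) η = angularFourierInv θ (η - ξ) := by
  rw [angularFourierInv_apply, angularFourierInv_apply]
  congr 2
  ext x
  rw [modulate_apply, ← mul_assoc, ← phase_add, sub_eq_add_neg]

theorem angularFourierInv_mul_angularFourier (θ ψ : 𝓢(Rd d, ℂ)) (η : Rd d) :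
    angularFourierInv (SchwartzMap.smulLeftCLM ℂ θ (angularFourier ψ)) η =
      fourierConst d * ∫ ξ, angularFourierInv θ (η - ξ) * ψ ξ := by
  have h1 : ∀ x, phase η x * (SchwartzMap.smulLeftCLM ℂ θ (angularFourier ψ)) x =
      ∫ ξ, fourierConst d * (phase η x * phase (-ξ) x * θ x * ψ ξ) := by
    intro x
    rw [SchwartzMap.smulLeftCLM_apply_apply θ.hasTemperateGrowth, angularFourier_eq_phase,
      integral_const_mul, smul_eq_mul]
    have : ∀ ξ, phase η x * phase (-ξ) x * θ x * ψ ξ =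
        phase η x * θ x * (phase (-x) ξ * ψ ξ) := fun ξ => by
      rw [phase_neg_comm ξ x]
      ring
    simp only [this]
    rw [integral_const_mul]
    ring
  rw [angularFourierInv_apply]
  simp only [h1]
  rw [integral_integral_swap]
  · congr 2
    ext ξ
    rw [integral_const_mul, angularFourierInv_apply, mul_assoc, ← integral_mul_const]
    congr 2
    ext x
    rw [sub_eq_add_neg, phase_add]
  · have h3 := ((θ.integrable (μ := volume)).mul_prod (ψ.integrable (μ := volume))).const_mul
      (fourierConst d : ℂ)
    refine h3.mono ?_ (Filter.Eventually.of_forall fun z => ?_)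
    · have h4 : Continuous (phase η) := (contDiff_phase η).continuous
      have h5 : Continuous fun z : Rd d × Rd d => phase (-z.2) z.1 :=
        continuous_phase_uncurry.comp (continuous_snd.neg.prodMk continuous_fst)
      have h6 := θ.continuous
      have h7 := ψ.continuous
      refine Continuous.aestronglyMeasurable ?_
      simp only [Function.uncurry_def]
      fun_prop
    · simp [Function.uncurry_def, norm_phase, mul_assoc]

theorem exists_decay (κ : 𝓢(Rd d, ℂ)) (L : ℕ) :
    ∃ C, 0 ≤ C ∧ ∀ x, ‖κ x‖ ≤ C * ((1 + ‖x‖) ^ L)⁻¹ := by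
  refine ⟨2 ^ L * ((Finset.Iic (L, 0)).sup (schwartzSeminormFamily ℝ (Rd d) ℂ) κ), ?_, fun x => ?_⟩
  · have : 0 ≤ (Finset.Iic (L, 0)).sup (schwartzSeminormFamily ℝ (Rd d) ℂ) κ := apply_nonneg _ _
    positivity
  · have := SchwartzMap.one_add_le_sup_seminorm_apply (𝕜 := ℝ) (m := (L, 0)) (k := L) (n := 0)
      le_rfl le_rfl κ x
    rw [norm_iteratedFDeriv_zero] at this
    rw [← div_eq_mul_inv, le_div_iff₀ (by positivity), mul_comm]
    exact this

theorem inv_one_add_norm_sub_le (η ξ : Rd d) (L : ℕ) :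
    ((1 + ‖η - ξ‖) ^ L)⁻¹ ≤ ((1 + ‖η‖) ^ L)⁻¹ * (1 + ‖ξ‖) ^ L := by
  rw [← div_eq_inv_mul, le_div_iff₀ (by positivity), inv_mul_le_iff₀ (by positivity), ← mul_pow]
  gcongr
  exact one_add_norm_le_sub η ξ

/-- Reproducing formula: since `θ φ = φ`, the test function `e^{-i⟨x,ξ⟩} φ` is `φ` times the Fourier
transform of the inverse transform of `e^{-i⟨x,ξ⟩} θ`, and modulation of `θ` is translation by `ξ`
on the Fourier side. -/
theorem localFourier_eq_integral {φ θ : 𝓢(Rd d, ℂ)} (hθ : ∀ x, θ x * φ x = φ x) (f : 𝓢'(Rd d, ℂ))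
    {g : Rd d → ℂ} (hg : ∀ ψ, distFourier (TemperedDistribution.smulLeftCLM ℂ φ f) ψ =
      ∫ x, g x * ψ x) (ξ : Rd d) :
    localFourier φ f ξ = fourierConst d * ∫ η, g η * angularFourierInv θ (η - ξ) := by
  rw [localFourier]
  congr 1
  have h1 : modulate ξ φ = SchwartzMap.smulLeftCLM ℂ φ (modulate ξ θ) := by
    ext x
    rw [SchwartzMap.smulLeftCLM_apply_apply φ.hasTemperateGrowth, modulate_apply, modulate_apply,
      smul_eq_mul]
    linear_combination -phase (-ξ) x * hθ x
  rw [h1]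
  have h2 := hg (angularFourierInv (modulate ξ θ))
  simp only [angularFourierInv_modulate] at h2
  rw [← h2]
  have h3 : distFourier (TemperedDistribution.smulLeftCLM ℂ φ f)
      (angularFourierInv (modulate ξ θ)) = f (SchwartzMap.smulLeftCLM ℂ φ
        (angularFourier (angularFourierInv (modulate ξ θ)))) := rfl
  rw [h3, angularFourier_angularFourierInv]

theorem integrable_mul_weight_of_decay {F : Type*} [NormedAddCommGroup F] {g : Rd d → F} {m : ℕ}
    {C : ℝ} (hgm : AEStronglyMeasurable g volume) (hg : ∀ x, ‖g x‖ ≤ C * (1 + ‖x‖) ^ m)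
    (ψ : 𝓢(Rd d, ℂ)) : Integrable fun x => ‖g x‖ * ‖ψ x‖ := by
  refine ((integrable_weight_mul_norm ψ m).const_mul C).mono'
    (hgm.norm.mul ψ.continuous.aestronglyMeasurable.norm) (Filter.Eventually.of_forall fun x => ?_)
  rw [Real.norm_of_nonneg (by positivity), ← mul_assoc]
  gcongr
  exact hg x

/-- The Fourier transform of the compactly supported distribution `φ f` is the function
`localFourier φ f`. -/
theorem localFourier_spec {φ : 𝓢(Rd d, ℂ)} (hφ : HasCompactSupport φ) (f : 𝓢'(Rd d, ℂ)) :
    AEStronglyMeasurable (localFourier φ f) volume ∧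
      IsRepresentedBy (distFourier (TemperedDistribution.smulLeftCLM ℂ φ f)) (localFourier φ f) := by
  obtain ⟨m, hm⟩ := exists_distOrderLE f
  obtain ⟨C, hC, hb⟩ := hm.exists_bound_fourier φ
  -- An abstract representative `g`, known only almost everywhere. The reproducing formula then
  -- identifies it, as a distribution, with the explicit function `localFourier φ f`.
  obtain ⟨g, L, hgm, hgi, hg⟩ := exists_function_of_bound _ m C hC hb
  obtain ⟨θ, -, hθ⟩ := exists_cutoff_of_hasCompactSupport hφ
  obtain ⟨D, hD0, hD⟩ := exists_decay (angularFourierInv θ) L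
  have hform := localFourier_eq_integral hθ f hg
  have hκ := (angularFourierInv θ).continuous
  have hmeas : AEStronglyMeasurable (localFourier φ f) volume := by
    have h1 : AEStronglyMeasurable (fun p : Rd d × Rd d => g p.2 * angularFourierInv θ (p.2 - p.1))
        (volume.prod volume) := by
      refine (hgm.comp_snd).mul (Continuous.aestronglyMeasurable ?_)
      fun_prop
    have h2 := (h1.integral_prod_right').const_mul (fourierConst d : ℂ)
    exact h2.congr (Filter.Eventually.of_forall fun ξ => (hform ξ).symm)
  obtain ⟨A, hA, hgrow⟩ := hm.localFourier_le φ
  refine ⟨hmeas, fun ψ => ⟨?_, ?_⟩⟩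
  · refine (integrable_mul_weight_of_decay hmeas hgrow ψ).mono
      (hmeas.mul ψ.continuous.aestronglyMeasurable) (Filter.Eventually.of_forall fun x => ?_)
    simp
  -- Inserting `θ` next to `φ` replaces `ψ` by a convolution with the inverse transform of `θ`;
  -- Fubini moves this convolution onto `g`, where it yields `localFourier φ f`.
  · have h1 : distFourier (TemperedDistribution.smulLeftCLM ℂ φ f) ψ =
        distFourier (TemperedDistribution.smulLeftCLM ℂ φ f)
          (angularFourierInv (SchwartzMap.smulLeftCLM ℂ θ (angularFourier ψ))) := by
      have h2 : ∀ χ, distFourier (TemperedDistribution.smulLeftCLM ℂ φ f) χ =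
        f (SchwartzMap.smulLeftCLM ℂ φ (angularFourier χ)) := fun _ => rfl
      rw [h2, h2, angularFourier_angularFourierInv]
      congr 1
      ext x
      rw [SchwartzMap.smulLeftCLM_apply_apply φ.hasTemperateGrowth,
        SchwartzMap.smulLeftCLM_apply_apply φ.hasTemperateGrowth,
        SchwartzMap.smulLeftCLM_apply_apply θ.hasTemperateGrowth, smul_eq_mul, smul_eq_mul,
        smul_eq_mul]
      linear_combination -angularFourier ψ x * hθ x
    rw [h1, hg]
    simp only [angularFourierInv_mul_angularFourier, hform]
    have h3 : ∀ η, g η * (fourierConst d * ∫ ξ, angularFourierInv θ (η - ξ) * ψ ξ) =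
        ∫ ξ, fourierConst d * (g η * angularFourierInv θ (η - ξ) * ψ ξ) := by
      intro η
      rw [mul_left_comm, ← integral_const_mul, ← integral_const_mul]
      congr 1
      ext ξ
      ring
    simp only [h3]
    rw [integral_integral_swap]
    · congr 1
      ext ξ
      rw [integral_const_mul, integral_mul_const]
      ring
    · have h4 := (hgi.mul_prod (integrable_weight_mul_norm ψ L)).const_mul (fourierConst d * D)
      refine h4.mono' ?_ (Filter.Eventually.of_forall fun z => ?_)
      · have h5 := ψ.continuous
        refine AEStronglyMeasurable.const_mul ?_ _
        refine (hgm.comp_fst.mul (Continuous.aestronglyMeasurable ?_)).mul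
          (Continuous.aestronglyMeasurable ?_)
        · fun_prop
        · fun_prop
      · obtain ⟨η, ξ⟩ := z
        simp only [Function.uncurry_apply_pair, norm_mul, Complex.norm_real,
          Real.norm_of_nonneg (fourierConst_pos d).le]
        have := (fourierConst_pos d).le
        calc fourierConst d * (‖g η‖ * ‖angularFourierInv θ (η - ξ)‖ * ‖ψ ξ‖)
            ≤ fourierConst d * (‖g η‖ * (D * (((1 + ‖η‖) ^ L)⁻¹ * (1 + ‖ξ‖) ^ L)) * ‖ψ ξ‖) := by
              gcongr
              refine (hD _).trans ?_
              gcongr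
              exact inv_one_add_norm_sub_le η ξ L
          _ = _ := by ring

/-- The value of `φ f` on a Schwartz function in terms of its Fourier transform. -/
theorem smul_apply_eq_integral {φ : 𝓢(Rd d, ℂ)} (hφ : HasCompactSupport φ) (f : 𝓢'(Rd d, ℂ))
    (ψ : 𝓢(Rd d, ℂ)) : f (SchwartzMap.smulLeftCLM ℂ φ ψ) =
      ∫ η, localFourier φ f η * angularFourierInv ψ η := by
  rw [← ((localFourier_spec hφ f).2 (angularFourierInv ψ)).2]
  have : distFourier (TemperedDistribution.smulLeftCLM ℂ φ f) (angularFourierInv ψ) =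
    f (SchwartzMap.smulLeftCLM ℂ φ (angularFourier (angularFourierInv ψ))) := rfl
  rw [this, angularFourier_angularFourierInv]

/-- The distribution enters only through `localFourier φ f`, so estimates for `Op(a)(φ f)` become
estimates for the oscillatory integral as a kernel. -/
theorem op_smul_apply_eq_integral {a : Rd d × Rd d → ℂ} (ha : HasUniformTemperateGrowth a)
    {φ : 𝓢(Rd d, ℂ)} (hφ : HasCompactSupport φ) (f : 𝓢'(Rd d, ℂ)) (ψ : 𝓢(Rd d, ℂ)) :
    op a ha (TemperedDistribution.smulLeftCLM ℂ φ f) ψ =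
      fourierConst d * ∫ η, localFourier φ f η * HasUniformTemperateGrowth.oscIntegral a ψ η := by
  have h : op a ha (TemperedDistribution.smulLeftCLM ℂ φ f) ψ =
    distFourier (TemperedDistribution.smulLeftCLM ℂ φ f)
      ((fourierConst d : ℂ) • ha.oscIntegralCLM a ψ) := rfl
  rw [h, map_smul, ((localFourier_spec hφ f).2 _).2]
  rfl

end representation

end FourierBF

end

noncomputable section

namespace FourierBF

open scoped ContDiff

/-! ### Commutation relations for the transposed operator -/

section commutation
variable {d : ℕ}

/-- The partial derivative in the `j`-th coordinate on the Schwartz space. -/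
def schwartzDeriv (j : Fin d) (φ : 𝓢(Rd d, ℂ)) : 𝓢(Rd d, ℂ) :=
  LineDeriv.lineDerivOp (EuclideanSpace.single j (1 : ℝ)) φ

theorem schwartzDeriv_coe (j : Fin d) (φ : 𝓢(Rd d, ℂ)) : ⇑(schwartzDeriv j φ) = partialDeriv j φ :=
  rfl

theorem hasTemperateGrowth_inner_single (j : Fin d) :
    (fun x : Rd d => (inner ℝ x (EuclideanSpace.single j (1 : ℝ)) : ℝ)).HasTemperateGrowth :=
  ((innerSL ℝ).flip (EuclideanSpace.single j (1 : ℝ))).hasTemperateGrowth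

theorem inner_single_one (x : Rd d) (j : Fin d) :
    (inner ℝ x (EuclideanSpace.single j (1 : ℝ)) : ℝ) = x j := by
  simp [EuclideanSpace.inner_single_right]

theorem angularFourier_eq_fourier (φ : 𝓢(Rd d, ℂ)) (ξ : Rd d) :
    angularFourier φ ξ = fourierConst d * (𝓕 φ : 𝓢(Rd d, ℂ)) ((2 * Real.pi)⁻¹ • ξ) := rfl

theorem angularFourier_schwartzDeriv (j : Fin d) (φ : 𝓢(Rd d, ℂ)) (y : Rd d) :
    angularFourier (schwartzDeriv j φ) y = Complex.I * (y j : ℂ) * angularFourier φ y := by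
  rw [angularFourier_eq_fourier, angularFourier_eq_fourier, schwartzDeriv,
    SchwartzMap.fourier_lineDerivOp_eq, _root_.smul_apply,
    SchwartzMap.smulLeftCLM_apply_apply (hasTemperateGrowth_inner_single j), inner_single_one]
  simp only [PiLp.smul_apply, smul_eq_mul, Complex.real_smul]
  push_cast
  have : (Real.pi : ℂ) ≠ 0 := by exact_mod_cast Real.pi_ne_zero
  field_simp

theorem schwartzDeriv_angularFourier_apply (j : Fin d) (φ φ' : 𝓢(Rd d, ℂ))
    (h : ∀ η, φ' η = Complex.I * (η j : ℂ) * φ η) (y : Rd d) :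
    schwartzDeriv j (angularFourier φ) y = -angularFourier φ' y := by
  have e : angularFourier φ = (fourierConst d : ℂ) •
      SchwartzMap.compCLMOfContinuousLinearEquiv ℂ (scaling d) (𝓕 φ) := rfl
  have hφ' : SchwartzMap.smulLeftCLM ℂ
      (fun x : Rd d => (inner ℝ x (EuclideanSpace.single j (1 : ℝ)) : ℝ)) φ =
        (-Complex.I) • φ' := by
    ext η
    rw [SchwartzMap.smulLeftCLM_apply_apply (hasTemperateGrowth_inner_single j), inner_single_one,
      _root_.smul_apply, h, Complex.real_smul, smul_eq_mul, ← mul_assoc, ← mul_assoc]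
    simp
  have h2 : LineDeriv.lineDerivOp (EuclideanSpace.single j (1 : ℝ)) (𝓕 φ) =
      (-(2 * Real.pi : ℂ)) • (𝓕 φ' : 𝓢(Rd d, ℂ)) := by
    rw [SchwartzMap.lineDerivOp_fourier_eq, hφ']
    have : 𝓕 (-(2 * Real.pi * Complex.I) • (-Complex.I) • φ') =
      (SchwartzMap.fourierTransformCLM ℂ) (-(2 * Real.pi * Complex.I) • (-Complex.I) • φ') := rfl
    rw [this, map_smul, map_smul, smul_smul]
    have h3 : -(2 * (Real.pi : ℂ) * Complex.I) * -Complex.I = -(2 * Real.pi) := by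
      linear_combination (2 * (Real.pi : ℂ)) * Complex.I_mul_I
    rw [h3]
    rfl
  rw [schwartzDeriv, e, LineDeriv.lineDerivOp_smul,
    SchwartzMap.lineDerivOp_compCLMOfContinuousLinearEquiv, angularFourier_eq_fourier]
  have h4 : scaling d (EuclideanSpace.single j (1 : ℝ)) =
      (2 * Real.pi)⁻¹ • EuclideanSpace.single j (1 : ℝ) := rfl
  rw [h4, LineDeriv.lineDerivOp_left_smul, h2]
  have h5 : scaling d y = (2 * Real.pi)⁻¹ • y := rfl
  simp only [_root_.smul_apply, SchwartzMap.compCLMOfContinuousLinearEquiv_apply,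
    Function.comp_apply, smul_eq_mul, Complex.real_smul, h5]
  push_cast
  have : (Real.pi : ℂ) ≠ 0 := by exact_mod_cast Real.pi_ne_zero
  field_simp

/-- The derivative of a symbol in a coordinate direction of phase space. -/
def symDeriv (s : Fin d ⊕ Fin d) (a : Rd d × Rd d → ℂ) (z : Rd d × Rd d) : ℂ :=
  fderiv ℝ a z (coordDir s)

/-- The symbol `i ξ_j a(x,ξ)`. -/
def freqMul (j : Fin d) (a : Rd d × Rd d → ℂ) (z : Rd d × Rd d) : ℂ :=
  Complex.I * (z.2 j : ℂ) * a z

theorem HasUniformTemperateGrowth.symDeriv {a : Rd d × Rd d → ℂ} (ha : HasUniformTemperateGrowth a)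
    (s : Fin d ⊕ Fin d) : HasUniformTemperateGrowth (FourierBF.symDeriv s a) :=
  clm_comp (ContinuousLinearMap.apply ℝ ℂ (coordDir s)) ha.fderiv

theorem HasUniformTemperateGrowth.freqMul {a : Rd d × Rd d → ℂ} (ha : HasUniformTemperateGrowth a)
    (j : Fin d) : HasUniformTemperateGrowth (FourierBF.freqMul j a) := by
  have h1 : HasUniformTemperateGrowth (fun z : Rd d × Rd d => Complex.I * (z.2 j : ℂ)) :=
    bilin (ContinuousLinearMap.mul ℝ ℂ) (const Complex.I)
      (clm (Complex.ofRealCLM.comp ((EuclideanSpace.proj j).comp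
        (ContinuousLinearMap.snd ℝ (Rd d) (Rd d)))))
  exact bilin (ContinuousLinearMap.mul ℝ ℂ) h1 ha

open HasUniformTemperateGrowth

theorem oscIntegral_eq_phase (a : Rd d × Rd d → ℂ) (φ : Rd d → ℂ) (ξ : Rd d) :
    oscIntegral a φ ξ = ∫ x, phase ξ x * φ x * a (x, ξ) := rfl

theorem integrable_phase_mul {a : Rd d × Rd d → ℂ} (ha : HasUniformTemperateGrowth a)
    (φ : 𝓢(Rd d, ℂ)) (ξ : Rd d) : Integrable fun x => phase ξ x * φ x * a (x, ξ) :=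
  ha.integrable_integrand φ ξ

theorem opTranspose_apply {a : Rd d × Rd d → ℂ} (ha : HasUniformTemperateGrowth a)
    (φ : 𝓢(Rd d, ℂ)) (y : Rd d) :
    opTranspose a ha φ y = fourierConst d * angularFourier (ha.oscIntegralCLM a φ) y := by
  have : opTranspose a ha φ = angularFourier ((fourierConst d : ℂ) • ha.oscIntegralCLM a φ) := rfl
  rw [this, map_smul]
  rfl

/-- The variable `y` occurs only in `e^{-i⟨y,ξ⟩}`, so `∂_{y_j}` multiplies the symbol by `-iξ_j`. -/
theorem schwartzDeriv_opTranspose {a : Rd d × Rd d → ℂ} (ha : HasUniformTemperateGrowth a)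
    (j : Fin d) (φ : 𝓢(Rd d, ℂ)) (y : Rd d) :
    schwartzDeriv j (opTranspose a ha φ) y = -opTranspose (freqMul j a) (ha.freqMul j) φ y := by
  have h : opTranspose a ha φ = (fourierConst d : ℂ) • angularFourier (ha.oscIntegralCLM a φ) := by
    ext y
    rw [opTranspose_apply]
    rfl
  rw [opTranspose_apply, h, schwartzDeriv, LineDeriv.lineDerivOp_smul]
  have h1 := schwartzDeriv_angularFourier_apply j (ha.oscIntegralCLM a φ)
    ((ha.freqMul j).oscIntegralCLM (freqMul j a) φ) (fun η => by
      have e1 : ((ha.freqMul j).oscIntegralCLM (freqMul j a) φ) η =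
        oscIntegral (freqMul j a) φ η := rfl
      have e2 : (ha.oscIntegralCLM a φ) η = oscIntegral a φ η := rfl
      rw [e1, e2, oscIntegral_eq_phase, oscIntegral_eq_phase, ← integral_const_mul]
      congr 1
      ext x
      simp only [freqMul]
      ring) y
  rw [_root_.smul_apply]
  have h2 : (LineDeriv.lineDerivOp (EuclideanSpace.single j (1 : ℝ))
    (angularFourier (ha.oscIntegralCLM a φ)) : 𝓢(Rd d, ℂ)) y = _ := h1
  rw [h2, smul_eq_mul, mul_neg]

theorem partialDeriv_oscIntegral {a : Rd d × Rd d → ℂ} (ha : HasUniformTemperateGrowth a)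
    (j : Fin d) (φ φ' : 𝓢(Rd d, ℂ)) (h : ∀ x, φ' x = (x j : ℂ) * φ x) (η : Rd d) :
    partialDeriv j (oscIntegral a φ) η =
      oscIntegral (symDeriv (Sum.inr j) a) φ η + Complex.I * oscIntegral a φ' η := by
  rw [partialDeriv, (ha.hasFDerivAt_oscIntegral φ η).fderiv]
  have h1 : oscIntegral (derivSymbol a) φ η (EuclideanSpace.single j 1) =
      ∫ x, ((Complex.exp (Complex.I * (inner ℝ x η : ℝ)) * φ x) • derivSymbol a (x, η))
        (EuclideanSpace.single j 1) :=
    ContinuousLinearMap.integral_apply (ha.derivSymbol_growth.integrable_integrand φ η) _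
  rw [h1, oscIntegral_eq_phase, oscIntegral_eq_phase, ← integral_const_mul, ← integral_add
    (integrable_phase_mul (ha.symDeriv _) φ η) ((integrable_phase_mul ha φ' η).const_mul _)]
  congr 1
  ext x
  rw [h]
  simp only [derivSymbol, _root_.smul_apply, _root_.add_apply, ContinuousLinearMap.comp_apply,
    ContinuousLinearMap.smulRight_apply, ContinuousLinearMap.inr_apply, innerSL_apply_apply,
    inner_single_one, smul_eq_mul, Complex.real_smul, symDeriv, coordDir, phase]
  ring

/-- The factor `x_j - y_j` against `e^{i⟨x-y,ξ⟩}` is `-i∂_{ξ_j}`; integration by parts moves the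
derivative to the symbol. Hence each factor `x_j - y_j` lowers the order of the symbol. -/
theorem opTranspose_coord_mul {a : Rd d × Rd d → ℂ} (ha : HasUniformTemperateGrowth a)
    (j : Fin d) (φ φ' : 𝓢(Rd d, ℂ)) (h : ∀ x, φ' x = (x j : ℂ) * φ x) (y : Rd d) :
    opTranspose a ha φ' y = (y j : ℂ) * opTranspose a ha φ y +
      Complex.I * opTranspose _ (ha.symDeriv (Sum.inr j)) φ y := by
  rw [opTranspose_apply, opTranspose_apply, opTranspose_apply]
  have h1 : ha.oscIntegralCLM a φ' = (-Complex.I) • schwartzDeriv j (ha.oscIntegralCLM a φ) +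
      Complex.I • (ha.symDeriv (Sum.inr j)).oscIntegralCLM _ φ := by
    ext η
    have h2 : schwartzDeriv j (ha.oscIntegralCLM a φ) η = _ :=
      partialDeriv_oscIntegral ha j φ φ' h η
    have e1 : (ha.oscIntegralCLM a φ') η = oscIntegral a φ' η := rfl
    have e2 : ((ha.symDeriv (Sum.inr j)).oscIntegralCLM _ φ) η =
      oscIntegral (symDeriv (Sum.inr j) a) φ η := rfl
    rw [_root_.add_apply, _root_.smul_apply, _root_.smul_apply, h2, e1, e2, smul_eq_mul,
      smul_eq_mul]
    linear_combination oscIntegral a φ' η * Complex.I_mul_I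
  rw [h1, map_add, map_smul, map_smul]
  simp only [_root_.add_apply, _root_.smul_apply, smul_eq_mul, angularFourier_schwartzDeriv]
  linear_combination (-(fourierConst d : ℂ) * (y j : ℂ) *
    angularFourier (ha.oscIntegralCLM a φ) y) * Complex.I_mul_I

theorem integral_schwartzDeriv (j : Fin d) (φ : 𝓢(Rd d, ℂ)) : ∫ x, schwartzDeriv j φ x = 0 := by
  have h := angularFourier_schwartzDeriv j φ 0
  rw [angularFourier_eq_phase] at h
  have hc : (fourierConst d : ℂ) ≠ 0 := by exact_mod_cast (fourierConst_pos d).ne'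
  simpa [phase, hc] using h

theorem differentiable_symbol {a : Rd d × Rd d → ℂ} (ha : HasUniformTemperateGrowth a) :
    Differentiable ℝ a := ha.1.differentiable (by simp)

theorem partialDeriv_mul {f g : Rd d → ℂ} {x : Rd d} (hf : DifferentiableAt ℝ f x)
    (hg : DifferentiableAt ℝ g x) (j : Fin d) :
    partialDeriv j (fun x => f x * g x) x = f x * partialDeriv j g x + partialDeriv j f x * g x := by
  rw [partialDeriv, fderiv_fun_mul hf hg]
  simp only [_root_.add_apply, _root_.smul_apply, smul_eq_mul, partialDeriv]
  ring

theorem partialDeriv_slice {a : Rd d × Rd d → ℂ} (ha : HasUniformTemperateGrowth a) (j : Fin d)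
    (x ξ : Rd d) : partialDeriv j (fun x => a (x, ξ)) x = symDeriv (Sum.inl j) a (x, ξ) := by
  have hp : HasFDerivAt (fun x : Rd d => ((x, ξ) : Rd d × Rd d))
      (ContinuousLinearMap.inl ℝ (Rd d) (Rd d)) x := hasFDerivAt_prodMk_left x ξ
  have h1 := ((differentiable_symbol ha) (x, ξ)).hasFDerivAt.comp x hp
  have h2 : HasFDerivAt (fun x => a (x, ξ)) _ x := h1
  rw [partialDeriv, h2.fderiv]
  rfl

/-- Integration by parts in `x`: the derivative falls on `e^{i⟨x,ξ⟩}` and on `a`. -/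
theorem opTranspose_schwartzDeriv {a : Rd d × Rd d → ℂ} (ha : HasUniformTemperateGrowth a)
    (j : Fin d) (φ : 𝓢(Rd d, ℂ)) (y : Rd d) :
    opTranspose a ha (schwartzDeriv j φ) y =
      -opTranspose _ ((ha.freqMul j).add (ha.symDeriv (Sum.inl j))) φ y := by
  rw [opTranspose_apply, opTranspose_apply]
  have h1 : ha.oscIntegralCLM a (schwartzDeriv j φ) =
      -((ha.freqMul j).add (ha.symDeriv (Sum.inl j))).oscIntegralCLM _ φ := by
    ext η
    have e1 : ha.oscIntegralCLM a (schwartzDeriv j φ) η =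
      oscIntegral a (schwartzDeriv j φ) η := rfl
    have e2 : (((ha.freqMul j).add (ha.symDeriv (Sum.inl j))).oscIntegralCLM _ φ) η =
      oscIntegral (fun z => freqMul j a z + symDeriv (Sum.inl j) a z) φ η := rfl
    rw [_root_.neg_apply, e1, e2, oscIntegral_eq_phase, oscIntegral_eq_phase, eq_neg_iff_add_eq_zero,
      ← integral_add (integrable_phase_mul ha _ η)
        (integrable_phase_mul ((ha.freqMul j).add (ha.symDeriv (Sum.inl j))) φ η)]
    -- The integral of `∂_j(e^{i⟨x,η⟩} φ(x) a(x,η))` vanishes; the product rule yields the three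
    -- terms.
    have h2 := integral_schwartzDeriv j (SchwartzMap.smulLeftCLM ℂ (phase η) (ha.sliceMul η φ))
    rw [← h2]
    congr 1
    ext x
    have e3 : ⇑(SchwartzMap.smulLeftCLM ℂ (phase η) (ha.sliceMul η φ)) =
        fun x => phase η x * (φ x * a (x, η)) := by
      ext x
      rw [SchwartzMap.smulLeftCLM_apply_apply (hasTemperateGrowth_phase η), sliceMul_apply]
      rfl
    have d1 : DifferentiableAt ℝ (fun x => a (x, η)) x :=
      (ha.slice_hasTemperateGrowth η).1.differentiable (by simp) x
    have d2 : DifferentiableAt ℝ φ x := φ.differentiableAt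
    rw [schwartzDeriv_coe, schwartzDeriv_coe, e3,
      partialDeriv_mul ((contDiff_phase η).differentiable (by simp) x) (d2.fun_mul d1),
      partialDeriv_mul d2 d1, partialDeriv_slice ha, partialDeriv_phase]
    simp only [freqMul]
    ring
  rw [h1, map_neg]
  simp

end commutation

end FourierBF

end

noncomputable section

namespace FourierBF

open scoped ContDiff

/-! ### Symbols of finite order -/

section order
variable {d : ℕ}

/-- Bounds for the derivatives of `a` up to order `k`, of symbol type with order `M` in the
frequency and polynomial growth `N` in the position. -/
def SymbolBounds (ρ : ℝ) (N : ℕ) : ℕ → ℝ → (Rd d × Rd d → ℂ) → Prop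
  | 0, M, a => ∃ C, 0 ≤ C ∧ ∀ x ξ, ‖a (x, ξ)‖ ≤ C * (1 + ‖x‖) ^ N * (1 + ‖ξ‖) ^ M
  | k + 1, M, a => (∃ C, 0 ≤ C ∧ ∀ x ξ, ‖a (x, ξ)‖ ≤ C * (1 + ‖x‖) ^ N * (1 + ‖ξ‖) ^ M) ∧
      (∀ j, SymbolBounds ρ N k M (symDeriv (Sum.inl j) a)) ∧
      ∀ j, SymbolBounds ρ N k (M - ρ) (symDeriv (Sum.inr j) a)

namespace SymbolBounds

variable {ρ : ℝ} {N : ℕ}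

theorem mono {k : ℕ} : ∀ {M M' : ℝ} {a : Rd d × Rd d → ℂ}, M ≤ M' → SymbolBounds ρ N k M a →
    SymbolBounds ρ N k M' a := by
  have h0 : ∀ {M M' : ℝ} {a : Rd d × Rd d → ℂ}, M ≤ M' → SymbolBounds ρ N 0 M a →
      SymbolBounds ρ N 0 M' a := by
    rintro M M' a hM ⟨C, hC, h⟩
    refine ⟨C, hC, fun x ξ => (h x ξ).trans ?_⟩
    gcongr
    exact one_le_one_add_norm ξ
  induction k with
  | zero => exact h0
  | succ k ih =>
    rintro M M' a hM ⟨h, h1, h2⟩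
    exact ⟨h0 hM h, fun j => ih hM (h1 j), fun j => ih (by linarith) (h2 j)⟩

theorem add {k : ℕ} : ∀ {M : ℝ} {a b : Rd d × Rd d → ℂ}, HasUniformTemperateGrowth a →
    HasUniformTemperateGrowth b → SymbolBounds ρ N k M a → SymbolBounds ρ N k M b →
    SymbolBounds ρ N k M (fun z => a z + b z) := by
  have h0 : ∀ {M : ℝ} {a b : Rd d × Rd d → ℂ}, SymbolBounds ρ N 0 M a → SymbolBounds ρ N 0 M b →
      SymbolBounds ρ N 0 M (fun z => a z + b z) := by
    rintro M a b ⟨C, hC, h⟩ ⟨D, hD, h'⟩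
    refine ⟨C + D, by positivity, fun x ξ => (norm_add_le _ _).trans ?_⟩
    rw [add_mul, add_mul]
    exact add_le_add (h x ξ) (h' x ξ)
  induction k with
  | zero => exact fun _ _ => h0
  | succ k ih =>
    rintro M a b ha hb ⟨h, h1, h2⟩ ⟨h', h1', h2'⟩
    have e : ∀ s, symDeriv s (fun z => a z + b z) = fun z => symDeriv s a z + symDeriv s b z := by
      intro s
      ext z
      simp only [symDeriv]
      rw [fderiv_fun_add (differentiable_symbol ha z) (differentiable_symbol hb z)]
      rfl
    refine ⟨h0 h h', fun j => ?_, fun j => ?_⟩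
    · rw [e]
      exact ih (ha.symDeriv _) (hb.symDeriv _) (h1 j) (h1' j)
    · rw [e]
      exact ih (ha.symDeriv _) (hb.symDeriv _) (h2 j) (h2' j)

theorem const_mul (c : ℂ) {k : ℕ} : ∀ {M : ℝ} {a : Rd d × Rd d → ℂ}, HasUniformTemperateGrowth a →
    SymbolBounds ρ N k M a → SymbolBounds ρ N k M (fun z => c * a z) := by
  have h0 : ∀ {M : ℝ} {a : Rd d × Rd d → ℂ}, SymbolBounds ρ N 0 M a →
      SymbolBounds ρ N 0 M (fun z => c * a z) := by
    rintro M a ⟨C, hC, h⟩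
    refine ⟨‖c‖ * C, by positivity, fun x ξ => ?_⟩
    rw [norm_mul, mul_assoc, mul_assoc, ← mul_assoc C]
    gcongr
    exact h x ξ
  induction k with
  | zero => exact fun _ => h0
  | succ k ih =>
    rintro M a ha ⟨h, h1, h2⟩
    have e : ∀ s, symDeriv s (fun z => c * a z) = fun z => c * symDeriv s a z := by
      intro s
      ext z
      simp only [symDeriv]
      rw [fderiv_const_mul (differentiable_symbol ha z)]
      rfl
    refine ⟨h0 h, fun j => ?_, fun j => ?_⟩
    · rw [e]
      exact ih (ha.symDeriv _) (h1 j)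
    · rw [e]
      exact ih (ha.symDeriv _) (h2 j)

theorem symDeriv_freqMul {a : Rd d × Rd d → ℂ} (ha : HasUniformTemperateGrowth a) (i : Fin d)
    (s : Fin d ⊕ Fin d) : symDeriv s (freqMul i a) = fun z =>
      (Complex.I * ((coordDir s).2 i : ℂ)) * a z + freqMul i (symDeriv s a) z := by
  ext z
  have h1 : HasFDerivAt (fun z : Rd d × Rd d => (z.2 i : ℂ))
      (Complex.ofRealCLM.comp ((EuclideanSpace.proj i).comp
        (ContinuousLinearMap.snd ℝ (Rd d) (Rd d)))) z :=
    (Complex.ofRealCLM.comp ((EuclideanSpace.proj i).comp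
        (ContinuousLinearMap.snd ℝ (Rd d) (Rd d)))).hasFDerivAt
  have h2 := (h1.const_mul Complex.I).mul (differentiable_symbol ha z).hasFDerivAt
  have h3 : HasFDerivAt (freqMul i a) _ z := h2
  simp only [symDeriv, freqMul]
  rw [← h3.fderiv] at h2
  have h4 := congrArg (fun l => l (coordDir s)) h3.fderiv
  refine Eq.trans h4 ?_
  simp
  ring

/-- When `∂_{ξ_j}` hits the factor `ξ_i`, the undifferentiated `a` of order `M` remains, and it has
to fit into order `M + 1 - ρ`. This is where `ρ ≤ 1` is needed, and why `min ρ 1` replaces `ρ`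
later. -/
theorem freqMul {k : ℕ} (hρ : ρ ≤ 1) (i : Fin d) : ∀ {M : ℝ} {a : Rd d × Rd d → ℂ},
    HasUniformTemperateGrowth a → SymbolBounds ρ N k M a →
      SymbolBounds ρ N k (M + 1) (FourierBF.freqMul i a) := by
  have h0 : ∀ {M : ℝ} {a : Rd d × Rd d → ℂ}, SymbolBounds ρ N 0 M a →
      SymbolBounds ρ N 0 (M + 1) (FourierBF.freqMul i a) := by
    rintro M a ⟨C, hC, h⟩
    refine ⟨C, hC, fun x ξ => ?_⟩
    simp only [FourierBF.freqMul, norm_mul, Complex.norm_I, one_mul, Complex.norm_real]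
    rw [Real.rpow_add (one_add_norm_pos ξ), Real.rpow_one]
    have h1 : ‖ξ i‖ ≤ 1 + ‖ξ‖ := (PiLp.norm_apply_le ξ i).trans (by linarith)
    calc ‖ξ i‖ * ‖a (x, ξ)‖ ≤ (1 + ‖ξ‖) * (C * (1 + ‖x‖) ^ N * (1 + ‖ξ‖) ^ M) := by
          gcongr
          exact h x ξ
      _ = _ := by ring
  induction k with
  | zero => exact fun _ => h0
  | succ k ih =>
    rintro M a ha ⟨h, h1, h2⟩
    refine ⟨h0 h, fun j => ?_, fun j => ?_⟩
    · rw [symDeriv_freqMul ha]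
      have e : (fun z => (Complex.I * ((coordDir (Sum.inl j)).2 i : ℂ)) * a z +
          FourierBF.freqMul i (symDeriv (Sum.inl j) a) z) =
            FourierBF.freqMul i (symDeriv (Sum.inl j) a) := by
        ext z
        simp [coordDir]
      rw [e]
      exact ih (ha.symDeriv _) (h1 j)
    · rw [symDeriv_freqMul ha]
      have hk : SymbolBounds ρ N k M a := by
        clear ih
        have : ∀ k {M : ℝ} {a : Rd d × Rd d → ℂ}, SymbolBounds ρ N (k + 1) M a →
            SymbolBounds ρ N k M a := by
          intro k
          induction k with
          | zero => exact fun h => h.1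
          | succ k ih => exact fun h => ⟨h.1, fun j => ih (h.2.1 j), fun j => ih (h.2.2 j)⟩
        exact this k ⟨h, h1, h2⟩
      have h3 := ih (ha.symDeriv (Sum.inr j)) (h2 j)
      refine add (HasUniformTemperateGrowth.bilin (ContinuousLinearMap.mul ℝ ℂ)
        (HasUniformTemperateGrowth.const _) ha) ((ha.symDeriv _).freqMul i)
        (mono (by linarith) (const_mul _ ha hk)) (mono (by linarith) h3)

end SymbolBounds

/-- Symbols of finite order and type `ρ`. -/
structure FiniteOrder (ρ : ℝ) (a : Rd d × Rd d → ℂ) : Prop where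
  growth : HasUniformTemperateGrowth a
  bounds : ∃ (N : ℕ) (M : ℝ), ∀ k, SymbolBounds ρ N k M a

theorem FiniteOrder.freqMul {ρ : ℝ} (hρ : ρ ≤ 1) {a : Rd d × Rd d → ℂ} (ha : FiniteOrder ρ a)
    (j : Fin d) : FiniteOrder ρ (FourierBF.freqMul j a) := by
  obtain ⟨h, N, M, hk⟩ := ha
  exact ⟨h.freqMul j, N, M + 1, fun k => (hk k).freqMul hρ j h⟩

theorem FiniteOrder.freqMul_add_symDeriv {ρ : ℝ} (hρ : ρ ≤ 1) {a : Rd d × Rd d → ℂ}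
    (ha : FiniteOrder ρ a) (j : Fin d) :
    FiniteOrder ρ (fun z => FourierBF.freqMul j a z + symDeriv (Sum.inl j) a z) := by
  obtain ⟨h, N, M, hk⟩ := ha
  exact ⟨(h.freqMul j).add (h.symDeriv _), N, M + 1, fun k => SymbolBounds.add (h.freqMul j)
    (h.symDeriv _) ((hk k).freqMul hρ j h) (((hk (k + 1)).2.1 j).mono (by linarith))⟩

theorem iteratedFDeriv_symDeriv {a : Rd d × Rd d → ℂ} (ha : ContDiff ℝ ∞ a) (s : Fin d ⊕ Fin d)
    (k : ℕ) (z : Rd d × Rd d) (m : Fin k → Rd d × Rd d) :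
    iteratedFDeriv ℝ k (symDeriv s a) z m =
      iteratedFDeriv ℝ (k + 1) a z (Fin.snoc m (coordDir s)) := by
  have h : ContDiff ℝ ∞ (fderiv ℝ a) := ha.fderiv_right (m := ∞) (by simp)
  rw [iteratedFDeriv_succ_apply_right]
  simp only [Fin.init_snoc, Fin.snoc_last]
  exact iteratedFDeriv_clm_apply_const_apply h (i := k) (mod_cast le_top)

/-- Appending `s` to the list of directions: a frequency direction contributes one more factor
`⟨ξ⟩^{-ρ}`, which is absorbed into the weight. This makes inductions on the number of derivatives
possible within the symbol classes. -/
theorem SymbolClass.symDeriv {ρ : ℝ} {w : Rd d × Rd d → ℝ} {a : Rd d × Rd d → ℂ}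
    (ha : SymbolClass ρ 0 w a) (s : Fin d ⊕ Fin d) :
    SymbolClass ρ 0 (fun z => w z * japaneseBracket z.2 ^ (-ρ * if s.isRight then 1 else 0))
      (FourierBF.symDeriv s a) := by
  refine ⟨(ha.1.fderiv_right (m := ∞) (by simp)).clm_apply contDiff_const, fun k r => ?_⟩
  obtain ⟨C, hC⟩ := ha.2 (k + 1) (Fin.snoc r s : Fin (k + 1) → Fin d ⊕ Fin d)
  refine ⟨C, fun x ξ => ?_⟩
  have h := hC x ξ
  rw [iteratedFDeriv_symDeriv ha.1]
  have e1 : (fun l => coordDir ((Fin.snoc r s : Fin (k + 1) → Fin d ⊕ Fin d) l)) =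
      (Fin.snoc (fun l => coordDir (r l)) (coordDir s) : Fin (k + 1) → Rd d × Rd d) := by
    ext1 l
    refine Fin.lastCases ?_ (fun i => ?_) l
    · simp
    · simp
  rw [e1] at h
  refine h.trans (le_of_eq ?_)
  have hb : 0 < japaneseBracket ξ := zero_lt_one.trans_le (one_le_japaneseBracket ξ)
  rw [mul_assoc C, mul_assoc C, mul_assoc (w (x, ξ)), ← Real.rpow_add hb]
  congr 3
  simp only [Finset.card_filter]
  rw [Fin.sum_univ_castSucc]
  simp only [Fin.snoc_castSucc, Fin.snoc_last]
  push_cast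
  ring

theorem one_add_norm_le_two_mul_japaneseBracket (ξ : Rd d) : 1 + ‖ξ‖ ≤ 2 * japaneseBracket ξ := by
  have h1 := one_le_japaneseBracket ξ
  have h2 : ‖ξ‖ ≤ japaneseBracket ξ := Real.le_sqrt_of_sq_le (by linarith)
  linarith

theorem japaneseBracket_rpow_neg_le (ξ : Rd d) {ρ ρ' : ℝ} (h : ρ' ≤ ρ) (hρ : 0 ≤ ρ) :
    japaneseBracket ξ ^ (-ρ) ≤ 2 ^ ρ * (1 + ‖ξ‖) ^ (-ρ') := by
  have hb : 0 < japaneseBracket ξ := zero_lt_one.trans_le (one_le_japaneseBracket ξ)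
  have h1 : (1 + ‖ξ‖) ^ ρ ≤ 2 ^ ρ * japaneseBracket ξ ^ ρ := by
    rw [← Real.mul_rpow (by norm_num) hb.le]
    exact Real.rpow_le_rpow (by positivity) (one_add_norm_le_two_mul_japaneseBracket ξ) hρ
  have h2 : (1 + ‖ξ‖) ^ ρ' ≤ (1 + ‖ξ‖) ^ ρ :=
    Real.rpow_le_rpow_of_exponent_le (one_le_one_add_norm ξ) h
  rw [Real.rpow_neg hb.le, Real.rpow_neg (by positivity), ← div_eq_mul_inv,
    inv_eq_one_div, div_le_div_iff₀ (by positivity) (by positivity), one_mul]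
  exact h2.trans h1

theorem SymbolClass.symbolBounds {ρ ρ' : ℝ} (hρ : 0 ≤ ρ) (hρ' : ρ' ≤ ρ) {N : ℕ} (k : ℕ) :
    ∀ {M : ℝ} {w : Rd d × Rd d → ℝ} {a : Rd d × Rd d → ℂ}, (∀ z, 0 < w z) →
      (∃ C, ∀ x ξ, w (x, ξ) ≤ C * (1 + ‖x‖) ^ N * (1 + ‖ξ‖) ^ M) → SymbolClass ρ 0 w a →
      SymbolBounds ρ' N k M a := by
  have h0 : ∀ {M : ℝ} {w : Rd d × Rd d → ℝ} {a : Rd d × Rd d → ℂ}, (∀ z, 0 < w z) →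
      (∃ C, ∀ x ξ, w (x, ξ) ≤ C * (1 + ‖x‖) ^ N * (1 + ‖ξ‖) ^ M) → SymbolClass ρ 0 w a →
      SymbolBounds ρ' N 0 M a := by
    rintro M w a hw ⟨C, hC⟩ ha
    obtain ⟨D, hD⟩ := ha.2 0 Fin.elim0
    have hC0 : 0 ≤ C := by
      have := (hw (0, 0)).le.trans (hC 0 0)
      simpa using this
    refine ⟨|D| * C, by positivity, fun x ξ => ?_⟩
    have h := hD x ξ
    simp only [iteratedFDeriv_zero_apply, Finset.univ_eq_empty, Finset.filter_empty,
      Finset.card_empty, CharP.cast_eq_zero, mul_zero, add_zero, Real.rpow_zero, mul_one] at h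
    have := (hw (x, ξ)).le
    calc ‖a (x, ξ)‖ ≤ D * w (x, ξ) := h
      _ ≤ |D| * (C * (1 + ‖x‖) ^ N * (1 + ‖ξ‖) ^ M) := by
          gcongr
          · exact le_abs_self D
          · exact hC x ξ
      _ = _ := by ring
  induction k with
  | zero => exact h0
  | succ k ih =>
    intro M w a hw hC ha
    refine ⟨h0 hw hC ha, fun j => ?_, fun j => ?_⟩
    · refine ih (fun z => ?_) ?_ (ha.symDeriv (Sum.inl j))
      · have hb : 0 < japaneseBracket z.2 := zero_lt_one.trans_le (one_le_japaneseBracket _)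
        have := hw z
        positivity
      · simpa using hC
    · refine ih (fun z => ?_) ?_ (ha.symDeriv (Sum.inr j))
      · have hb : 0 < japaneseBracket z.2 := zero_lt_one.trans_le (one_le_japaneseBracket _)
        have := hw z
        positivity
      · obtain ⟨C, hC⟩ := hC
        have hC0 : 0 ≤ C := by
          have := (hw (0, 0)).le.trans (hC 0 0)
          simpa using this
        refine ⟨C * 2 ^ ρ, fun x ξ => ?_⟩
        simp only [Sum.isRight_inr, if_true, mul_one]
        have h1 := japaneseBracket_rpow_neg_le ξ hρ' hρ
        have := (hw (x, ξ)).le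
        calc w (x, ξ) * japaneseBracket ξ ^ (-ρ)
            ≤ (C * (1 + ‖x‖) ^ N * (1 + ‖ξ‖) ^ M) * (2 ^ ρ * (1 + ‖ξ‖) ^ (-ρ')) := by
              have hb : 0 < japaneseBracket ξ := zero_lt_one.trans_le (one_le_japaneseBracket _)
              gcongr
              exact hC x ξ
          _ = _ := by
              rw [sub_eq_add_neg, Real.rpow_add (one_add_norm_pos ξ)]
              ring

theorem IsPolyModerate.exists_pos {F : Type*} [NormedAddCommGroup F] [MeasurableSpace F]
    {w : F → ℝ} (hw : IsPolyModerate w) :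
    ∃ (C : ℝ) (N : ℕ), 0 < C ∧ ∀ x y, w (x + y) ≤ C * w x * (1 + ‖y‖) ^ N := by
  obtain ⟨C, N, h⟩ := hw.moderate
  refine ⟨C, N, ?_, h⟩
  have h1 := h 0 0
  simp only [add_zero, norm_zero, one_pow, mul_one] at h1
  exact pos_of_mul_pos_left ((hw.pos 0).trans_le h1) (hw.pos 0).le

theorem norm_prod_le (x ξ : Rd d) : 1 + ‖(x, ξ)‖ ≤ (1 + ‖x‖) * (1 + ‖ξ‖) := by
  have h5 : ‖(x, ξ)‖ ≤ ‖x‖ + ‖ξ‖ := by simp [Prod.norm_def]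
  nlinarith [norm_nonneg x, norm_nonneg ξ]

/-- A moderate weight grows at most like `(1 + |x|)^N (1 + |ξ|)^N`, which bounds the order of the
symbol. -/
theorem SymbolClass.finiteOrder {ρ : ℝ} (hρ : 0 ≤ ρ) {w : Rd d × Rd d → ℝ}
    (hw : IsPolyModerate w) {a : Rd d × Rd d → ℂ} (ha : SymbolClass ρ 0 w a) :
    FiniteOrder (min ρ 1) a := by
  refine ⟨ha.hasUniformTemperateGrowth hρ hw, ?_⟩
  obtain ⟨C, N, hC, h⟩ := hw.exists_pos
  refine ⟨N, N, fun k => ha.symbolBounds hρ (min_le_left _ _) k hw.pos ⟨C * w 0, fun x ξ => ?_⟩⟩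
  have h1 := h 0 (x, ξ)
  rw [zero_add] at h1
  have := (hw.pos 0).le
  calc w (x, ξ) ≤ C * w 0 * (1 + ‖(x, ξ)‖) ^ N := h1
    _ ≤ C * w 0 * ((1 + ‖x‖) * (1 + ‖ξ‖)) ^ N := by
        gcongr
        exact norm_prod_le x ξ
    _ = _ := by
        rw [mul_pow, Real.rpow_natCast]
        ring

end order

end FourierBF

end

noncomputable section

namespace FourierBF

open scoped ContDiff

/-! ### Pseudolocality -/

section pseudolocal
variable {d : ℕ}

theorem integrable_one_add_norm_rpow : Integrable fun x : Rd d => (1 + ‖x‖) ^ (-(d + 1 : ℝ)) :=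
  integrable_one_add_norm (by simp)

theorem norm_coord_le (x : Rd d) (j : Fin d) : |x j| ≤ ‖x‖ := PiLp.norm_apply_le x j

theorem norm_le_sum_coord (x : Rd d) : ‖x‖ ≤ ∑ j, |x j| := by
  conv_lhs => rw [← sum_coord_smul_single x]
  refine (norm_sum_le _ _).trans (Finset.sum_le_sum fun j _ => ?_)
  simp [norm_smul]

/-- For order at most `-(d + 1)` the `ξ`-integral converges absolutely, and the sup norm of `ψ`
together with its support in `K` suffices. -/
theorem SymbolBounds.norm_opTranspose_le {ρ M : ℝ} {N : ℕ} {a : Rd d × Rd d → ℂ}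
    (ha : HasUniformTemperateGrowth a) (h : SymbolBounds ρ N 0 M a) (hM : M ≤ -(d + 1 : ℝ))
    {K : Set (Rd d)} (hK : IsCompact K) :
    ∃ C, 0 ≤ C ∧ ∀ (ψ : 𝓢(Rd d, ℂ)) (S : ℝ), 0 ≤ S → (∀ x, x ∉ K → ψ x = 0) → (∀ x, ‖ψ x‖ ≤ S) →
      ∀ y, ‖opTranspose a ha ψ y‖ ≤ C * S := by
  obtain ⟨C, hC, hb⟩ := h
  obtain ⟨R, hR0, hR⟩ := hK.isBounded.exists_pos_norm_le
  set I := ∫ x : Rd d, (1 + ‖x‖) ^ (-(d + 1 : ℝ)) with hI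
  have hI0 : 0 ≤ I := integral_nonneg fun x => by positivity
  have hc := (fourierConst_pos d).le
  refine ⟨fourierConst d * fourierConst d * (C * (1 + R) ^ N * volume.real K * I), by positivity,
    fun ψ S hS h0 hψ y => ?_⟩
  have h1 : ∀ η, ‖HasUniformTemperateGrowth.oscIntegral a ψ η‖ ≤
      C * (1 + R) ^ N * volume.real K * S * (1 + ‖η‖) ^ (-(d + 1 : ℝ)) := by
    intro η
    rw [oscIntegral_eq_phase, ← setIntegral_eq_integral_of_forall_compl_eq_zero (s := K)
      (fun x hx => by rw [h0 x hx, mul_zero, zero_mul])]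
    refine (norm_setIntegral_le_of_norm_le_const hK.measure_lt_top (C := S * (C * (1 + R) ^ N *
      (1 + ‖η‖) ^ (-(d + 1 : ℝ)))) fun x hx => ?_).trans (le_of_eq (by ring))
    rw [norm_mul, norm_mul, norm_phase, one_mul]
    refine mul_le_mul (hψ x) ((hb x η).trans ?_) (norm_nonneg _) hS
    gcongr
    · exact hR x hx
    · exact one_le_one_add_norm η
  rw [opTranspose_apply, angularFourier_eq_phase, norm_mul, norm_mul, Complex.norm_real,
    Real.norm_of_nonneg hc, ← mul_assoc, mul_assoc (_ * _) _ S]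
  refine mul_le_mul_of_nonneg_left ?_ (by positivity)
  refine (norm_integral_le_of_norm_le (integrable_one_add_norm_rpow.const_mul
    (C * (1 + R) ^ N * volume.real K * S)) (Filter.Eventually.of_forall fun η => ?_)).trans
    (le_of_eq ?_)
  · rw [norm_mul, norm_phase, one_mul]
    exact h1 η
  · rw [integral_const_mul]
    ring

/-- `ψ(x) (x_j - y_j) / |x - y|²` as a Schwartz function, for `ψ` vanishing near `y`. -/
theorem exists_schwartz_div_norm_sq {K : Set (Rd d)} (hK : IsCompact K) {ψ : 𝓢(Rd d, ℂ)}
    (h0 : ∀ x, x ∉ K → ψ x = 0) {y : Rd d} (hy : y ∉ K) (j : Fin d) :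
    ∃ Ψ : 𝓢(Rd d, ℂ), ∀ x, Ψ x = ψ x * (((x j - y j) / ‖x - y‖ ^ 2 : ℝ) : ℂ) := by
  have hc : HasCompactSupport fun x => ψ x * (((x j - y j) / ‖x - y‖ ^ 2 : ℝ) : ℂ) :=
    HasCompactSupport.intro hK fun x hx => by rw [h0 x hx, zero_mul]
  have hs : ContDiff ℝ ∞ fun x => ψ x * (((x j - y j) / ‖x - y‖ ^ 2 : ℝ) : ℂ) := by
    rw [contDiff_iff_contDiffAt]
    intro x
    by_cases hx : x = y
    · subst hx
      have : (fun z => ψ z * (((z j - x j) / ‖z - x‖ ^ 2 : ℝ) : ℂ)) =ᶠ[𝓝 x] fun _ => 0 := by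
        filter_upwards [hK.isClosed.isOpen_compl.mem_nhds hy] with z hz
        rw [h0 z hz, zero_mul]
      exact contDiffAt_const.congr_of_eventuallyEq this
    · have hne : ‖x - y‖ ^ 2 ≠ 0 := by
        simpa [sub_eq_zero] using hx
      have h1 : ContDiffAt ℝ ∞ (fun x : Rd d => (x j - y j) / ‖x - y‖ ^ 2) x := by
        refine ContDiffAt.div ?_ ?_ hne
        · exact ((EuclideanSpace.proj (𝕜 := ℝ) j).contDiff.sub contDiff_const).contDiffAt
        · exact ((contDiff_id.sub contDiff_const).norm_sq ℝ).contDiffAt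
      exact ((ψ.smooth ⊤).contDiffAt).mul (Complex.ofRealCLM.contDiff.contDiffAt.comp x h1)
  exact ⟨hc.toSchwartzMap hs, fun x => rfl⟩

theorem hasTemperateGrowth_coord (j : Fin d) :
    (fun x : Rd d => ((x j : ℝ) : ℂ)).HasTemperateGrowth :=
  (Complex.ofRealCLM.comp (EuclideanSpace.proj (𝕜 := ℝ) j)).hasTemperateGrowth

/-- Away from `y` one has `ψ = ∑_j (x_j - y_j) Ψ_j` with `Ψ_j = ψ (x_j - y_j)/|x - y|²`. By
`opTranspose_coord_mul` the factor `x_j - y_j` becomes a frequency derivative of the symbol. Each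
round gains `r⁻¹` and lowers the order by `ρ`, until the absolutely convergent case is reached. -/
theorem SymbolBounds.norm_opTranspose_le_far {ρ : ℝ} {N : ℕ} {K : Set (Rd d)} (hK : IsCompact K)
    (n : ℕ) : ∀ {M : ℝ} {a : Rd d × Rd d → ℂ} (ha : HasUniformTemperateGrowth a),
    SymbolBounds ρ N n M a → M - n * ρ ≤ -(d + 1 : ℝ) →
    ∃ C, 0 ≤ C ∧ ∀ (ψ : 𝓢(Rd d, ℂ)) (S : ℝ), 0 ≤ S → (∀ x, x ∉ K → ψ x = 0) → (∀ x, ‖ψ x‖ ≤ S) →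
      ∀ (y : Rd d) (r : ℝ), 0 < r → (∀ x ∈ K, r ≤ ‖x - y‖) →
        ‖opTranspose a ha ψ y‖ ≤ C * S * r⁻¹ ^ n := by
  induction n with
  | zero =>
    intro M a ha h hM
    obtain ⟨C, hC, hb⟩ := h.norm_opTranspose_le ha (by simpa using hM) hK
    exact ⟨C, hC, fun ψ S hS h0 hψ y r hr hy => by simpa using hb ψ S hS h0 hψ y⟩
  | succ n ih =>
    rintro M a ha ⟨-, -, h⟩ hM
    have hM' : M - ρ - n * ρ ≤ -(d + 1 : ℝ) := by
      push_cast at hM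
      linarith
    choose C hC hb using fun j => ih (ha.symDeriv (Sum.inr j)) (h j) hM'
    refine ⟨∑ j, C j, Finset.sum_nonneg fun j _ => hC j, fun ψ S hS h0 hψ y r hr hy => ?_⟩
    have hyK : y ∉ K := fun hyK => by
      have := hy y hyK
      rw [sub_self, norm_zero] at this
      linarith
    choose Ψ hΨ using exists_schwartz_div_norm_sq hK h0 hyK
    have hΨ0 : ∀ j x, x ∉ K → Ψ j x = 0 := fun j x hx => by rw [hΨ, h0 x hx, zero_mul]
    have hΨS : ∀ j x, ‖Ψ j x‖ ≤ S * r⁻¹ := by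
      intro j x
      by_cases hx : x ∈ K
      · have h2 := hy x hx
        have h3 : 0 < ‖x - y‖ := hr.trans_le h2
        rw [hΨ, norm_mul, Complex.norm_real, norm_div, norm_pow, norm_norm, sq]
        refine mul_le_mul (hψ x) ?_ (by positivity) hS
        have h4 : ‖x j - y j‖ ≤ ‖x - y‖ := norm_coord_le (x - y) j
        calc ‖x j - y j‖ / (‖x - y‖ * ‖x - y‖) ≤ ‖x - y‖ / (‖x - y‖ * ‖x - y‖) := by gcongr
          _ = ‖x - y‖⁻¹ := by field_simp
          _ ≤ r⁻¹ := by gcongr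
      · rw [hΨ0 j x hx, norm_zero]
        positivity
    set Ψ' : Fin d → 𝓢(Rd d, ℂ) := fun j =>
      SchwartzMap.smulLeftCLM ℂ (fun x : Rd d => ((x j : ℝ) : ℂ)) (Ψ j) with hΨ'
    have hΨ'a : ∀ j x, Ψ' j x = (x j : ℂ) * Ψ j x := fun j x => by
      rw [hΨ', SchwartzMap.smulLeftCLM_apply_apply (hasTemperateGrowth_coord j), smul_eq_mul]
    have e : ψ = ∑ j, (Ψ' j - (y j : ℂ) • Ψ j) := by
      ext x
      rw [_root_.sum_apply]
      simp only [_root_.sub_apply, _root_.smul_apply, hΨ'a, hΨ, smul_eq_mul]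
      by_cases hx : x ∈ K
      · have h3 : 0 < ‖x - y‖ := hr.trans_le (hy x hx)
        have h4 : ∀ j, (x j : ℂ) * (ψ x * (((x j - y j) / ‖x - y‖ ^ 2 : ℝ) : ℂ)) -
            (y j : ℂ) * (ψ x * (((x j - y j) / ‖x - y‖ ^ 2 : ℝ) : ℂ)) =
            ψ x * (((‖x - y‖ ^ 2)⁻¹ * (x j - y j) ^ 2 : ℝ) : ℂ) := by
          intro j
          push_cast
          ring
        simp only [h4]
        rw [← Finset.mul_sum, ← Complex.ofReal_sum, ← Finset.mul_sum]
        have h5 : ∑ j, (x j - y j) ^ 2 = ‖x - y‖ ^ 2 := by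
          rw [EuclideanSpace.norm_sq_eq]
          refine Finset.sum_congr rfl fun j _ => ?_
          rw [Real.norm_eq_abs, sq_abs]
          rfl
        rw [h5, inv_mul_cancel₀ (by positivity)]
        simp
      · simp [h0 x hx]
    have e2 : opTranspose a ha ψ y = ∑ j, Complex.I * opTranspose _ (ha.symDeriv (Sum.inr j)) (Ψ j) y := by
      conv_lhs => rw [e]
      rw [map_sum, _root_.sum_apply]
      refine Finset.sum_congr rfl fun j _ => ?_
      rw [map_sub, map_smul, _root_.sub_apply, _root_.smul_apply,
        opTranspose_coord_mul ha j (Ψ j) (Ψ' j) (hΨ'a j), smul_eq_mul]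
      ring
    rw [e2, Finset.sum_mul, Finset.sum_mul]
    refine (norm_sum_le _ _).trans (Finset.sum_le_sum fun j _ => ?_)
    rw [norm_mul, Complex.norm_I, one_mul]
    refine (hb j (Ψ j) (S * r⁻¹) (by positivity) (hΨ0 j) (hΨS j) y r hr hy).trans (le_of_eq ?_)
    rw [pow_succ]
    ring

/-- Where the contribution of `1 - χ` and its derivatives need not vanish, the distance to `K` is
comparable to `1 + |y|`. A gain in inverse distance is then also decay in `y`. -/
theorem exists_far_of_eventually_eq_one {K : Set (Rd d)} (hK : IsCompact K) {χ : Rd d → ℂ}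
    (hχ : ∀ᶠ x in 𝓝ˢ K, χ x = 1) :
    ∃ δ, 0 < δ ∧ ∀ y, (∀ᶠ z in 𝓝 y, χ z = 1) ∨ ∀ x ∈ K, δ * (1 + ‖y‖) ≤ ‖x - y‖ := by
  have hU : IsOpen {y | ∀ᶠ z in 𝓝 y, χ z = 1} := isOpen_setOfPred_eventually_nhds
  obtain ⟨ε, hε, h⟩ := hK.exists_thickening_subset_open hU (by
    rwa [eventually_nhdsSet_iff_forall] at hχ)
  obtain ⟨R, hR0, hR⟩ := hK.isBounded.exists_pos_norm_le
  -- From `ε ≤ |x - y|` and `|y| ≤ R + |x - y|`: the second bound on `δ` makes `δ(1 + R) ≤ ε/2`, the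
  -- first makes `δ|x - y| ≤ |x - y|/2`.
  refine ⟨min (1 / 2) (ε / (2 * (1 + R))), by positivity, fun y => ?_⟩
  by_cases hy : y ∈ {y | ∀ᶠ z in 𝓝 y, χ z = 1}
  · exact Or.inl hy
  refine Or.inr fun x hx => ?_
  have h1 : ε ≤ ‖x - y‖ := by
    by_contra! hlt
    refine hy (h (Metric.mem_thickening_iff.2 ⟨x, hx, ?_⟩))
    rwa [dist_comm, dist_eq_norm]
  have h2 : ‖y‖ ≤ R + ‖x - y‖ := by
    have := norm_sub_le x (x - y)
    rw [sub_sub_cancel] at this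
    linarith [hR x hx]
  set δ := min (1 / 2) (ε / (2 * (1 + R))) with hδ
  have h3 : δ ≤ 1 / 2 := min_le_left _ _
  have h4 : δ * (1 + R) ≤ ε / 2 := by
    have : δ ≤ ε / (2 * (1 + R)) := min_le_right _ _
    rw [le_div_iff₀ (by positivity)] at this
    linarith
  have h0 : 0 < δ := by positivity
  calc δ * (1 + ‖y‖) ≤ δ * (1 + R) + δ * ‖x - y‖ := by nlinarith
    _ ≤ ‖x - y‖ := by nlinarith [norm_nonneg (x - y)]

theorem TestFamily.schwartzDeriv {P : Type*} {K : Set (Rd d)} (hK : IsCompact K)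
    {H : P → 𝓢(Rd d, ℂ)} (hH : TestFamily K H) (j : Fin d) :
    TestFamily K (fun p => FourierBF.schwartzDeriv j (H p)) := by
  refine ⟨hH.unif.partialDeriv j, fun p x hx => ?_⟩
  have h1 : (H p : Rd d → ℂ) =ᶠ[𝓝 x] fun _ => 0 := by
    filter_upwards [hK.isClosed.isOpen_compl.mem_nhds hx] with z hz
    exact hH.supp p z hz
  rw [schwartzDeriv_coe, partialDeriv, h1.fderiv_eq]
  simp

theorem schwartzDeriv_modulate (j : Fin d) (ξ : Rd d) (φ : 𝓢(Rd d, ℂ)) :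
    schwartzDeriv j (modulate ξ φ) =
      (-(Complex.I * (ξ j : ℂ))) • modulate ξ φ + modulate ξ (schwartzDeriv j φ) := by
  ext x
  have e : ⇑(modulate ξ φ) = fun x => phase (-ξ) x * φ x := funext fun x => modulate_apply ξ φ x
  rw [schwartzDeriv_coe, e, partialDeriv_mul ((contDiff_phase _).differentiable (by simp) x)
    φ.differentiableAt, partialDeriv_phase]
  simp only [_root_.add_apply, _root_.smul_apply, modulate_apply, smul_eq_mul,
    schwartzDeriv_coe, PiLp.neg_apply]
  push_cast
  ring

/-- Induction on the power of `1 + |ξ|`. A factor `iξ_j` on `e^{-i⟨x,ξ⟩} H` is removed through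
`-∂_j(e^{-i⟨x,ξ⟩} H) + e^{-i⟨x,ξ⟩} ∂_j H`, at the price of a derivative of `H` or a symbol of higher
order. Neither matters, since the base case holds for every finite order and every test family;
hence the quantification over `a` and `H` inside the induction. -/
theorem FiniteOrder.opTranspose_modulate_decay {ρ : ℝ} (hρ : 0 < ρ) (hρ1 : ρ ≤ 1) {P : Type*}
    {K : Set (Rd d)} (hK : IsCompact K) {δ : ℝ} (hδ : 0 < δ) (L N : ℕ) :
    ∀ {a : Rd d × Rd d → ℂ} (ha : FiniteOrder ρ a) {H : P → 𝓢(Rd d, ℂ)}, TestFamily K H →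
      ∃ C, 0 ≤ C ∧ ∀ p ξ y, (∀ x ∈ K, δ * (1 + ‖y‖) ≤ ‖x - y‖) →
        (1 + ‖ξ‖) ^ N * ‖opTranspose a ha.growth (modulate ξ (H p)) y‖ ≤ C * ((1 + ‖y‖) ^ L)⁻¹ := by
  induction N with
  | zero =>
    intro a ha H hH
    obtain ⟨N, M, hM⟩ := ha.bounds
    obtain ⟨n₀, hn₀⟩ := exists_nat_ge ((M + (d + 1 : ℝ)) / ρ)
    -- The part `n₀` brings the order below `-(d + 1)`, the part `L` supplies the decay in `y`.
    set n := max n₀ L with hn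
    have h1 : M - n * ρ ≤ -(d + 1 : ℝ) := by
      have h2 : (n₀ : ℝ) ≤ n := by exact_mod_cast le_max_left n₀ L
      have := (div_le_iff₀ hρ).1 (hn₀.trans h2)
      linarith
    obtain ⟨C, hC, hb⟩ := (hM n).norm_opTranspose_le_far hK n ha.growth h1
    obtain ⟨S, hS, hSb⟩ := hH.unif.exists_bound 0
    simp only [norm_iteratedFDeriv_zero] at hSb
    refine ⟨C * S * δ⁻¹ ^ n, by positivity, fun p ξ y hy => ?_⟩
    rw [pow_zero, one_mul]
    have hy0 := one_add_norm_pos y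
    refine (hb (modulate ξ (H p)) S hS (fun x hx => ?_) (fun x => ?_) y (δ * (1 + ‖y‖))
      (by positivity) hy).trans ?_
    · rw [modulate_apply, hH.supp p x hx, mul_zero]
    · rw [modulate_apply, norm_mul, norm_phase, one_mul]
      exact hSb p x
    · rw [mul_inv, mul_pow, ← mul_assoc, inv_pow (1 + ‖y‖)]
      gcongr
      · exact one_le_one_add_norm y
      · exact le_max_right _ _
  | succ N ih =>
    intro a ha H hH
    obtain ⟨C, hC, hb⟩ := ih ha hH
    choose D hD hDb using fun j => ih ha (hH.schwartzDeriv hK j)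
    choose F hF hFb using fun j => ih (ha.freqMul_add_symDeriv hρ1 j) hH
    refine ⟨C + ∑ j, (D j + F j), add_nonneg hC (Finset.sum_nonneg fun j _ =>
      add_nonneg (hD j) (hF j)), fun p ξ y hy => ?_⟩
    have key : ∀ j, (1 + ‖ξ‖) ^ N * (|ξ j| * ‖opTranspose a ha.growth (modulate ξ (H p)) y‖) ≤
        (D j + F j) * ((1 + ‖y‖) ^ L)⁻¹ := by
      intro j
      have h1 := opTranspose_schwartzDeriv ha.growth j (modulate ξ (H p)) y
      rw [schwartzDeriv_modulate, map_add, map_smul, _root_.add_apply, _root_.smul_apply,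
        smul_eq_mul] at h1
      have h2 : Complex.I * (ξ j : ℂ) * opTranspose a ha.growth (modulate ξ (H p)) y =
          opTranspose a ha.growth (modulate ξ (FourierBF.schwartzDeriv j (H p))) y +
          opTranspose _ ((ha.growth.freqMul j).add (ha.growth.symDeriv (Sum.inl j)))
            (modulate ξ (H p)) y := by
        linear_combination -h1
      have h3 : |ξ j| * ‖opTranspose a ha.growth (modulate ξ (H p)) y‖ ≤
          ‖opTranspose a ha.growth (modulate ξ (FourierBF.schwartzDeriv j (H p))) y‖ +
          ‖opTranspose _ ((ha.growth.freqMul j).add (ha.growth.symDeriv (Sum.inl j)))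
            (modulate ξ (H p)) y‖ := by
        have := (congrArg norm h2).trans_le (norm_add_le _ _)
        rwa [norm_mul, norm_mul, Complex.norm_I, one_mul, Complex.norm_real,
          Real.norm_eq_abs] at this
      have h4 := hDb j p ξ y hy
      have h5 := hFb j p ξ y hy
      calc _ ≤ (1 + ‖ξ‖) ^ N * (_ + _) := mul_le_mul_of_nonneg_left h3 (by positivity)
        _ ≤ _ := by
          rw [mul_add, add_mul]
          exact add_le_add h4 h5
    have h6 := hb p ξ y hy
    have h7 := norm_le_sum_coord ξ
    calc (1 + ‖ξ‖) ^ (N + 1) * ‖opTranspose a ha.growth (modulate ξ (H p)) y‖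
        ≤ (1 + ‖ξ‖) ^ N * ((1 + ∑ j, |ξ j|) * ‖opTranspose a ha.growth (modulate ξ (H p)) y‖) := by
          rw [pow_succ, mul_assoc]
          gcongr
      _ = (1 + ‖ξ‖) ^ N * ‖opTranspose a ha.growth (modulate ξ (H p)) y‖ +
          ∑ j, (1 + ‖ξ‖) ^ N * (|ξ j| * ‖opTranspose a ha.growth (modulate ξ (H p)) y‖) := by
          rw [← Finset.mul_sum, ← Finset.sum_mul]
          ring
      _ ≤ C * ((1 + ‖y‖) ^ L)⁻¹ + ∑ j, (D j + F j) * ((1 + ‖y‖) ^ L)⁻¹ :=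
          add_le_add h6 (Finset.sum_le_sum fun j _ => key j)
      _ = _ := by rw [← Finset.sum_mul, add_mul]

/-- Derivatives in `y` only replace the symbol by `iξ_j a`, which again has finite order. -/
theorem FiniteOrder.iteratedFDeriv_opTranspose_modulate_decay {ρ : ℝ} (hρ : 0 < ρ) (hρ1 : ρ ≤ 1)
    {P : Type*} {K : Set (Rd d)} (hK : IsCompact K) {δ : ℝ} (hδ : 0 < δ) (L N : ℕ)
    {H : P → 𝓢(Rd d, ℂ)} (hH : TestFamily K H) (n : ℕ) :
    ∀ {a : Rd d × Rd d → ℂ} (ha : FiniteOrder ρ a),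
      ∃ C, 0 ≤ C ∧ ∀ p ξ y, (∀ x ∈ K, δ * (1 + ‖y‖) ≤ ‖x - y‖) →
        (1 + ‖ξ‖) ^ N * ‖iteratedFDeriv ℝ n (opTranspose a ha.growth (modulate ξ (H p))) y‖ ≤
          C * ((1 + ‖y‖) ^ L)⁻¹ := by
  induction n with
  | zero =>
    intro a ha
    simp only [norm_iteratedFDeriv_zero]
    exact ha.opTranspose_modulate_decay hρ hρ1 hK hδ L N hH
  | succ n ih =>
    intro a ha
    choose C hC hb using fun j => ih (ha.freqMul hρ1 j)
    refine ⟨∑ j, C j, Finset.sum_nonneg fun j _ => hC j, fun p ξ y hy => ?_⟩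
    refine (mul_le_mul_of_nonneg_left (norm_iteratedFDeriv_succ_le_sum
      ((opTranspose a ha.growth (modulate ξ (H p))).smooth ⊤) n y) (by positivity)).trans ?_
    rw [Finset.mul_sum, Finset.sum_mul]
    refine Finset.sum_le_sum fun j _ => ?_
    have e : partialDeriv j (opTranspose a ha.growth (modulate ξ (H p))) =
        ⇑(-opTranspose _ (ha.growth.freqMul j) (modulate ξ (H p))) := by
      ext z
      exact schwartzDeriv_opTranspose ha.growth j _ z
    have e2 : ‖iteratedFDeriv ℝ n (⇑(-opTranspose _ (ha.growth.freqMul j) (modulate ξ (H p)))) y‖ =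
        ‖iteratedFDeriv ℝ n (opTranspose _ (ha.growth.freqMul j) (modulate ξ (H p))) y‖ := by
      have : iteratedFDeriv ℝ n (⇑(-opTranspose _ (ha.growth.freqMul j) (modulate ξ (H p)))) y =
          -iteratedFDeriv ℝ n (opTranspose _ (ha.growth.freqMul j) (modulate ξ (H p))) y :=
        iteratedFDeriv_neg_apply
      rw [this, norm_neg]
    rw [e, e2]
    exact hb j p ξ y hy

/-- Pseudolocality. By transposition the difference is `f` applied to `(1 - χ) Op(a)ᵗ(e^{-i⟨x,ξ⟩}
H)`. Only finitely many seminorms of this function count, and all of them decay rapidly in `ξ`. -/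
theorem FiniteOrder.op_sub_op_cutoff_decay {ρ : ℝ} (hρ : 0 < ρ) (hρ1 : ρ ≤ 1) {P : Type*}
    {K : Set (Rd d)} (hK : IsCompact K) {a : Rd d × Rd d → ℂ} (ha : FiniteOrder ρ a)
    {H : P → 𝓢(Rd d, ℂ)} (hH : TestFamily K H) (f : 𝓢'(Rd d, ℂ)) {χ : 𝓢(Rd d, ℂ)}
    (hχc : HasCompactSupport χ) (hχ : ∀ᶠ x in 𝓝ˢ K, χ x = 1) (N : ℕ) :
    ∃ C, 0 ≤ C ∧ ∀ p ξ, (1 + ‖ξ‖) ^ N * ‖op a ha.growth f (modulate ξ (H p)) -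
      op a ha.growth (TemperedDistribution.smulLeftCLM ℂ χ f) (modulate ξ (H p))‖ ≤ C := by
  obtain ⟨m, C₀, hC₀, hf⟩ := exists_distOrderLE f
  obtain ⟨δ, hδ, hfar⟩ := exists_far_of_eventually_eq_one hK hχ
  choose C hC hb using fun n =>
    FiniteOrder.iteratedFDeriv_opTranspose_modulate_decay hρ hρ1 hK hδ m N hH n ha
  have hg : UnifSmooth (fun (_ : Unit) x => 1 + -χ x) :=
    (UnifSmooth.const 1).add (UnifSmooth.of_hasCompactSupport (χ.smooth ⊤) hχc).neg
  choose D hD hDb using hg.exists_bound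
  have hCD : ∀ n, 0 ≤ ∑ i ∈ Finset.range (n + 1), (n.choose i : ℝ) * D i * C (n - i) := fun n =>
    Finset.sum_nonneg fun i _ => by
      have := hD i
      have := hC (n - i)
      positivity
  refine ⟨C₀ * ∑ n ∈ Finset.range (m + 1), ∑ i ∈ Finset.range (n + 1),
    (n.choose i : ℝ) * D i * C (n - i), mul_nonneg hC₀ (Finset.sum_nonneg fun n _ => hCD n),
    fun p ξ => ?_⟩
  set T := opTranspose a ha.growth (modulate ξ (H p)) with hT
  have e1 : op a ha.growth f (modulate ξ (H p)) -
      op a ha.growth (TemperedDistribution.smulLeftCLM ℂ χ f) (modulate ξ (H p)) =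
      f (T - SchwartzMap.smulLeftCLM ℂ χ T) := by
    rw [map_sub]
    rfl
  have e2 : ⇑(T - SchwartzMap.smulLeftCLM ℂ χ T) = fun x => (1 + -χ x) * T x := by
    ext x
    rw [_root_.sub_apply, SchwartzMap.smulLeftCLM_apply_apply χ.hasTemperateGrowth, smul_eq_mul]
    ring
  have hξ : 0 < (1 + ‖ξ‖) ^ N := pow_pos (one_add_norm_pos ξ) N
  have h1 := hf (T - SchwartzMap.smulLeftCLM ℂ χ T) (((1 + ‖ξ‖) ^ N)⁻¹ *
    ∑ n ∈ Finset.range (m + 1), ∑ i ∈ Finset.range (n + 1), (n.choose i : ℝ) * D i * C (n - i))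
    (mul_nonneg (by positivity) (Finset.sum_nonneg fun n _ => hCD n)) (fun n hn y => by
    rw [e2]
    -- Either `1 - χ` vanishes near `y`, together with all derivatives, or `y` is far from `K` and
    -- the decay estimates enter through the Leibniz formula.
    rcases hfar y with hy | hy
    · have h2 : (fun x => (1 + -χ x) * T x) =ᶠ[𝓝 y] fun _ => 0 := by
        filter_upwards [hy] with z hz
        rw [hz]
        ring
      rw [(Filter.EventuallyEq.iteratedFDeriv ℝ h2 n).eq_of_nhds]
      have : iteratedFDeriv ℝ n (fun _ : Rd d => (0 : ℂ)) y = 0 := by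
        rw [iteratedFDeriv_fun_zero]
        rfl
      rw [this, norm_zero, mul_zero]
      exact mul_nonneg (by positivity) (Finset.sum_nonneg fun n _ => hCD n)
    · rw [← div_eq_inv_mul, le_div_iff₀ hξ]
      have h3 := norm_iteratedFDeriv_mul_le (𝕜 := ℝ) (hg.smooth ()) (T.smooth ⊤) y (n := n)
        (mod_cast le_top)
      have hy0 : 0 < (1 + ‖y‖) ^ m := pow_pos (one_add_norm_pos y) m
      calc (1 + ‖y‖) ^ m * ‖iteratedFDeriv ℝ n (fun x => (1 + -χ x) * T x) y‖ * (1 + ‖ξ‖) ^ N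
          ≤ (1 + ‖y‖) ^ m * (∑ i ∈ Finset.range (n + 1), (n.choose i : ℝ) *
            ‖iteratedFDeriv ℝ i (fun x => 1 + -χ x) y‖ * ‖iteratedFDeriv ℝ (n - i) T y‖) *
              (1 + ‖ξ‖) ^ N := by gcongr
        _ = ∑ i ∈ Finset.range (n + 1), (1 + ‖y‖) ^ m * ((n.choose i : ℝ) *
            ‖iteratedFDeriv ℝ i (fun x => 1 + -χ x) y‖ *
              ((1 + ‖ξ‖) ^ N * ‖iteratedFDeriv ℝ (n - i) T y‖)) := by
            rw [Finset.mul_sum, Finset.sum_mul]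
            refine Finset.sum_congr rfl fun i _ => ?_
            ring
        _ ≤ ∑ i ∈ Finset.range (n + 1), (1 + ‖y‖) ^ m * ((n.choose i : ℝ) * D i *
              (C (n - i) * ((1 + ‖y‖) ^ m)⁻¹)) := by
            refine Finset.sum_le_sum fun i _ => ?_
            have h4 := hDb i () y
            have h5 := hb (n - i) p ξ y hy
            have := hD i
            gcongr
        _ = ∑ i ∈ Finset.range (n + 1), (n.choose i : ℝ) * D i * C (n - i) := by
            refine Finset.sum_congr rfl fun i _ => ?_
            field_simp
        _ ≤ _ := Finset.single_le_sum
            (f := fun n => ∑ i ∈ Finset.range (n + 1), (n.choose i : ℝ) * D i * C (n - i))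
            (fun n _ => hCD n) (Finset.mem_range.2 (by omega)))
  rw [e1]
  calc _ ≤ (1 + ‖ξ‖) ^ N * (C₀ * (((1 + ‖ξ‖) ^ N)⁻¹ * _)) := by gcongr
    _ = _ := by field_simp

end pseudolocal

end FourierBF

end

noncomputable section

namespace FourierBF

/-! ### Domination by elements of a BF-space -/

section lattice
variable {d : ℕ}

/-- The points of the lattice `ε ℤ^d`. -/
def latticePoint (ε : ℝ) (k : Fin d → ℤ) : Rd d := WithLp.toLp 2 fun i => ε * k i

theorem latticePoint_apply (ε : ℝ) (k : Fin d → ℤ) (i : Fin d) :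
    latticePoint ε k i = ε * k i := rfl

theorem exists_latticePoint_sub_le {ε : ℝ} (hε : 0 < ε) (x : Rd d) :
    ∃ k : Fin d → ℤ, ‖latticePoint ε k - x‖ ≤ d * ε := by
  refine ⟨fun i => round (x i / ε), (norm_le_sum_coord _).trans ?_⟩
  have : ∀ i ∈ Finset.univ, |(latticePoint ε (fun i => round (x i / ε)) - x) i| ≤ ε := by
    intro i _
    have h1 : (latticePoint ε (fun i => round (x i / ε)) - x) i =
        -(ε * (x i / ε - round (x i / ε))) := by
      rw [PiLp.sub_apply, latticePoint_apply]
      field_simp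
      ring
    rw [h1, abs_neg, abs_mul, abs_of_pos hε]
    have := abs_sub_round (x i / ε)
    nlinarith
  refine (Finset.sum_le_sum this).trans ?_
  simp

theorem summable_inv_one_add_sq {ε : ℝ} (hε : 0 < ε) :
    Summable fun k : ℤ => ((1 + |ε * k|) ^ 2)⁻¹ := by
  have h1 : Summable fun k : ℤ => ε⁻¹ ^ 2 * (1 / (k : ℝ) ^ 2) :=
    (Real.summable_one_div_int_pow.2 one_lt_two).mul_left _
  refine h1.of_norm_bounded_eventually ?_
  have h2 : ∀ᶠ k : ℤ in Filter.cofinite, k ≠ 0 := by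
    rw [Filter.eventually_cofinite]
    simp
  filter_upwards [h2] with k hk
  have hk' : (0 : ℝ) < |(k : ℝ)| := by simpa using hk
  rw [Real.norm_of_nonneg (by positivity), abs_mul, abs_of_pos hε, inv_pow, one_div, ← mul_inv,
    ← mul_pow, ← sq_abs (ε * k), abs_mul, abs_of_pos hε]
  gcongr
  linarith

/-- Comparison with a product of one-dimensional series: `(1 + |q|)^{2d} ≥ ∏_i (1 + |q_i|)²`. -/
theorem summable_latticePoint {ε : ℝ} (hε : 0 < ε) :
    Summable fun k : Fin d → ℤ => ((1 + ‖latticePoint ε k‖) ^ (2 * d))⁻¹ := by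
  set f : ℤ → ℝ := fun k => ((1 + |ε * k|) ^ 2)⁻¹ with hf
  have hf0 : ∀ k, 0 ≤ f k := fun k => by positivity
  have hfs : Summable f := summable_inv_one_add_sq hε
  have h1 : Summable fun k : Fin d → ℤ => ∏ i, f (k i) := by
    refine summable_of_sum_le (c := ∏ _i : Fin d, ∑' k, f k)
      (fun k => Finset.prod_nonneg fun i _ => hf0 _) fun s => ?_
    have h2 : s ⊆ Fintype.piFinset fun i => s.image fun k => k i := fun k hk =>
      Fintype.mem_piFinset.2 fun i => Finset.mem_image_of_mem _ hk
    refine (Finset.sum_le_sum_of_subset_of_nonneg h2 fun k _ _ =>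
      Finset.prod_nonneg fun i _ => hf0 _).trans ?_
    rw [← Finset.prod_univ_sum]
    exact Finset.prod_le_prod (fun i _ => Finset.sum_nonneg fun k _ => hf0 k)
      fun i _ => hfs.sum_le_tsum _ fun k _ => hf0 k
  refine h1.of_nonneg_of_le (fun k => by positivity) fun k => ?_
  rw [hf, Finset.prod_inv_distrib, pow_mul]
  refine inv_anti₀ (Finset.prod_pos fun i _ => by positivity) ?_
  calc ∏ i, (1 + |ε * k i|) ^ 2 ≤ ∏ _i : Fin d, (1 + ‖latticePoint ε k‖) ^ 2 := by
        gcongr with i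
        exact norm_coord_le (latticePoint ε k) i
    _ = _ := by simp

end lattice

/-! ### Domination in a solid, translation invariant space -/

section domination

set_option linter.unusedSectionVars false
variable {d : ℕ} {B : Type*} [NormedAddCommGroup B] [NormedSpace ℂ B] [CompleteSpace B]
  {v : Rd d → ℝ} {ι : B →ₗ[ℂ] (Rd d →ₘ[(volume : Measure (Rd d))] ℂ)}

/-- `F` is bounded almost everywhere by the modulus of an element of `B`. -/
def IsDominated (ι : B →ₗ[ℂ] (Rd d →ₘ[(volume : Measure (Rd d))] ℂ)) (F : Rd d → ℝ) : Prop :=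
  ∃ h : B, ∀ᵐ x, F x ≤ ‖ι h x‖

theorem IsDominated.mono {F G : Rd d → ℝ} (hG : IsDominated ι G) (h : ∀ x, F x ≤ G x) :
    IsDominated ι F := by
  obtain ⟨b, hb⟩ := hG
  exact ⟨b, hb.mono fun x hx => (h x).trans hx⟩

theorem IsDominated.const_mul {F : Rd d → ℝ} (hF : IsDominated ι F) {c : ℝ} (hc : 0 ≤ c) :
    IsDominated ι (fun x => c * F x) := by
  obtain ⟨b, hb⟩ := hF
  refine ⟨(c : ℂ) • b, ?_⟩
  rw [map_smul]
  filter_upwards [hb, AEEqFun.coeFn_smul (c : ℂ) (ι b)] with x hx h1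
  rw [h1, Pi.smul_apply, norm_smul, Complex.norm_real, Real.norm_of_nonneg hc]
  gcongr

theorem IsRepresentedBy.locallyIntegrable {u : 𝓢'(Rd d, ℂ)} {g : Rd d → ℂ}
    (hg : IsRepresentedBy u g) : LocallyIntegrable g volume := by
  intro x
  obtain ⟨θ, h1, -⟩ := exists_cutoff (isCompact_closedBall x 1) (isCompact_closedBall x 2)
    (Metric.closedBall_subset_ball (by norm_num) |>.trans Metric.ball_subset_interior_closedBall)
  refine ⟨Metric.closedBall x 1, Metric.closedBall_mem_nhds x one_pos, ?_⟩
  refine ((hg θ).1.integrableOn (s := Metric.closedBall x 1)).congr_fun (fun z hz => ?_)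
    measurableSet_closedBall
  change g z * θ z = g z
  rw [h1.self_of_nhdsSet z hz, mul_one]

namespace IsTranslationInvariantBFSpace

theorem locallyIntegrable (hB : IsTranslationInvariantBFSpace v ι) (h : B) :
    LocallyIntegrable (ι h) volume := by
  obtain ⟨k, hk⟩ := hB.tempered_embedding
  exact (hk h).locallyIntegrable

/-- Local integrability of `f` comes for free from the domination, since elements of `B` represent
tempered distributions. -/
theorem exists_solid (hB : IsTranslationInvariantBFSpace v ι) :
    ∃ C, 0 ≤ C ∧ ∀ (f : Rd d → ℂ) (g : B), AEStronglyMeasurable f volume →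
      (∀ᵐ x, ‖f x‖ ≤ ‖ι g x‖) → ∃ h : B, ι h =ᵐ[volume] f ∧ ‖h‖ ≤ C * ‖g‖ := by
  obtain ⟨C, hC⟩ := hB.solid
  refine ⟨|C|, abs_nonneg C, fun f g hf hfg => ?_⟩
  obtain ⟨h, h1, h2⟩ := hC f g ((hB.locallyIntegrable g).mono hf hfg) hfg
  exact ⟨h, h1, h2.trans (by gcongr; exact le_abs_self C)⟩

/-- The elements of `B` that are nonnegative functions. -/
def Nonneg (ι : B →ₗ[ℂ] (Rd d →ₘ[(volume : Measure (Rd d))] ℂ)) (h : B) : Prop :=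
  ∀ᵐ x, ι h x = (‖ι h x‖ : ℂ)

theorem nonneg_zero : Nonneg ι 0 := by
  rw [Nonneg, map_zero]
  filter_upwards [AEEqFun.coeFn_zero (α := Rd d) (β := ℂ) (μ := volume)] with x hx
  rw [hx]
  simp

theorem Nonneg.add {g h : B} (hg : Nonneg ι g) (hh : Nonneg ι h) :
    Nonneg ι (g + h) ∧ ∀ᵐ x, ‖ι (g + h) x‖ = ‖ι g x‖ + ‖ι h x‖ := by
  have key : ∀ᵐ x, ι (g + h) x = ((‖ι g x‖ + ‖ι h x‖ : ℝ) : ℂ) := by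
    rw [map_add]
    filter_upwards [AEEqFun.coeFn_add (ι g) (ι h), hg, hh] with x h1 h2 h3
    rw [h1, Pi.add_apply, h2, h3]
    simp
  have h4 : ∀ᵐ x, ‖ι (g + h) x‖ = ‖ι g x‖ + ‖ι h x‖ := by
    filter_upwards [key] with x hx
    rw [hx, Complex.norm_real, Real.norm_of_nonneg (by positivity)]
  refine ⟨?_, h4⟩
  filter_upwards [key, h4] with x h1 h2
  rw [h2, h1]

theorem Nonneg.sum {κ : Type*} {h : κ → B} (hh : ∀ k, Nonneg ι (h k)) (s : Finset κ) :
    Nonneg ι (∑ k ∈ s, h k) := by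
  classical
  induction s using Finset.induction_on with
  | empty => simpa using nonneg_zero
  | insert k s hk ih =>
    rw [Finset.sum_insert hk]
    exact ((hh k).add ih).1

theorem exists_abs (hB : IsTranslationInvariantBFSpace v ι) :
    ∃ C, 0 ≤ C ∧ ∀ g : B, ∃ h : B, Nonneg ι h ∧ (∀ᵐ x, ‖ι h x‖ = ‖ι g x‖) ∧ ‖h‖ ≤ C * ‖g‖ := by
  obtain ⟨C, hC, hs⟩ := hB.exists_solid
  refine ⟨C, hC, fun g => ?_⟩
  obtain ⟨h, h1, h2⟩ := hs (fun x => (‖ι g x‖ : ℂ)) g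
    (Complex.continuous_ofReal.comp_aestronglyMeasurable (ι g).aestronglyMeasurable.norm)
    (Filter.Eventually.of_forall fun x => by simp)
  have h3 : ∀ᵐ x, ‖ι h x‖ = ‖ι g x‖ := by
    filter_upwards [h1] with x hx
    rw [hx]
    simp
  refine ⟨h, ?_, h3, h2⟩
  filter_upwards [h1, h3] with x hx hx'
  rw [hx', hx]

/-- For nonnegative `T_k` one has `|T_k - |S|| ≤ |T_k - S|` pointwise. Solidity gives `T_k → |S|` in
`B`, and uniqueness of limits gives `S = |S|`. No almost everywhere convergence is involved. -/
theorem nonneg_of_tendsto (hB : IsTranslationInvariantBFSpace v ι) {κ : Type*} {l : Filter κ}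
    [l.NeBot] {T : κ → B} {S : B} (hT : Filter.Tendsto T l (𝓝 S)) (h : ∀ᶠ k in l, Nonneg ι (T k)) :
    Nonneg ι S := by
  obtain ⟨C, hC, hs⟩ := hB.exists_solid
  obtain ⟨_, -, ha⟩ := hB.exists_abs
  obtain ⟨S', hS', hSS', -⟩ := ha S
  have h1 : ∀ᶠ k in l, ‖T k - S'‖ ≤ C * ‖T k - S‖ := by
    filter_upwards [h] with k hk
    obtain ⟨g, hg, hgn⟩ := hs (ι (T k - S')) (T k - S) (ι (T k - S')).aestronglyMeasurable (by
      rw [map_sub, map_sub]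
      filter_upwards [AEEqFun.coeFn_sub (ι (T k)) (ι S), AEEqFun.coeFn_sub (ι (T k)) (ι S'), hk,
        hS', hSS'] with x h1 h2 h3 h4 h5
      rw [h1, h2, Pi.sub_apply, Pi.sub_apply, h4, h5]
      have : ‖ι (T k) x - (‖ι S x‖ : ℂ)‖ = |‖ι (T k) x‖ - ‖ι S x‖| := by
        rw [h3, ← Complex.ofReal_sub, Complex.norm_real, Complex.norm_real, Real.norm_eq_abs]
        simp
      rw [this]
      exact abs_norm_sub_norm_le _ _)
    rw [← hB.injective (AEEqFun.ext hg)]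
    exact hgn
  have h2 : Filter.Tendsto T l (𝓝 S') := by
    rw [tendsto_iff_norm_sub_tendsto_zero] at hT ⊢
    refine squeeze_zero' (Filter.Eventually.of_forall fun k => norm_nonneg _) h1 ?_
    simpa using hT.const_mul C
  rwa [tendsto_nhds_unique hT h2]

/-- `S` is the norm-convergent sum of the absolute values. Its difference with any single term is a
limit of finite sums of nonnegative functions, hence nonnegative. -/
theorem exists_dominating_of_summable (hB : IsTranslationInvariantBFSpace v ι) {κ : Type*}
    {h : κ → B} (hh : Summable fun k => ‖h k‖) : ∃ S : B, ∀ k, ∀ᵐ x, ‖ι (h k) x‖ ≤ ‖ι S x‖ := by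
  classical
  obtain ⟨C, hC, ha⟩ := hB.exists_abs
  choose g hg hgh hgn using fun k => ha (h k)
  have hgs : Summable g := (hh.mul_left C).of_norm_bounded hgn
  refine ⟨∑' k, g k, fun k => ?_⟩
  have h1 : Nonneg ι (∑' k, g k - g k) := by
    refine hB.nonneg_of_tendsto (hgs.hasSum.sub_const (g k)) ?_
    filter_upwards [Filter.eventually_ge_atTop {k}] with s hs
    rw [← Finset.add_sum_erase s g (hs (Finset.mem_singleton_self k)), add_sub_cancel_left]
    exact Nonneg.sum hg _
  have h2 := ((hg k).add h1).2
  rw [add_sub_cancel] at h2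
  filter_upwards [h2, hgh k] with x h3 h4
  rw [h3, ← h4]
  linarith [norm_nonneg (ι (∑' k, g k - g k) x)]

end IsTranslationInvariantBFSpace

theorem IsDominated.add (hB : IsTranslationInvariantBFSpace v ι) {F G : Rd d → ℝ}
    (hF : IsDominated ι F) (hG : IsDominated ι G) : IsDominated ι (fun x => F x + G x) := by
  obtain ⟨f, hf⟩ := hF
  obtain ⟨g, hg⟩ := hG
  obtain ⟨_, -, ha⟩ := hB.exists_abs
  obtain ⟨f', h1, h2, -⟩ := ha f
  obtain ⟨g', h3, h4, -⟩ := ha g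
  refine ⟨f' + g', ?_⟩
  filter_upwards [(h1.add h3).2, h2, h4, hf, hg] with x e1 e2 e3 e4 e5
  rw [e1, e2, e3]
  exact add_le_add e4 e5

/-- Replaces the inequality for convolutions in `B`: a translate by `t_k` costs at most a constant
times `v(t_k)`, so the weighted translates are summable in norm and have a common majorant.
Countability of `κ` allows all the almost everywhere bounds to hold at once. -/
theorem IsDominated.of_translates (hB : IsTranslationInvariantBFSpace v ι) {κ : Type*} [Countable κ]
    {G : Rd d → ℝ} (hG : IsDominated ι G) {c : κ → ℝ} (hc : ∀ k, 0 ≤ c k) {t : κ → Rd d}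
    (hs : Summable fun k => c k * v (t k)) {F : Rd d → ℝ}
    (hF : ∀ x, ∃ k, F x ≤ c k * G (x - t k)) : IsDominated ι F := by
  obtain ⟨g, hg⟩ := hG
  obtain ⟨C, hC⟩ := hB.translation
  choose h hh hn using fun k => hC g (t k)
  obtain ⟨S, hS⟩ := hB.exists_dominating_of_summable (h := fun k => (c k : ℂ) • h k) (by
    refine (hs.mul_left (|C| * ‖g‖)).of_nonneg_of_le (fun k => norm_nonneg _) fun k => ?_
    rw [norm_smul, Complex.norm_real, Real.norm_of_nonneg (hc k)]
    have hv := (hB.weight.polyModerate.pos (t k)).le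
    have := hc k
    calc c k * ‖h k‖ ≤ c k * (|C| * v (t k) * ‖g‖) := by
          gcongr
          refine (hn k).trans ?_
          gcongr
          exact le_abs_self C
      _ = _ := by ring)
  refine ⟨S, ?_⟩
  have h1 : ∀ k, ∀ᵐ x, G (x - t k) ≤ ‖ι g (x - t k)‖ := fun k =>
    (measurePreserving_sub_right volume (t k)).quasiMeasurePreserving.ae hg
  have h2 : ∀ k, ∀ᵐ x, c k * G (x - t k) ≤ ‖ι S x‖ := by
    intro k
    filter_upwards [h1 k, hh k, hS k, AEEqFun.coeFn_smul (c k : ℂ) (ι (h k))] with x e1 e2 e3 e4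
    rw [map_smul, e4, Pi.smul_apply, norm_smul, e2, Complex.norm_real,
      Real.norm_of_nonneg (hc k)] at e3
    have := hc k
    exact (by gcongr : c k * G (x - t k) ≤ _).trans e3
  filter_upwards [ae_all_iff.2 h2] with x hx
  obtain ⟨k, hk⟩ := hF x
  exact hk.trans (hx k)

theorem IsPolyModerate.le_mul_pow {w : Rd d → ℝ} (hw : IsPolyModerate w) :
    ∃ (C : ℝ) (N : ℕ), 0 < C ∧ ∀ x, w x ≤ C * (1 + ‖x‖) ^ N := by
  obtain ⟨C, N, hC, h⟩ := hw.exists_pos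
  exact ⟨C * w 0, N, mul_pos hC (hw.pos 0), fun x => by simpa using h 0 x⟩

/-- Rapidly decreasing error terms are harmless. A Schwartz cutoff lies in `B`, and its translates
along the integer lattice, with polynomially decreasing coefficients, cover the whole space. -/
theorem IsTranslationInvariantBFSpace.exists_isDominated_decay
    (hB : IsTranslationInvariantBFSpace v ι) :
    ∃ L : ℕ, IsDominated ι (fun x => ((1 + ‖x‖) ^ L)⁻¹) := by
  obtain ⟨C, N, hC, hv⟩ := hB.weight.polyModerate.le_mul_pow
  obtain ⟨θ, h1, -⟩ := exists_cutoff (isCompact_closedBall (0 : Rd d) d)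
    (isCompact_closedBall (0 : Rd d) (d + 1))
    (Metric.closedBall_subset_ball (by norm_num) |>.trans Metric.ball_subset_interior_closedBall)
  have hθ : IsDominated ι (fun x => ‖θ x‖) := by
    obtain ⟨j, hj⟩ := hB.schwartz_embedding
    refine ⟨j θ, ?_⟩
    filter_upwards [hj θ] with x hx
    rw [hx]
  -- `N` compensates the growth of `v` and `2d` makes the lattice sum converge. Each `x` lies within
  -- `d` of the lattice, where the cutoff is `1`; this gives the factor `(1 + d)^{2d+N}`.
  refine ⟨2 * d + N, hθ.of_translates hB (κ := Fin d → ℤ)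
    (c := fun k => (1 + d) ^ (2 * d + N) * ((1 + ‖latticePoint 1 k‖) ^ (2 * d + N))⁻¹)
    (fun k => by positivity) (t := fun k => latticePoint 1 k) ?_ fun x => ?_⟩
  · refine ((summable_latticePoint one_pos).mul_left ((1 + d : ℝ) ^ (2 * d + N) * C)).of_nonneg_of_le
      (fun k => ?_) fun k => ?_
    · have := (hB.weight.polyModerate.pos (latticePoint 1 k)).le
      positivity
    · calc _ ≤ (1 + d : ℝ) ^ (2 * d + N) * ((1 + ‖latticePoint 1 k‖) ^ (2 * d + N))⁻¹ *
            (C * (1 + ‖latticePoint 1 k‖) ^ N) := by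
            gcongr
            exact hv _
        _ = _ := by
          have := one_add_norm_pos (latticePoint 1 k)
          rw [pow_add (1 + ‖latticePoint 1 k‖)]
          field_simp
  · obtain ⟨k, hk⟩ := exists_latticePoint_sub_le one_pos x
    rw [mul_one] at hk
    refine ⟨k, ?_⟩
    rw [h1.self_of_nhdsSet (x - latticePoint 1 k) (by
      rw [mem_closedBall_zero_iff, norm_sub_rev]
      exact hk), norm_one, mul_one, ← div_eq_mul_inv, inv_eq_one_div,
      div_le_div_iff₀ (pow_pos (one_add_norm_pos x) _) (pow_pos (one_add_norm_pos _) _), one_mul,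
      ← mul_pow]
    refine pow_le_pow_left₀ (one_add_norm_pos _).le ((one_add_norm_le_sub _ x).trans ?_) _
    gcongr

theorem IsDominated.exists_eq (hB : IsTranslationInvariantBFSpace v ι) {F : Rd d → ℝ}
    (hF : IsDominated ι F) {f : Rd d → ℂ} (hf : AEStronglyMeasurable f volume)
    (h : ∀ x, ‖f x‖ ≤ F x) : ∃ g : B, ι g =ᵐ[volume] f := by
  obtain ⟨b, hb⟩ := hF
  obtain ⟨_, -, hs⟩ := hB.exists_solid
  obtain ⟨g, hg, -⟩ := hs f b hf (hb.mono fun x hx => (h x).trans hx)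
  exact ⟨g, hg⟩

end domination

end FourierBF

end

noncomputable section

namespace FourierBF

/-! ### The Peetre maximal function -/

section peetre
variable {d : ℕ}

/-- The Peetre maximal function `sup_η |g(η)| (1 + |ξ - η|)^{-N}`. -/
def peetre (N : ℕ) (g : Rd d → ℂ) (ξ : Rd d) : ℝ := ⨆ η, ‖g η‖ * ((1 + ‖ξ - η‖) ^ N)⁻¹

theorem peetre_nonneg (N : ℕ) (g : Rd d → ℂ) (ξ : Rd d) : 0 ≤ peetre N g ξ :=
  Real.iSup_nonneg fun η => by positivity

theorem peetre_term_le {g : Rd d → ℂ} {m N : ℕ} (hmN : m ≤ N) {C : ℝ} (hC : 0 ≤ C)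
    (hg : ∀ η, ‖g η‖ ≤ C * (1 + ‖η‖) ^ m) (ξ η : Rd d) :
    ‖g η‖ * ((1 + ‖ξ - η‖) ^ N)⁻¹ ≤ C * (1 + ‖ξ‖) ^ m := by
  rw [← div_eq_mul_inv, div_le_iff₀ (pow_pos (one_add_norm_pos _) N)]
  calc ‖g η‖ ≤ C * ((1 + ‖ξ - η‖) * (1 + ‖ξ‖)) ^ m := by
        refine (hg η).trans ?_
        gcongr
        exact one_add_norm_le_sub' η ξ
    _ = C * (1 + ‖ξ‖) ^ m * (1 + ‖ξ - η‖) ^ m := by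
        rw [mul_pow]
        ring
    _ ≤ _ := by
        gcongr
        exact one_le_one_add_norm _

/-- A real supremum over an unbounded family is `0` by convention, so the growth bound with `m ≤ N`
is what makes the maximal function meaningful. -/
theorem le_peetre {g : Rd d → ℂ} {m N : ℕ} (hmN : m ≤ N) {C : ℝ} (hC : 0 ≤ C)
    (hg : ∀ η, ‖g η‖ ≤ C * (1 + ‖η‖) ^ m) (ξ η : Rd d) :
    ‖g η‖ ≤ peetre N g ξ * (1 + ‖ξ - η‖) ^ N := by
  rw [← div_le_iff₀ (pow_pos (one_add_norm_pos _) N), div_eq_mul_inv]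
  exact le_ciSup (f := fun η => ‖g η‖ * ((1 + ‖ξ - η‖) ^ N)⁻¹)
    ⟨_, Set.forall_mem_range.2 fun η => peetre_term_le hmN hC hg ξ η⟩ η

/-- Mean value inequality on the unit ball around `z`; moving the decay of the derivative to the
centre costs `2 ^ L`. -/
theorem exists_lipschitz_decay (κ : 𝓢(Rd d, ℂ)) (L : ℕ) : ∃ C, 0 ≤ C ∧ ∀ z u : Rd d, ‖u‖ ≤ 1 →
    ‖κ (z + u) - κ z‖ ≤ C * ‖u‖ * ((1 + ‖z‖) ^ L)⁻¹ := by
  set D : ℝ := 2 ^ L * ((Finset.Iic (L, 1)).sup (schwartzSeminormFamily ℝ (Rd d) ℂ) κ) with hD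
  have hD0 : 0 ≤ D := mul_nonneg (by positivity) (apply_nonneg _ _)
  have h1 : ∀ y, ‖fderiv ℝ κ y‖ ≤ D * ((1 + ‖y‖) ^ L)⁻¹ := fun y => by
    have := SchwartzMap.one_add_le_sup_seminorm_apply (𝕜 := ℝ) (m := (L, 1)) (k := L) (n := 1)
      le_rfl le_rfl κ y
    rw [norm_iteratedFDeriv_one] at this
    rw [← div_eq_mul_inv, le_div_iff₀ (pow_pos (one_add_norm_pos _) L), mul_comm]
    exact this
  refine ⟨D * 2 ^ L, by positivity, fun z u hu => ?_⟩
  have h2 := (convex_closedBall z 1).norm_image_sub_le_of_norm_fderiv_le (𝕜 := ℝ) (f := κ)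
    (C := D * (((1 + ‖z‖) ^ L)⁻¹ * 2 ^ L)) (x := z) (y := z + u)
    (fun y _ => κ.differentiableAt) (fun y hy => ?_) (by simp) (by simpa using hu)
  · rw [add_sub_cancel_left] at h2
    refine h2.trans (le_of_eq (by ring))
  · refine (h1 y).trans ?_
    gcongr
    have h3 := inv_one_add_norm_sub_le z (z - y) L
    rw [sub_sub_cancel] at h3
    refine h3.trans ?_
    have h4 : ‖z - y‖ ≤ 1 := by
      rw [← dist_eq_norm, dist_comm]
      exact hy
    gcongr
    linarith

theorem exists_reproducing_kernel {φ : 𝓢(Rd d, ℂ)} (hφ : HasCompactSupport φ) (f : 𝓢'(Rd d, ℂ)) :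
    ∃ κ : 𝓢(Rd d, ℂ), ∀ ξ, (Integrable fun η => localFourier φ f η * κ (η - ξ)) ∧
      localFourier φ f ξ = fourierConst d * ∫ η, localFourier φ f η * κ (η - ξ) := by
  obtain ⟨θ, -, hθ⟩ := exists_cutoff_of_hasCompactSupport hφ
  have hs := (localFourier_spec hφ f).2
  refine ⟨angularFourierInv θ, fun ξ => ⟨?_, localFourier_eq_integral hθ f (fun ψ => (hs ψ).2) ξ⟩⟩
  have h := (hs (angularFourierInv (modulate ξ θ))).1
  simpa only [angularFourierInv_modulate] using h

/-- Subtract the reproducing formulas at `η + u` and `η`: the difference of the kernels has size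
`|u|`, and `g` is bounded by its maximal function at `ξ`. The kernel decays with `N` powers for the
growth in `ζ` and `d + 1` more for integrability. -/
theorem exists_oscillation_le {φ : 𝓢(Rd d, ℂ)} (hφ : HasCompactSupport φ) (f : 𝓢'(Rd d, ℂ))
    {m N : ℕ} (hmN : m ≤ N) {C₀ : ℝ} (hC₀ : 0 ≤ C₀)
    (hg : ∀ η, ‖localFourier φ f η‖ ≤ C₀ * (1 + ‖η‖) ^ m) :
    ∃ C, 0 ≤ C ∧ ∀ ξ η u : Rd d, ‖u‖ ≤ 1 → ‖localFourier φ f (η + u) - localFourier φ f η‖ ≤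
      C * ‖u‖ * (peetre N (localFourier φ f) ξ * (1 + ‖ξ - η‖) ^ N) := by
  obtain ⟨κ, hκ⟩ := exists_reproducing_kernel hφ f
  obtain ⟨C, hC, hlip⟩ := exists_lipschitz_decay κ (N + (d + 1))
  set g := localFourier φ f with hgdef
  have hc := (fourierConst_pos d).le
  set I := ∫ x : Rd d, (1 + ‖x‖) ^ (-(d + 1 : ℝ)) with hI
  have hI0 : 0 ≤ I := integral_nonneg fun x => by positivity
  refine ⟨fourierConst d * (C * I), by positivity, fun ξ η u hu => ?_⟩
  set A := peetre N g ξ with hA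
  have hA0 : 0 ≤ A := peetre_nonneg N g ξ
  have e : g (η + u) - g η =
      fourierConst d * ∫ ζ, g ζ * (κ (ζ - η + -u) - κ (ζ - η)) := by
    rw [(hκ (η + u)).2, (hκ η).2, ← mul_sub, ← integral_sub (hκ _).1 (hκ _).1]
    congr 2
    ext ζ
    rw [show ζ - (η + u) = ζ - η + -u by abel]
    ring
  rw [e, norm_mul, Complex.norm_real, Real.norm_of_nonneg hc, mul_assoc, mul_assoc]
  gcongr
  have h1 : ∀ ζ, ‖g ζ * (κ (ζ - η + -u) - κ (ζ - η))‖ ≤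
      C * ‖u‖ * (A * (1 + ‖ξ - η‖) ^ N) * (1 + ‖ζ - η‖) ^ (-(d + 1 : ℝ)) := by
    intro ζ
    rw [norm_mul]
    have h2 := hlip (ζ - η) (-u) (by rwa [norm_neg])
    rw [norm_neg] at h2
    have h3 : ‖g ζ‖ ≤ A * ((1 + ‖ξ - η‖) * (1 + ‖ζ - η‖)) ^ N := by
      refine (le_peetre hmN hC₀ hg ξ ζ).trans ?_
      gcongr
      have := one_add_norm_add_le (ξ - η) (η - ζ)
      rwa [sub_add_sub_cancel, norm_sub_rev η ζ] at this
    have hp := one_add_norm_pos (ζ - η)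
    have e2 : (1 + ‖ζ - η‖) ^ (-(d + 1 : ℝ)) = ((1 + ‖ζ - η‖) ^ (d + 1))⁻¹ := by
      rw [Real.rpow_neg hp.le, ← Real.rpow_natCast]
      push_cast
      rfl
    calc ‖g ζ‖ * ‖κ (ζ - η + -u) - κ (ζ - η)‖
        ≤ (A * ((1 + ‖ξ - η‖) * (1 + ‖ζ - η‖)) ^ N) *
          (C * ‖u‖ * ((1 + ‖ζ - η‖) ^ (N + (d + 1)))⁻¹) := by gcongr
      _ = _ := by
        rw [e2, mul_pow, pow_add]
        field_simp
  have hint : Integrable fun ζ : Rd d => (1 + ‖ζ - η‖) ^ (-(d + 1 : ℝ)) :=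
    integrable_one_add_norm_rpow.comp_sub_right η
  refine (norm_integral_le_of_norm_le (hint.const_mul _)
    (Filter.Eventually.of_forall h1)).trans (le_of_eq ?_)
  rw [integral_const_mul, integral_sub_right_eq_self (fun x : Rd d => (1 + ‖x‖) ^ (-(d + 1 : ℝ)))]
  ring

/-- The supremum is nearly attained at some `η`; on a fine enough lattice the nearest point `ξ + q`
has a comparable value of `|g|`, because the oscillation is small relative to the maximal function
itself. The mesh does not depend on `ξ`. -/
theorem exists_peetre_le_latticePoint {φ : 𝓢(Rd d, ℂ)} (hφ : HasCompactSupport φ)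
    (f : 𝓢'(Rd d, ℂ)) {m N : ℕ} (hmN : m ≤ N) {C₀ : ℝ} (hC₀ : 0 ≤ C₀)
    (hg : ∀ η, ‖localFourier φ f η‖ ≤ C₀ * (1 + ‖η‖) ^ m) :
    ∃ ε > 0, ∃ C, 0 ≤ C ∧ ∀ ξ, ∃ k : Fin d → ℤ, peetre N (localFourier φ f) ξ ≤
      C * ((1 + ‖latticePoint ε k‖) ^ N)⁻¹ * ‖localFourier φ f (ξ + latticePoint ε k)‖ := by
  obtain ⟨C, hC, hosc⟩ := exists_oscillation_le hφ f hmN hC₀ hg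
  set g := localFourier φ f with hgdef
  -- A displacement up to `u₀` changes `g` by at most a quarter of the maximal function times its
  -- weight. The mesh is `u₀ / (d + 1)` because rounding moves a point by at most `d` times the
  -- mesh.
  set u₀ := min 1 (1 / (4 * (C + 1))) with hu₀
  have hu₀p : 0 < u₀ := by positivity
  refine ⟨u₀ / (d + 1), by positivity, 2 * 2 ^ N, by positivity, fun ξ => ?_⟩
  set A := peetre N g ξ with hA
  have hA0 : 0 ≤ A := peetre_nonneg N g ξ
  rcases hA0.eq_or_lt with hA0 | hA0
  · refine ⟨0, ?_⟩
    rw [← hA0]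
    positivity
  -- Three quarters at `η`, minus the quarter lost by moving to the lattice, leaves one half.
  obtain ⟨η, hη⟩ := exists_lt_of_lt_ciSup (show 3 / 4 * A < ⨆ η, ‖g η‖ * ((1 + ‖ξ - η‖) ^ N)⁻¹ by
    change 3 / 4 * A < A
    linarith)
  rw [← div_eq_mul_inv, lt_div_iff₀ (pow_pos (one_add_norm_pos _) N)] at hη
  obtain ⟨k, hk⟩ := exists_latticePoint_sub_le (ε := u₀ / (d + 1)) (by positivity) (η - ξ)
  refine ⟨k, ?_⟩
  set q := latticePoint (u₀ / (d + 1)) k with hq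
  set u := q - (η - ξ) with hu
  have hule : ‖u‖ ≤ u₀ := by
    refine hk.trans ?_
    rw [mul_div_assoc', div_le_iff₀ (by positivity)]
    nlinarith
  have hu1 : ‖u‖ ≤ 1 := hule.trans (min_le_left _ _)
  have hCu : C * ‖u‖ ≤ 1 / 4 := by
    have h1 : ‖u‖ ≤ 1 / (4 * (C + 1)) := hule.trans (min_le_right _ _)
    rw [le_div_iff₀ (by positivity)] at h1
    nlinarith [norm_nonneg u]
  have e1 : ξ + q = η + u := by
    rw [hu]
    abel
  have h2 := hosc ξ η u hu1
  have hP : 0 < A * (1 + ‖ξ - η‖) ^ N := mul_pos hA0 (pow_pos (one_add_norm_pos _) N)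
  have h3 : 1 / 2 * (A * (1 + ‖ξ - η‖) ^ N) ≤ ‖g (ξ + q)‖ := by
    rw [e1]
    have h4 : ‖g η‖ ≤ ‖g (η + u)‖ + ‖g (η + u) - g η‖ := by
      have := norm_sub_le (g (η + u)) (g (η + u) - g η)
      rwa [sub_sub_cancel] at this
    have h5 : C * ‖u‖ * (A * (1 + ‖ξ - η‖) ^ N) ≤ 1 / 4 * (A * (1 + ‖ξ - η‖) ^ N) := by gcongr
    linarith
  have h6 : (1 + ‖q‖) ^ N ≤ 2 ^ N * (1 + ‖ξ - η‖) ^ N := by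
    rw [← mul_pow]
    gcongr
    have : q = u - (ξ - η) := by
      rw [hu]
      abel
    have h7 := norm_sub_le u (ξ - η)
    rw [← this] at h7
    nlinarith [norm_nonneg (ξ - η)]
  have hqp : 0 < (1 + ‖q‖) ^ N := pow_pos (one_add_norm_pos _) N
  rw [mul_assoc, ← div_eq_inv_mul, mul_div_assoc', le_div_iff₀ hqp]
  calc A * (1 + ‖q‖) ^ N ≤ A * (2 ^ N * (1 + ‖ξ - η‖) ^ N) := by gcongr
    _ = 2 * 2 ^ N * (1 / 2 * (A * (1 + ‖ξ - η‖) ^ N)) := by ring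
    _ ≤ _ := by gcongr

/-- `Γ'` is a conic subset of `Γ` at positive angular distance from the complement of `Γ`. -/
def IsConicSubset (Γ' Γ : Set (Rd d)) : Prop :=
  Γ' ⊆ Γ ∧ ∃ C, 0 ≤ C ∧ ∀ ξ ∈ Γ', ∀ η, η ∉ Γ → ‖ξ‖ ≤ C * ‖ξ - η‖

/-- The cone over the ball of radius `r / 2` about `ξ₀`, where the ball of radius `r` lies in `Γ`.
After rescaling `ξ` into the small ball, a point outside `Γ` stays at distance at least `r / 2` from
it. -/
theorem IsOpenCone.exists_isConicSubset {Γ : Set (Rd d)} (hΓ : IsOpenCone Γ) {ξ₀ : Rd d}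
    (hξ₀ : ξ₀ ∈ Γ) : ∃ Γ', IsOpenCone Γ' ∧ ξ₀ ∈ Γ' ∧ IsConicSubset Γ' Γ := by
  obtain ⟨r, hr, hball⟩ := Metric.isOpen_iff.1 hΓ.isOpen ξ₀ hξ₀
  have hr0 : r ≤ ‖ξ₀‖ := by
    by_contra! h
    refine hΓ.zero_notMem (hball ?_)
    rwa [Metric.mem_ball, dist_eq_norm, zero_sub, norm_neg]
  refine ⟨{ξ | ∃ t : ℝ, 0 < t ∧ ‖t • ξ - ξ₀‖ < r / 2}, ⟨?_, ?_, ?_⟩, ⟨1, one_pos, ?_⟩, ?_,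
    (‖ξ₀‖ + r / 2) / (r / 2), by positivity, ?_⟩
  · have : {ξ : Rd d | ∃ t : ℝ, 0 < t ∧ ‖t • ξ - ξ₀‖ < r / 2} =
        ⋃ (t : ℝ) (_ : 0 < t), {ξ | ‖t • ξ - ξ₀‖ < r / 2} := by
      ext ξ
      simp
    rw [this]
    exact isOpen_iUnion fun t => isOpen_iUnion fun _ => isOpen_lt (by fun_prop) continuous_const
  · rintro ⟨t, -, ht⟩
    rw [smul_zero, zero_sub, norm_neg] at ht
    linarith
  · rintro ξ ⟨t, ht, h⟩ s hs
    refine ⟨t / s, by positivity, ?_⟩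
    rwa [smul_smul, div_mul_cancel₀ _ hs.ne']
  · simpa using hr
  · rintro ξ ⟨t, ht, h⟩
    have h1 : t • ξ ∈ Γ := hball (by
      rw [Metric.mem_ball, dist_eq_norm]
      linarith)
    have := hΓ.smul_mem _ h1 t⁻¹ (by positivity)
    rwa [smul_smul, inv_mul_cancel₀ ht.ne', one_smul] at this
  · rintro ξ ⟨t, ht, h⟩ η hη
    have h1 : r ≤ ‖t • η - ξ₀‖ := by
      by_contra! hlt
      have h2 : t • η ∈ Γ := hball (by rwa [Metric.mem_ball, dist_eq_norm])
      have := hΓ.smul_mem _ h2 t⁻¹ (by positivity)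
      rw [smul_smul, inv_mul_cancel₀ ht.ne', one_smul] at this
      exact hη this
    have h3 : r / 2 ≤ t * ‖ξ - η‖ := by
      have h4 := norm_sub_le (t • ξ - ξ₀) (t • (ξ - η))
      rw [smul_sub, show t • ξ - ξ₀ - (t • ξ - t • η) = t • η - ξ₀ by abel, ← smul_sub,
        norm_smul t (ξ - η), Real.norm_of_nonneg ht.le] at h4
      linarith
    have h5 : t * ‖ξ‖ ≤ ‖ξ₀‖ + r / 2 := by
      have h6 := norm_add_le (t • ξ - ξ₀) ξ₀
      rw [sub_add_cancel, norm_smul, Real.norm_of_nonneg ht.le] at h6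
      linarith
    rw [div_mul_eq_mul_div, le_div_iff₀ (by positivity)]
    have h7 : t * (‖ξ‖ * (r / 2)) ≤ t * ((‖ξ₀‖ + r / 2) * ‖ξ - η‖) := by
      calc t * (‖ξ‖ * (r / 2)) = (t * ‖ξ‖) * (r / 2) := by ring
        _ ≤ (‖ξ₀‖ + r / 2) * (t * ‖ξ - η‖) := by gcongr
        _ = _ := by ring
    exact le_of_mul_le_mul_left h7 ht

end peetre

/-! ### Domination of the Peetre maximal function, and regular directions -/

section domination

set_option linter.unusedSectionVars false
variable {d : ℕ} {B : Type*} [NormedAddCommGroup B] [NormedSpace ℂ B] [CompleteSpace B]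
  {v : Rd d → ℝ} {ι : B →ₗ[ℂ] (Rd d →ₘ[(volume : Measure (Rd d))] ℂ)}

/-- By the lattice bound, the maximal function at `ξ` is at most a multiple of `(1 + |q|)^{-N} |g(ξ
+ q)|`. For `ξ + q ∈ Γ` this is a translate of the given dominated function, up to moving the
weight. Otherwise `q` is at least as large as `ξ`, up to a constant, and the term decays as fast as
desired. -/
theorem IsDominated.peetre (hB : IsTranslationInvariantBFSpace v ι) {φ : 𝓢(Rd d, ℂ)}
    (hφ : HasCompactSupport φ) (f : 𝓢'(Rd d, ℂ)) {w : Rd d → ℝ} (hw : IsPolyModerate w)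
    {Γ Γ' : Set (Rd d)} (hΓ : IsConicSubset Γ' Γ)
    (h : IsDominated ι (Γ.indicator fun ξ => ‖localFourier φ f ξ‖ * w ξ)) :
    ∃ N₀, ∀ N ≥ N₀,
      IsDominated ι (Γ'.indicator fun ξ => FourierBF.peetre N (localFourier φ f) ξ * w ξ) := by
  obtain ⟨m, hm⟩ := exists_distOrderLE f
  obtain ⟨C₀, hC₀, hg⟩ := hm.localFourier_le φ
  obtain ⟨L, hL⟩ := hB.exists_isDominated_decay
  obtain ⟨Cv, Nv, hCv, hv⟩ := hB.weight.polyModerate.le_mul_pow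
  obtain ⟨Cw, Nw, hCw, hmod⟩ := hw.exists_pos
  obtain ⟨-, Cγ, hCγ, hγ⟩ := hΓ
  set Cγ' := 1 + Cγ with hCγ'
  -- Two demands: `N - Nw ≥ 2d + Nv` for summability of the translates, and `N - m ≥ m + Nw + L` for
  -- the part outside `Γ`.
  refine ⟨2 * d + Nw + Nv + 2 * m + L, fun N hN => ?_⟩
  obtain ⟨ε, hε, C, hC, hk⟩ := exists_peetre_le_latticePoint hφ f (show m ≤ N by omega) hC₀ hg
  set g := localFourier φ f with hgdef
  have hw0 := (hw.pos 0).le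
  set I := Γ.indicator fun ξ => ‖g ξ‖ * w ξ with hI
  set D := C * C₀ * (Cw * w 0) * Cγ' ^ (N - m) with hD
  have hG : IsDominated ι fun ξ => I ξ + D * ((1 + ‖ξ‖) ^ L)⁻¹ :=
    h.add hB (hL.const_mul (by positivity))
  have hI0 : ∀ ξ, 0 ≤ I ξ := Set.indicator_nonneg fun ξ _ =>
    mul_nonneg (norm_nonneg _) (hw.pos ξ).le
  refine hG.of_translates hB (κ := Fin d → ℤ)
    (c := fun k => (C * Cw + 1) * ((1 + ‖latticePoint ε k‖) ^ (N - Nw))⁻¹)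
    (fun k => by positivity) (t := fun k => -latticePoint ε k) ?_ fun ξ => ?_
  · refine ((summable_latticePoint hε).mul_left ((C * Cw + 1) * Cv)).of_nonneg_of_le
      (fun k => ?_) fun k => ?_
    · have := (hB.weight.polyModerate.pos (-latticePoint ε k)).le
      positivity
    · have hq := one_add_norm_pos (latticePoint ε k)
      have h1 : (1 + ‖latticePoint ε k‖) ^ (2 * d + Nv) ≤
          (1 + ‖latticePoint ε k‖) ^ (N - Nw) :=
        pow_le_pow_right₀ (one_le_one_add_norm _) (by omega)
      calc _ ≤ (C * Cw + 1) * ((1 + ‖latticePoint ε k‖) ^ (2 * d + Nv))⁻¹ *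
            (Cv * (1 + ‖latticePoint ε k‖) ^ Nv) := by
            have := (hB.weight.polyModerate.pos (-latticePoint ε k)).le
            gcongr
            simpa using hv (-latticePoint ε k)
        _ = _ := by
          rw [pow_add]
          field_simp
  · simp only [sub_neg_eq_add]
    by_cases hξ : ξ ∈ Γ'
    swap
    · refine ⟨0, ?_⟩
      rw [Set.indicator_of_notMem hξ]
      have := hI0 (ξ + latticePoint ε 0)
      positivity
    rw [Set.indicator_of_mem hξ]
    obtain ⟨k, hkξ⟩ := hk ξ
    set q := latticePoint ε k with hq
    have hqp := one_add_norm_pos q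
    have hξp := one_add_norm_pos ξ
    by_cases hmem : ξ + q ∈ Γ
    -- Inside `Γ` the translate by `q` is used; moving the weight from `ξ + q` to `ξ` costs `(1 +
    -- |q|)^{Nw}`.
    · refine ⟨k, ?_⟩
      have h1 : w ξ ≤ Cw * w (ξ + q) * (1 + ‖q‖) ^ Nw := by
        have := hmod (ξ + q) (-q)
        rwa [add_neg_cancel_right, norm_neg] at this
      have h2 := (hw.pos ξ).le
      have h3 := (hw.pos (ξ + q)).le
      have h4 : (1 + ‖q‖) ^ N = (1 + ‖q‖) ^ (N - Nw) * (1 + ‖q‖) ^ Nw := by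
        rw [← pow_add]
        congr 1
        omega
      have h5 : I (ξ + q) = ‖g (ξ + q)‖ * w (ξ + q) := Set.indicator_of_mem hmem _
      calc FourierBF.peetre N g ξ * w ξ
          ≤ (C * ((1 + ‖q‖) ^ N)⁻¹ * ‖g (ξ + q)‖) * (Cw * w (ξ + q) * (1 + ‖q‖) ^ Nw) := by gcongr
        _ = C * Cw * ((1 + ‖q‖) ^ (N - Nw))⁻¹ * I (ξ + q) := by
          rw [h4, h5]
          field_simp
        _ ≤ (C * Cw + 1) * ((1 + ‖q‖) ^ (N - Nw))⁻¹ *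
            (I (ξ + q) + D * ((1 + ‖ξ + q‖) ^ L)⁻¹) := by
          have := hI0 (ξ + q)
          gcongr
          · linarith
          · have : 0 ≤ D * ((1 + ‖ξ + q‖) ^ L)⁻¹ := by positivity
            linarith
    -- Outside `Γ` the bound depends on `ξ` alone, so the untranslated term with its summand `D (1 +
    -- |ξ|)^{-L}` is used.
    · refine ⟨0, ?_⟩
      have e0 : latticePoint ε (0 : Fin d → ℤ) = 0 := by
        ext i
        simp [latticePoint_apply]
      have h1 : 1 + ‖ξ‖ ≤ Cγ' * (1 + ‖q‖) := by
        have := hγ ξ hξ (ξ + q) hmem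
        rw [sub_add_cancel_left, norm_neg] at this
        rw [hCγ']
        nlinarith [norm_nonneg q]
      have h2 : ((1 + ‖q‖) ^ (N - m))⁻¹ ≤ Cγ' ^ (N - m) * ((1 + ‖ξ‖) ^ (N - m))⁻¹ := by
        rw [← div_eq_mul_inv, le_div_iff₀ (by positivity), inv_mul_le_iff₀ (by positivity),
          mul_comm, ← mul_pow]
        gcongr
      have h3 : w ξ ≤ Cw * w 0 * (1 + ‖ξ‖) ^ Nw := by simpa using hmod 0 ξ
      have h4 : ‖g (ξ + q)‖ ≤ C₀ * ((1 + ‖ξ‖) * (1 + ‖q‖)) ^ m := by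
        refine (hg _).trans ?_
        gcongr
        exact one_add_norm_add_le ξ q
      have h5 : (1 + ‖q‖) ^ N = (1 + ‖q‖) ^ (N - m) * (1 + ‖q‖) ^ m := by
        rw [← pow_add]
        congr 1
        omega
      have h6 : (1 + ‖ξ‖) ^ (m + Nw + L) ≤ (1 + ‖ξ‖) ^ (N - m) :=
        pow_le_pow_right₀ (one_le_one_add_norm _) (by omega)
      have h7 := (hw.pos ξ).le
      calc FourierBF.peetre N g ξ * w ξ
          ≤ (C * ((1 + ‖q‖) ^ N)⁻¹ * (C₀ * ((1 + ‖ξ‖) * (1 + ‖q‖)) ^ m)) *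
            (Cw * w 0 * (1 + ‖ξ‖) ^ Nw) := by
            gcongr
            exact hkξ.trans (by gcongr)
        _ = C * C₀ * (Cw * w 0) * (1 + ‖ξ‖) ^ (m + Nw) * ((1 + ‖q‖) ^ (N - m))⁻¹ := by
          rw [h5, mul_pow, pow_add]
          field_simp
        _ ≤ C * C₀ * (Cw * w 0) * (1 + ‖ξ‖) ^ (m + Nw) *
            (Cγ' ^ (N - m) * ((1 + ‖ξ‖) ^ (m + Nw + L))⁻¹) := by
          gcongr
          refine h2.trans ?_
          gcongr
        _ = D * ((1 + ‖ξ‖) ^ L)⁻¹ := by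
          rw [hD, pow_add _ (m + Nw)]
          field_simp
        _ ≤ (C * Cw + 1) * ((1 + ‖latticePoint ε 0‖) ^ (N - Nw))⁻¹ *
            (I (ξ + latticePoint ε 0) + D * ((1 + ‖ξ + latticePoint ε 0‖) ^ L)⁻¹) := by
          rw [e0]
          simp only [norm_zero, add_zero, one_pow, inv_one, mul_one]
          have h8 : 0 ≤ D * ((1 + ‖ξ‖) ^ L)⁻¹ := by positivity
          have h9 := hI0 ξ
          have h10 : 0 ≤ C * Cw := by positivity
          nlinarith

theorem IsRepresentedBy.ae_eq {u : 𝓢'(Rd d, ℂ)} {g g' : Rd d → ℂ} (h : IsRepresentedBy u g)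
    (h' : IsRepresentedBy u g') : g =ᵐ[volume] g' := by
  refine ae_eq_of_integral_contDiff_smul_eq h.locallyIntegrable h'.locallyIntegrable fun χ hχ hχc => ?_
  have hs : ContDiff ℝ (⊤ : ℕ∞) fun x => (χ x : ℂ) := Complex.ofRealCLM.contDiff.comp hχ
  have hc : HasCompactSupport fun x => (χ x : ℂ) :=
    hχc.comp_left (g := fun r : ℝ => (r : ℂ)) Complex.ofReal_zero
  have e : ∀ g : Rd d → ℂ, ∫ x, χ x • g x = ∫ x, g x * hc.toSchwartzMap hs x := by
    intro g
    congr 1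
    ext x
    rw [Complex.real_smul, mul_comm]
    rfl
  rw [e, e, ← (h _).2, ← (h' _).2]

/-- Representatives of the Fourier transform agree almost everywhere, solidity makes membership in
`B` equivalent to domination, and moderateness compares `ω(y,·)` with `ω(0,·)`. -/
theorem mem_regularDirections_iff (hB : IsTranslationInvariantBFSpace v ι)
    {ω : Rd d × Rd d → ℝ} (hω : IsPolyModerate ω) {φ : 𝓢(Rd d, ℂ)} (hφ : HasCompactSupport φ)
    (f : 𝓢'(Rd d, ℂ)) (ξ₀ : Rd d) :
    ξ₀ ∈ regularDirections ι ω (TemperedDistribution.smulLeftCLM ℂ φ f) ↔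
      ∃ Γ, IsOpenCone Γ ∧ ξ₀ ∈ Γ ∧
        IsDominated ι (Γ.indicator fun ξ => ‖localFourier φ f ξ‖ * ω (0, ξ)) := by
  obtain ⟨hgm, hrep⟩ := localFourier_spec hφ f
  set g := localFourier φ f with hgdef
  constructor
  · rintro ⟨Γ, hΓ, hξ, h⟩
    refine ⟨Γ, hΓ, hξ, ?_⟩
    have h0 := h 0
    simp only [coneSeminorm, iInf_lt_iff] at h0
    obtain ⟨g', hg', b, hb, -⟩ := h0
    refine ⟨b, ?_⟩
    filter_upwards [hb, hrep.ae_eq hg'] with x h1 h2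
    rw [h1]
    by_cases hx : x ∈ Γ
    · rw [Set.indicator_of_mem hx, Set.indicator_of_mem hx, norm_mul, Complex.norm_real,
        Real.norm_of_nonneg (hω.pos _).le, h2]
    · rw [Set.indicator_of_notMem hx, Set.indicator_of_notMem hx, norm_zero]
  · rintro ⟨Γ, hΓ, hξ, h⟩
    obtain ⟨C, N, hC, hmod⟩ := hω.exists_pos
    refine ⟨Γ, hΓ, hξ, fun y => ?_⟩
    have hm : AEStronglyMeasurable (Γ.indicator fun ξ => g ξ * (ω (y, ξ) : ℂ)) volume := by
      refine (hgm.mul ?_).indicator hΓ.isOpen.measurableSet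
      exact (Complex.measurable_ofReal.comp
        (hω.measurable.comp measurable_prodMk_left)).aestronglyMeasurable
    obtain ⟨b, hb⟩ := (h.const_mul (c := C * (1 + ‖y‖) ^ N) (by positivity)).exists_eq hB hm
      fun x => by
        by_cases hx : x ∈ Γ
        · rw [Set.indicator_of_mem hx, Set.indicator_of_mem hx, norm_mul, Complex.norm_real,
            Real.norm_of_nonneg (hω.pos _).le]
          have h1 : ω (y, x) ≤ C * ω (0, x) * (1 + ‖y‖) ^ N := by
            have := hmod (0, x) (y, 0)
            simpa [Prod.norm_def] using this
          calc ‖g x‖ * ω (y, x) ≤ ‖g x‖ * (C * ω (0, x) * (1 + ‖y‖) ^ N) := by gcongr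
            _ = _ := by ring
        · rw [Set.indicator_of_notMem hx, Set.indicator_of_notMem hx, norm_zero, mul_zero]
    refine lt_of_le_of_lt (iInf₂_le_of_le g hrep (iInf₂_le b hb)) ?_
    exact enorm_lt_top

end domination

end FourierBF

end

noncomputable section

namespace FourierBF

open scoped ContDiff

/-! ### Families of localized symbols -/

section families
variable {d : ℕ}

theorem norm_iteratedFDeriv_const_mul {F : Rd d → ℂ} (hF : ContDiff ℝ ∞ F) (c : ℂ) (n : ℕ)
    (x : Rd d) :
    ‖iteratedFDeriv ℝ n (fun x => c * F x) x‖ = ‖c‖ * ‖iteratedFDeriv ℝ n F x‖ := by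
  have h : iteratedFDeriv ℝ n (c • F) x = c • iteratedFDeriv ℝ n F x :=
    iteratedFDeriv_const_smul_apply (hF.contDiffAt.of_le (mod_cast le_top))
  change ‖iteratedFDeriv ℝ n (c • F) x‖ = _
  rw [h, norm_smul]

theorem UnifSmooth.cutoff_mul {P : Type*} {θ : 𝓢(Rd d, ℂ)} {K : Set (Rd d)} (hK : IsCompact K)
    (hθ : ∀ x, x ∉ K → θ x = 0) {A : P → Rd d → ℂ} (hs : ∀ p, ContDiff ℝ ∞ (A p))
    (hb : ∀ n, ∃ C, ∀ p, ∀ x ∈ K, ‖iteratedFDeriv ℝ n (A p) x‖ ≤ C) :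
    UnifSmooth (fun p x => θ x * A p x) := by
  choose C hC using hb
  choose D hD0 hD using (UnifSmooth.of_hasCompactSupport (P := Unit) (θ.smooth ⊤)
    (hasCompactSupport_of_eq_zero hK hθ)).exists_bound
  refine .mk' (fun p => (θ.smooth ⊤).mul (hs p)) fun n =>
    ⟨∑ i ∈ Finset.range (n + 1), (n.choose i : ℝ) * D i * |C (n - i)|, fun p x => ?_⟩
  by_cases hx : x ∈ K
  · refine (norm_iteratedFDeriv_mul_le (𝕜 := ℝ) (θ.smooth ⊤) (hs p) x (n := n)
      (mod_cast le_top)).trans (Finset.sum_le_sum fun i _ => ?_)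
    have := hD0 i
    gcongr
    · exact hD i () x
    · exact (hC (n - i) p x hx).trans (le_abs_self _)
  · have h2 : (fun x => θ x * A p x) =ᶠ[𝓝 x] fun _ => 0 := by
      filter_upwards [hK.isClosed.isOpen_compl.mem_nhds hx] with z hz
      rw [hθ z hz, zero_mul]
    rw [(Filter.EventuallyEq.iteratedFDeriv ℝ h2 n).eq_of_nhds]
    have : iteratedFDeriv ℝ n (fun _ : Rd d => (0 : ℂ)) x = 0 := by
      rw [iteratedFDeriv_fun_zero]
      rfl
    rw [this, norm_zero]
    exact Finset.sum_nonneg fun i _ => by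
      have := hD0 i
      positivity

theorem HasUniformTemperateGrowth.contDiff_slice {a : Rd d × Rd d → ℂ}
    (ha : HasUniformTemperateGrowth a) (ξ : Rd d) : ContDiff ℝ ∞ fun x => a (x, ξ) :=
  (ha.slice_hasTemperateGrowth ξ).1

theorem SymbolClass.symDeriv_inl {ρ : ℝ} {w : Rd d × Rd d → ℝ} {a : Rd d × Rd d → ℂ}
    (ha : SymbolClass ρ 0 w a) (j : Fin d) :
    SymbolClass ρ 0 w (FourierBF.symDeriv (Sum.inl j) a) := by
  simpa using ha.symDeriv (Sum.inl j)

theorem SymbolClass.norm_le {ρ : ℝ} {w : Rd d × Rd d → ℝ} (hw : ∀ z, 0 < w z)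
    {a : Rd d × Rd d → ℂ} (ha : SymbolClass ρ 0 w a) :
    ∃ C, 0 ≤ C ∧ ∀ z, ‖a z‖ ≤ C * w z := by
  obtain ⟨D, hD⟩ := ha.2 0 Fin.elim0
  refine ⟨|D|, abs_nonneg D, fun z => ?_⟩
  have h := hD z.1 z.2
  simp only [iteratedFDeriv_zero_apply, Finset.univ_eq_empty, Finset.filter_empty,
    Finset.card_empty, CharP.cast_eq_zero, mul_zero, add_zero, Real.rpow_zero, mul_one] at h
  refine h.trans ?_
  have := (hw z).le
  gcongr
  exact le_abs_self D

theorem SymbolClass.iteratedFDeriv_slice_le {ρ : ℝ} {w : Rd d × Rd d → ℝ} (hw : ∀ z, 0 < w z)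
    (n : ℕ) : ∀ {a : Rd d × Rd d → ℂ}, HasUniformTemperateGrowth a → SymbolClass ρ 0 w a →
    ∃ C, 0 ≤ C ∧ ∀ x ξ, ‖iteratedFDeriv ℝ n (fun x => a (x, ξ)) x‖ ≤ C * w (x, ξ) := by
  induction n with
  | zero =>
    intro a ha h
    obtain ⟨C, hC, hb⟩ := h.norm_le hw
    exact ⟨C, hC, fun x ξ => by simpa using hb (x, ξ)⟩
  | succ n ih =>
    intro a ha h
    choose C hC hb using fun j => ih (ha.symDeriv (Sum.inl j)) (h.symDeriv_inl j)
    refine ⟨∑ j, C j, Finset.sum_nonneg fun j _ => hC j, fun x ξ => ?_⟩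
    refine (norm_iteratedFDeriv_succ_le_sum (ha.contDiff_slice ξ) n x).trans ?_
    rw [Finset.sum_mul]
    refine Finset.sum_le_sum fun j _ => ?_
    rw [show partialDeriv j (fun x => a (x, ξ)) = fun x => FourierBF.symDeriv (Sum.inl j) a (x, ξ)
      from funext fun x => partialDeriv_slice ha j x ξ]
    exact hb j x ξ

theorem partialDeriv_slice_right {a : Rd d × Rd d → ℂ} (ha : HasUniformTemperateGrowth a)
    (j : Fin d) (x ξ : Rd d) :
    partialDeriv j (fun ξ => a (x, ξ)) ξ = symDeriv (Sum.inr j) a (x, ξ) := by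
  have hp : HasFDerivAt (fun ξ : Rd d => ((x, ξ) : Rd d × Rd d))
      (ContinuousLinearMap.inr ℝ (Rd d) (Rd d)) ξ := hasFDerivAt_prodMk_right x ξ
  have h1 := ((differentiable_symbol ha) (x, ξ)).hasFDerivAt.comp ξ hp
  have h2 : HasFDerivAt (fun ξ => a (x, ξ)) _ ξ := h1
  rw [partialDeriv, h2.fderiv]
  rfl

/-- Mean value inequality on the segment from `ξ` to `η`. The frequency derivative gains `⟨ζ⟩^{-ρ}`,
and transferring this gain and the weight from `ζ` to `ξ` costs only powers of `1 + |ξ - η|`. This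
gain drives the elliptic estimate. -/
theorem SymbolClass.norm_slice_sub_le {ρ ρ' : ℝ} (hρ'0 : 0 ≤ ρ') (hρ' : ρ' ≤ ρ) (hρ'1 : ρ' ≤ 1)
    {w : Rd d × Rd d → ℝ} (hw : IsPolyModerate w) : ∃ M : ℕ, ∀ {a : Rd d × Rd d → ℂ},
      HasUniformTemperateGrowth a → SymbolClass ρ 0 w a → ∃ C, 0 ≤ C ∧ ∀ x ξ η,
        ‖a (x, η) - a (x, ξ)‖ ≤ C * (w (x, ξ) * (1 + ‖ξ‖) ^ (-ρ') * (1 + ‖ξ - η‖) ^ M) := by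
  obtain ⟨Cw, N, hCw, hmod⟩ := hw.exists_pos
  -- `N` from the weight, one from the bracket and one from the length of the segment. The exponent
  -- does not depend on `a`, which permits the later induction over derivatives of `a`.
  refine ⟨N + 2, fun {a} ha h => ?_⟩
  have hwr : ∀ z : Rd d × Rd d, 0 < w z * japaneseBracket z.2 ^ (-ρ) := fun z =>
    mul_pos (hw.pos z) (Real.rpow_pos_of_pos (zero_lt_one.trans_le (one_le_japaneseBracket _)) _)
  have h1 : ∀ j, ∃ C, 0 ≤ C ∧ ∀ z, ‖FourierBF.symDeriv (Sum.inr j) a z‖ ≤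
      C * (w z * japaneseBracket z.2 ^ (-ρ)) := fun j => by
    have := h.symDeriv (Sum.inr j)
    simp only [Sum.isRight_inr, if_true, mul_one] at this
    exact this.norm_le hwr
  choose C hC hb using h1
  set S := ∑ j, C j with hS
  have hS0 : 0 ≤ S := Finset.sum_nonneg fun j _ => hC j
  refine ⟨S * Cw * 2 ^ ρ, by positivity, fun x ξ η => ?_⟩
  set W := w (x, ξ) * (1 + ‖ξ‖) ^ (-ρ') with hW
  have hwx := hw.pos (x, ξ)
  have hWp : 0 < W := mul_pos hwx (Real.rpow_pos_of_pos (one_add_norm_pos ξ) _)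
  have hq := one_add_norm_pos (ξ - η)
  have hs : ContDiff ℝ ∞ fun ζ => a (x, ζ) := ha.1.comp (contDiff_const.prodMk contDiff_id)
  have h2 : ∀ ζ ∈ segment ℝ ξ η, ‖fderiv ℝ (fun ζ => a (x, ζ)) ζ‖ ≤
      S * Cw * 2 ^ ρ * (W * (1 + ‖ξ - η‖) ^ (N + 1)) := by
    intro ζ hζ
    have hζ' : ‖ζ - ξ‖ ≤ ‖ξ - η‖ := by
      rw [norm_sub_rev ξ η]
      exact norm_sub_le_of_mem_segment hζ
    have hζp := one_add_norm_pos ζ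
    have h3 := norm_iteratedFDeriv_succ_le_sum hs 0 ζ
    rw [zero_add, norm_iteratedFDeriv_one] at h3
    refine h3.trans ?_
    have h4 : w (x, ζ) ≤ Cw * w (x, ξ) * (1 + ‖ξ - η‖) ^ N := by
      have h5 := hmod (x, ξ) (0, ζ - ξ)
      simp only [Prod.mk_add_mk, add_zero, add_sub_cancel] at h5
      refine h5.trans ?_
      have h6 : ‖((0 : Rd d), ζ - ξ)‖ ≤ ‖ξ - η‖ := by simpa [Prod.norm_def] using hζ'
      gcongr
    -- Here `ρ' ≤ 1` bounds `(1 + |ξ - η|)^{ρ'}` by the first power.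
    have h7 : japaneseBracket ζ ^ (-ρ) ≤ 2 ^ ρ * ((1 + ‖ξ‖) ^ (-ρ') * (1 + ‖ξ - η‖)) := by
      refine (japaneseBracket_rpow_neg_le ζ hρ' (hρ'0.trans hρ')).trans ?_
      gcongr
      have h8 : 1 + ‖ξ‖ ≤ (1 + ‖ξ - η‖) * (1 + ‖ζ‖) := by
        refine (one_add_norm_le_sub' ξ ζ).trans ?_
        gcongr
      rw [Real.rpow_neg hζp.le, Real.rpow_neg (one_add_norm_pos ξ).le, inv_mul_eq_div,
        le_div_iff₀ (Real.rpow_pos_of_pos (one_add_norm_pos ξ) _),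
        inv_mul_le_iff₀ (Real.rpow_pos_of_pos hζp _)]
      calc (1 + ‖ξ‖) ^ ρ' ≤ ((1 + ‖ξ - η‖) * (1 + ‖ζ‖)) ^ ρ' := by gcongr
        _ = (1 + ‖ξ - η‖) ^ ρ' * (1 + ‖ζ‖) ^ ρ' := Real.mul_rpow hq.le hζp.le
        _ ≤ (1 + ‖ξ - η‖) ^ (1 : ℝ) * (1 + ‖ζ‖) ^ ρ' := by
          gcongr
          exact one_le_one_add_norm _
        _ = _ := by rw [Real.rpow_one, mul_comm]
    rw [hS, Finset.sum_mul, Finset.sum_mul, Finset.sum_mul]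
    refine Finset.sum_le_sum fun j _ => ?_
    rw [norm_iteratedFDeriv_zero, partialDeriv_slice_right ha]
    have hCj := hC j
    have hjb : 0 ≤ japaneseBracket ζ ^ (-ρ) := Real.rpow_nonneg (Real.sqrt_nonneg _) _
    calc _ ≤ C j * (w (x, ζ) * japaneseBracket ζ ^ (-ρ)) := hb j (x, ζ)
      _ ≤ C j * ((Cw * w (x, ξ) * (1 + ‖ξ - η‖) ^ N) *
          (2 ^ ρ * ((1 + ‖ξ‖) ^ (-ρ') * (1 + ‖ξ - η‖)))) := by gcongr
      _ = _ := by
        rw [hW, pow_succ]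
        ring
  have h9 := (convex_segment ξ η).norm_image_sub_le_of_norm_fderiv_le (𝕜 := ℝ)
    (f := fun ζ => a (x, ζ)) (fun ζ _ => hs.differentiable (by simp) ζ) h2
    (left_mem_segment ℝ ξ η) (right_mem_segment ℝ ξ η)
  refine h9.trans ?_
  have h10 : ‖η - ξ‖ ≤ 1 + ‖ξ - η‖ := by
    rw [norm_sub_rev]
    linarith
  calc _ ≤ S * Cw * 2 ^ ρ * (W * (1 + ‖ξ - η‖) ^ (N + 1)) * (1 + ‖ξ - η‖) := by gcongr
    _ = _ := by
      rw [pow_succ (1 + ‖ξ - η‖) (N + 1)]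
      ring

theorem SymbolClass.iteratedFDeriv_slice_sub_le {ρ ρ' : ℝ} (hρ'0 : 0 ≤ ρ') (hρ' : ρ' ≤ ρ)
    (hρ'1 : ρ' ≤ 1) {w : Rd d × Rd d → ℝ} (hw : IsPolyModerate w) : ∃ M : ℕ, ∀ (n : ℕ)
      {a : Rd d × Rd d → ℂ}, HasUniformTemperateGrowth a → SymbolClass ρ 0 w a → ∃ C, 0 ≤ C ∧
        ∀ x ξ η, ‖iteratedFDeriv ℝ n (fun x => a (x, η) - a (x, ξ)) x‖ ≤
          C * (w (x, ξ) * (1 + ‖ξ‖) ^ (-ρ') * (1 + ‖ξ - η‖) ^ M) := by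
  obtain ⟨M, hM⟩ := SymbolClass.norm_slice_sub_le hρ'0 hρ' hρ'1 hw
  refine ⟨M, fun n => ?_⟩
  induction n with
  | zero =>
    intro a ha h
    simpa only [norm_iteratedFDeriv_zero] using hM ha h
  | succ n ih =>
    intro a ha h
    choose C hC hb using fun j => ih (ha.symDeriv (Sum.inl j)) (h.symDeriv_inl j)
    refine ⟨∑ j, C j, Finset.sum_nonneg fun j _ => hC j, fun x ξ η => ?_⟩
    refine (norm_iteratedFDeriv_succ_le_sum ((ha.contDiff_slice η).sub (ha.contDiff_slice ξ))
      n x).trans ?_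
    rw [Finset.sum_mul]
    refine Finset.sum_le_sum fun j _ => ?_
    have e : partialDeriv j (fun x => a (x, η) - a (x, ξ)) = fun x =>
        FourierBF.symDeriv (Sum.inl j) a (x, η) - FourierBF.symDeriv (Sum.inl j) a (x, ξ) := by
      ext x
      rw [← partialDeriv_slice ha, ← partialDeriv_slice ha, partialDeriv, fderiv_fun_sub
        ((ha.contDiff_slice η).differentiable (by simp) x)
        ((ha.contDiff_slice ξ).differentiable (by simp) x)]
      rfl
    rw [e]
    exact hb j x ξ η

theorem IsPolyModerate.le_mul_of_isCompact {w : Rd d × Rd d → ℝ} (hw : IsPolyModerate w)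
    {K : Set (Rd d)} (hK : IsCompact K) : ∃ C, 0 < C ∧ ∀ x ∈ K, ∀ ξ,
      w (x, ξ) ≤ C * w (0, ξ) ∧ w (0, ξ) ≤ C * w (x, ξ) := by
  obtain ⟨Cw, N, hCw, hmod⟩ := hw.exists_pos
  obtain ⟨R, hR0, hR⟩ := hK.isBounded.exists_pos_norm_le
  refine ⟨Cw * (1 + R) ^ N, by positivity, fun x hx ξ => ⟨?_, ?_⟩⟩
  · have h1 := hmod (0, ξ) (x, 0)
    simp only [Prod.mk_add_mk, add_zero, zero_add] at h1
    have h2 : ‖(x, (0 : Rd d))‖ ≤ R := by simpa [Prod.norm_def] using hR x hx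
    have := (hw.pos (0, ξ)).le
    calc w (x, ξ) ≤ Cw * w (0, ξ) * (1 + R) ^ N := h1.trans (by gcongr)
      _ = _ := by ring
  · have h1 := hmod (x, ξ) (-x, 0)
    simp only [Prod.mk_add_mk, add_zero, add_neg_cancel] at h1
    have h2 : ‖(-x, (0 : Rd d))‖ ≤ R := by simpa [Prod.norm_def] using hR x hx
    have := (hw.pos (x, ξ)).le
    calc w (0, ξ) ≤ Cw * w (x, ξ) * (1 + R) ^ N := h1.trans (by gcongr)
      _ = _ := by ring

/-- Position derivatives cost nothing since `δ = 0`, and on compact sets `w(x,η)` is comparable to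
`w(0,η)`. Frozen symbols, normalized and cut off, thus form a family with uniform bounds. -/
theorem SymbolClass.unifSmooth_cutoff {ρ : ℝ} {w : Rd d × Rd d → ℝ} (hw : IsPolyModerate w)
    {a : Rd d × Rd d → ℂ} (ha : HasUniformTemperateGrowth a) (h : SymbolClass ρ 0 w a)
    {θ : 𝓢(Rd d, ℂ)} {K : Set (Rd d)} (hK : IsCompact K) (hθ : ∀ x, x ∉ K → θ x = 0) :
    UnifSmooth fun (η : Rd d) x => θ x * (((w (0, η))⁻¹ : ℝ) * a (x, η)) := by
  obtain ⟨Cw, hCw, hcomp⟩ := hw.le_mul_of_isCompact hK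
  refine UnifSmooth.cutoff_mul hK hθ (fun η => contDiff_const.mul (ha.contDiff_slice η)) fun n => ?_
  obtain ⟨C, hC, hb⟩ := h.iteratedFDeriv_slice_le hw.pos n ha
  refine ⟨C * Cw, fun η x hx => ?_⟩
  have hw0 := hw.pos (0, η)
  rw [norm_iteratedFDeriv_const_mul (ha.contDiff_slice η), Complex.norm_real,
    Real.norm_of_nonneg (inv_nonneg.2 hw0.le), inv_mul_le_iff₀ hw0]
  calc _ ≤ C * w (x, η) := hb x η
    _ ≤ C * (Cw * w (0, η)) := by
      gcongr
      exact (hcomp x hx η).1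
    _ = _ := by ring

theorem SymbolClass.unifSmooth_cutoff_sub {ρ ρ' : ℝ} (hρ'0 : 0 ≤ ρ') (hρ' : ρ' ≤ ρ)
    (hρ'1 : ρ' ≤ 1) {w : Rd d × Rd d → ℝ} (hw : IsPolyModerate w)
    {a : Rd d × Rd d → ℂ} (ha : HasUniformTemperateGrowth a) (h : SymbolClass ρ 0 w a)
    {θ : 𝓢(Rd d, ℂ)} {K : Set (Rd d)} (hK : IsCompact K) (hθ : ∀ x, x ∉ K → θ x = 0) :
    ∃ M : ℕ, UnifSmooth fun (p : Rd d × Rd d) x => θ x *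
      (((w (0, p.1) * (1 + ‖p.1‖) ^ (-ρ') * (1 + ‖p.1 - p.2‖) ^ M)⁻¹ : ℝ) *
        (a (x, p.2) - a (x, p.1))) := by
  obtain ⟨Cw, hCw, hcomp⟩ := hw.le_mul_of_isCompact hK
  obtain ⟨M, hM⟩ := SymbolClass.iteratedFDeriv_slice_sub_le hρ'0 hρ' hρ'1 hw
  refine ⟨M, UnifSmooth.cutoff_mul hK hθ (fun p => contDiff_const.mul
    ((ha.contDiff_slice p.2).sub (ha.contDiff_slice p.1))) fun n => ?_⟩
  obtain ⟨C, hC, hb⟩ := hM n ha h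
  refine ⟨C * Cw, fun p x hx => ?_⟩
  have hw0 := hw.pos (0, p.1)
  have h1 : 0 < (1 + ‖p.1‖) ^ (-ρ') := Real.rpow_pos_of_pos (one_add_norm_pos _) _
  have h2 : 0 < (1 + ‖p.1 - p.2‖) ^ M := pow_pos (one_add_norm_pos _) _
  rw [norm_iteratedFDeriv_const_mul ((ha.contDiff_slice p.2).sub (ha.contDiff_slice p.1)),
    Complex.norm_real, Real.norm_of_nonneg (by positivity), inv_mul_le_iff₀ (by positivity)]
  calc _ ≤ C * (w (x, p.1) * (1 + ‖p.1‖) ^ (-ρ') * (1 + ‖p.1 - p.2‖) ^ M) := hb x p.1 p.2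
    _ ≤ C * ((Cw * w (0, p.1)) * (1 + ‖p.1‖) ^ (-ρ') * (1 + ‖p.1 - p.2‖) ^ M) := by
      gcongr
      exact (hcomp x hx p.1).1
    _ = _ := by ring

/-- Division by a function without zeros on the support. -/
theorem exists_schwartz_div {K : Set (Rd d)} (hK : IsCompact K) {θ φ : 𝓢(Rd d, ℂ)}
    (hθ : ∀ x, x ∉ K → θ x = 0) (hφ : ∀ x ∈ K, φ x ≠ 0) :
    ∃ ψ : 𝓢(Rd d, ℂ), (∀ x, x ∉ K → ψ x = 0) ∧ ∀ x, φ x * ψ x = θ x := by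
  have hc : HasCompactSupport fun x => θ x * (φ x)⁻¹ :=
    HasCompactSupport.intro hK fun x hx => by rw [hθ x hx, zero_mul]
  have hs : ContDiff ℝ ∞ fun x => θ x * (φ x)⁻¹ := by
    rw [contDiff_iff_contDiffAt]
    intro x
    by_cases hx : x ∈ K
    · exact (θ.smooth ⊤).contDiffAt.mul ((φ.smooth ⊤).contDiffAt.inv (hφ x hx))
    · have : (fun x => θ x * (φ x)⁻¹) =ᶠ[𝓝 x] fun _ => 0 := by
        filter_upwards [hK.isClosed.isOpen_compl.mem_nhds hx] with z hz
        rw [hθ z hz, zero_mul]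
      exact contDiffAt_const.congr_of_eventuallyEq this
  refine ⟨hc.toSchwartzMap hs, fun x hx => ?_, fun x => ?_⟩
  · change θ x * (φ x)⁻¹ = 0
    rw [hθ x hx, zero_mul]
  · change φ x * (θ x * (φ x)⁻¹) = θ x
    by_cases hx : x ∈ K
    · have := hφ x hx
      field_simp
    · rw [hθ x hx, zero_mul, mul_zero]

theorem UnifSmooth.exists_testFamily {P : Type*} {H : P → Rd d → ℂ} (hH : UnifSmooth H)
    {K : Set (Rd d)} (hK : IsCompact K) (hs : ∀ p x, x ∉ K → H p x = 0) :
    ∃ H' : P → 𝓢(Rd d, ℂ), (∀ p x, H' p x = H p x) ∧ TestFamily K H' := by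
  have hc : ∀ p, HasCompactSupport (H p) := fun p => HasCompactSupport.intro hK (hs p)
  exact ⟨fun p => (hc p).toSchwartzMap (hH.smooth p), fun p x => rfl, hH, hs⟩

/-- A local parametrix: symbols `b` with `b(x,ξ) a(x,ξ) = w(0,ξ) φ(x)` for the frequencies `ξ` for
which `a` is elliptic on a neighbourhood of the support of `φ`. -/
theorem SymbolClass.exists_parametrix {ρ : ℝ} {w : Rd d × Rd d → ℝ} (hw : IsPolyModerate w)
    {a : Rd d × Rd d → ℂ} (ha : HasUniformTemperateGrowth a) (h : SymbolClass ρ 0 w a)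
    {K T : Set (Rd d)} (hK : IsCompact K) (hT : IsCompact T) {θ φ : 𝓢(Rd d, ℂ)}
    (hθK : ∀ x ∈ K, θ x = 1) (hθ : ∀ x, x ∉ T → θ x = 0) (hφ : ∀ x, x ∉ K → φ x = 0)
    {Ω : Set (Rd d)} {c : ℝ} (hc : 0 < c)
    (hell : ∀ x ∈ T, ∀ ξ ∈ Ω, c * w (x, ξ) ≤ ‖a (x, ξ)‖) :
    ∃ b : Ω → 𝓢(Rd d, ℂ), TestFamily K b ∧
      ∀ (ξ : Ω) x, b ξ x * a (x, ξ) = (w (0, (ξ : Rd d)) : ℂ) * φ x := by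
  obtain ⟨Cw, hCw, hcomp⟩ := hw.le_mul_of_isCompact hT
  set A : Ω → Rd d → ℂ := fun ξ x => θ x * (((w (0, (ξ : Rd d)))⁻¹ : ℝ) * a (x, ξ)) with hA
  have hAs : UnifSmooth A :=
    (SymbolClass.unifSmooth_cutoff hw ha h hT hθ).comp (fun ξ : Ω => (ξ : Rd d))
  have hθs : UnifSmooth (fun (_ : Ω) x => 1 + -θ x) := (UnifSmooth.const 1).add
    (UnifSmooth.of_hasCompactSupport (θ.smooth ⊤) (hasCompactSupport_of_eq_zero hT hθ)).neg
  -- `D = |A|² + |1 - θ|²` has a uniform positive lower bound on the whole space, hence a uniformly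
  -- smooth inverse. On `K` it equals `|A|²`, so `φ Ā / D` is `φ / A` there.
  set D : Ω → Rd d → ℂ := fun ξ x => A ξ x * (starRingEnd ℂ) (A ξ x) +
    (1 + -θ x) * (starRingEnd ℂ) (1 + -θ x) with hD
  have hDs : UnifSmooth D := (hAs.mul hAs.star).add (hθs.mul hθs.star)
  have hDr : ∀ ξ x, D ξ x = ((‖A ξ x‖ ^ 2 + ‖1 + -θ x‖ ^ 2 : ℝ) : ℂ) := by
    intro ξ x
    rw [hD]
    simp only [Complex.mul_conj, Complex.normSq_eq_norm_sq]
    push_cast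
    rfl
  set c' := min 1 (c / Cw) with hc'
  have hc'p : 0 < c' := by positivity
  have hAθ : ∀ ξ x, c' * ‖θ x‖ ≤ ‖A ξ x‖ := by
    intro ξ x
    by_cases hx : x ∈ T
    · have hw0 := hw.pos (0, (ξ : Rd d))
      have h1 := hell x hx ξ ξ.2
      have h2 := (hcomp x hx ξ).2
      simp only [hA]
      rw [norm_mul, norm_mul, Complex.norm_real, Real.norm_of_nonneg (by positivity), mul_comm]
      gcongr
      refine (min_le_right _ _).trans ?_
      rw [← div_eq_inv_mul, div_le_div_iff₀ hCw hw0]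
      nlinarith
    · rw [hθ x hx, norm_zero, mul_zero]
      exact norm_nonneg _
  -- From `1 ≤ |θ| + |1 - θ|`, `c'|θ| ≤ |A|` and `c' ≤ 1` follows `c' ≤ |A| + |1 - θ|`.
  have hDb : ∀ ξ x, c' ^ 2 / 4 ≤ ‖D ξ x‖ := by
    intro ξ x
    rw [hDr, Complex.norm_real, Real.norm_of_nonneg (by positivity)]
    have h1 : 1 ≤ ‖θ x‖ + ‖1 + -θ x‖ := by
      have := norm_add_le (θ x) (1 + -θ x)
      rw [show θ x + (1 + -θ x) = 1 by ring, norm_one] at this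
      exact this
    have h2 := hAθ ξ x
    have h3 : c' ≤ 1 := min_le_left _ _
    have h4 : c' ≤ ‖A ξ x‖ + ‖1 + -θ x‖ := by nlinarith [norm_nonneg (1 + -θ x)]
    have h5 : c' ^ 2 ≤ (‖A ξ x‖ + ‖1 + -θ x‖) ^ 2 := by gcongr
    nlinarith [sq_nonneg (‖A ξ x‖ - ‖1 + -θ x‖)]
  have hφs : UnifSmooth (fun _ : Ω => (φ : Rd d → ℂ)) :=
    UnifSmooth.of_hasCompactSupport (φ.smooth ⊤) (hasCompactSupport_of_eq_zero hK hφ)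
  obtain ⟨b, hb, hbt⟩ := ((hφs.mul hAs.star).mul (hDs.inv (by positivity) hDb)).exists_testFamily hK
    (fun ξ x hx => by rw [hφ x hx, zero_mul, zero_mul])
  refine ⟨b, hbt, fun ξ x => ?_⟩
  rw [hb]
  by_cases hx : x ∈ K
  · have hw0 : (w (0, (ξ : Rd d)) : ℂ) ≠ 0 := by exact_mod_cast (hw.pos _).ne'
    have hDne : D ξ x ≠ 0 := fun h0 => by
      have := hDb ξ x
      rw [h0, norm_zero] at this
      have : 0 < c' ^ 2 / 4 := by positivity
      linarith
    have hDe : D ξ x = A ξ x * (starRingEnd ℂ) (A ξ x) := by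
      simp [hD, hθK x hx]
    have hAe : a (x, ξ) = w (0, (ξ : Rd d)) * A ξ x := by
      simp only [hA, hθK x hx]
      push_cast
      field_simp
    rw [hAe]
    have : φ x * (starRingEnd ℂ) (A ξ x) * (D ξ x)⁻¹ * (w (0, (ξ : Rd d)) * A ξ x) =
        w (0, (ξ : Rd d)) * φ x * ((D ξ x)⁻¹ * (A ξ x * (starRingEnd ℂ) (A ξ x))) := by ring
    rw [this, ← hDe, inv_mul_cancel₀ hDne, mul_one]
  · rw [hφ x hx]
    ring

end families

end FourierBF

end

noncomputable section

namespace FourierBF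

/-! ### Estimates by Peetre maximal functions -/

section estimates
variable {d : ℕ}

/-- `N` powers of the kernel are spent on the maximal function, the remaining `d + 1` on
integrability. -/
theorem norm_integral_mul_le_peetre {g : Rd d → ℂ} {m N : ℕ} (hmN : m ≤ N) {C₀ : ℝ} (hC₀ : 0 ≤ C₀)
    (hg : ∀ η, ‖g η‖ ≤ C₀ * (1 + ‖η‖) ^ m) {k : Rd d → ℂ} {A : ℝ} {ξ : Rd d}
    (hk : ∀ η, ‖k η‖ ≤ A * ((1 + ‖ξ - η‖) ^ (N + (d + 1)))⁻¹) :
    ‖∫ η, g η * k η‖ ≤ A * (∫ x : Rd d, (1 + ‖x‖) ^ (-(d + 1 : ℝ))) * peetre N g ξ := by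
  have hP := peetre_nonneg N g ξ
  have h1 : ∀ η, ‖g η * k η‖ ≤ A * peetre N g ξ * (1 + ‖ξ - η‖) ^ (-(d + 1 : ℝ)) := by
    intro η
    have hp := one_add_norm_pos (ξ - η)
    have e2 : (1 + ‖ξ - η‖) ^ (-(d + 1 : ℝ)) = ((1 + ‖ξ - η‖) ^ (d + 1))⁻¹ := by
      rw [Real.rpow_neg hp.le, ← Real.rpow_natCast]
      push_cast
      rfl
    rw [norm_mul, e2]
    calc ‖g η‖ * ‖k η‖ ≤ (peetre N g ξ * (1 + ‖ξ - η‖) ^ N) *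
          (A * ((1 + ‖ξ - η‖) ^ (N + (d + 1)))⁻¹) := by
          gcongr
          · exact le_peetre hmN hC₀ hg ξ η
          · exact hk η
      _ = _ := by
        rw [pow_add]
        field_simp
  have hint : Integrable fun η : Rd d => (1 + ‖ξ - η‖) ^ (-(d + 1 : ℝ)) :=
    integrable_one_add_norm_rpow.comp_sub_left ξ
  refine (norm_integral_le_of_norm_le (hint.const_mul _)
    (Filter.Eventually.of_forall h1)).trans (le_of_eq ?_)
  rw [integral_const_mul,
    integral_sub_left_eq_self (fun x : Rd d => (1 + ‖x‖) ^ (-(d + 1 : ℝ)))]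
  ring

theorem TestFamily.exists_decay {P : Type*} {K : Set (Rd d)} (hK : IsCompact K)
    {H : P → 𝓢(Rd d, ℂ)} (hH : TestFamily K H) (L : ℕ) :
    ∃ C, 0 ≤ C ∧ ∀ p ξ η, ‖∫ x, phase (η - ξ) x * H p x‖ ≤ C * ((1 + ‖ξ - η‖) ^ L)⁻¹ := by
  obtain ⟨C, hC, h⟩ := hH.unif.integral_phase_decay hK hH.supp L
  refine ⟨C, hC, fun p ξ η => ?_⟩
  rw [← div_eq_mul_inv, le_div_iff₀ (pow_pos (one_add_norm_pos _) _), mul_comm, norm_sub_rev]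
  exact h p (η - ξ)

/-- Writing `H = φ H'` turns the pairing into an integral of `localFourier φ u` against the inverse
transform of `H'` translated by `ξ`, which decays uniformly in the parameter. -/
theorem TestFamily.norm_apply_modulate_le {P : Type*} {K : Set (Rd d)} (hK : IsCompact K)
    {H H' : P → 𝓢(Rd d, ℂ)} (hH' : TestFamily K H') {φ : 𝓢(Rd d, ℂ)} (hφ : HasCompactSupport φ)
    (hHH' : ∀ p x, φ x * H' p x = H p x) (u : 𝓢'(Rd d, ℂ)) {m N : ℕ} (hmN : m ≤ N)
    (hu : DistOrderLE u m) :
    ∃ C, 0 ≤ C ∧ ∀ p ξ, ‖u (modulate ξ (H p))‖ ≤ C * peetre N (localFourier φ u) ξ := by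
  obtain ⟨C₀, hC₀, hg⟩ := hu.localFourier_le φ
  obtain ⟨C, hC, h⟩ := hH'.exists_decay hK (N + (d + 1))
  have hc := (fourierConst_pos d).le
  refine ⟨fourierConst d * C * ∫ x : Rd d, (1 + ‖x‖) ^ (-(d + 1 : ℝ)),
    mul_nonneg (by positivity) (integral_nonneg fun x => by positivity), fun p ξ => ?_⟩
  have e : modulate ξ (H p) = SchwartzMap.smulLeftCLM ℂ φ (modulate ξ (H' p)) := by
    ext x
    rw [SchwartzMap.smulLeftCLM_apply_apply φ.hasTemperateGrowth, modulate_apply, modulate_apply,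
      smul_eq_mul, ← hHH']
    ring
  rw [e, smul_apply_eq_integral hφ]
  refine norm_integral_mul_le_peetre hmN hC₀ hg fun η => ?_
  rw [angularFourierInv_modulate, angularFourierInv_apply, norm_mul, Complex.norm_real,
    Real.norm_of_nonneg hc, mul_assoc]
  gcongr
  exact h p ξ η

/-- At frequency `η` the kernel is `w(0,η)` times an unnormalized inverse transform, at `η - ξ`, of
the uniformly smooth function `φ a(·,η)/w(0,η)`. The `N₀` extra powers of decay pay for moving the
weight from `η` to `ξ`. -/
theorem norm_op_smul_apply_modulate_le {ρ : ℝ} {w : Rd d × Rd d → ℝ} (hw : IsPolyModerate w)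
    {a : Rd d × Rd d → ℂ} (ha : HasUniformTemperateGrowth a) (h : SymbolClass ρ 0 w a)
    {K : Set (Rd d)} (hK : IsCompact K) {φ χ : 𝓢(Rd d, ℂ)} (hφ : ∀ x, x ∉ K → φ x = 0)
    (hχ : HasCompactSupport χ) (f : 𝓢'(Rd d, ℂ)) {m N : ℕ} (hmN : m ≤ N) (hf : DistOrderLE f m) :
    ∃ C, 0 ≤ C ∧ ∀ ξ,
      ‖op a ha (TemperedDistribution.smulLeftCLM ℂ χ f) (modulate ξ φ)‖ ≤
        C * w (0, ξ) * peetre N (localFourier χ f) ξ := by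
  obtain ⟨C₀, hC₀, hg⟩ := hf.localFourier_le χ
  obtain ⟨Cw, N₀, hCw, hmod⟩ := hw.exists_pos
  obtain ⟨H, hH, hHt⟩ := (SymbolClass.unifSmooth_cutoff hw ha h hK hφ).exists_testFamily hK
    (fun η x hx => by rw [hφ x hx, zero_mul])
  obtain ⟨C, hC, hb⟩ := hHt.exists_decay hK (N + (d + 1) + N₀)
  have hc := (fourierConst_pos d).le
  refine ⟨fourierConst d * (C * Cw) * ∫ x : Rd d, (1 + ‖x‖) ^ (-(d + 1 : ℝ)),
    mul_nonneg (by positivity) (integral_nonneg fun x => by positivity), fun ξ => ?_⟩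
  have h1 : ∀ η, ‖HasUniformTemperateGrowth.oscIntegral a (modulate ξ φ) η‖ ≤
      C * Cw * w (0, ξ) * ((1 + ‖ξ - η‖) ^ (N + (d + 1)))⁻¹ := by
    intro η
    have hw0 := hw.pos (0, η)
    have hp := one_add_norm_pos (ξ - η)
    have e : HasUniformTemperateGrowth.oscIntegral a (modulate ξ φ) η =
        (w (0, η) : ℂ) * ∫ x, phase (η - ξ) x * H η x := by
      rw [oscIntegral_eq_phase, ← integral_const_mul]
      congr 1
      ext x
      have hw0' : (w (0, η) : ℂ) ≠ 0 := by exact_mod_cast hw0.ne'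
      rw [modulate_apply, hH, sub_eq_add_neg, phase_add]
      push_cast
      field_simp
    rw [e, norm_mul, Complex.norm_real, Real.norm_of_nonneg hw0.le]
    have h2 : w (0, η) ≤ Cw * w (0, ξ) * (1 + ‖ξ - η‖) ^ N₀ := by
      have := hmod (0, ξ) (0, η - ξ)
      simpa [Prod.norm_def, norm_sub_rev η ξ] using this
    have hw1 := hw.pos (0, ξ)
    calc _ ≤ (Cw * w (0, ξ) * (1 + ‖ξ - η‖) ^ N₀) *
          (C * ((1 + ‖ξ - η‖) ^ (N + (d + 1) + N₀))⁻¹) := by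
          gcongr
          exact hb η ξ η
      _ = _ := by
        rw [pow_add _ _ N₀]
        field_simp
  rw [op_smul_apply_eq_integral ha hχ, norm_mul, Complex.norm_real, Real.norm_of_nonneg hc]
  refine (mul_le_mul_of_nonneg_left (norm_integral_mul_le_peetre hmN hC₀ hg h1) hc).trans
    (le_of_eq (by ring))

theorem integrable_phase_mul_schwartz (φ : 𝓢(Rd d, ℂ)) (η : Rd d) :
    Integrable fun x => phase η x * φ x := by
  have := integrable_phase_mul (HasUniformTemperateGrowth.const (1 : ℂ)) φ η
  simpa using this

/-- Freezing the frequency: if `a(x,η)` were `a(x,ξ)`, testing `Op(a)(χ f)` on `e^{-i⟨x,ξ⟩} b_ξ`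
would give exactly a multiple of `w(0,ξ)` times the transform of `φ f`. The error carries `a(x,η) -
a(x,ξ)`, hence the factor `(1 + |ξ|)^{-ρ'}` and a maximal function. -/
theorem exists_norm_localFourier_le {ρ ρ' : ℝ} (hρ'0 : 0 ≤ ρ') (hρ' : ρ' ≤ ρ) (hρ'1 : ρ' ≤ 1)
    {w : Rd d × Rd d → ℝ} (hw : IsPolyModerate w) {a : Rd d × Rd d → ℂ}
    (ha : HasUniformTemperateGrowth a) (h : SymbolClass ρ 0 w a) {K T : Set (Rd d)}
    (hK : IsCompact K) (hT : IsCompact T) {χ φ : 𝓢(Rd d, ℂ)} (hχK : ∀ x ∈ K, χ x = 1)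
    (hχ : ∀ x, x ∉ T → χ x = 0) (hφ : ∀ x, x ∉ K → φ x = 0) {Ω : Set (Rd d)}
    {b : Ω → 𝓢(Rd d, ℂ)} (hb : TestFamily K b)
    (hab : ∀ (ξ : Ω) x, b ξ x * a (x, ξ) = (w (0, (ξ : Rd d)) : ℂ) * φ x)
    (f : 𝓢'(Rd d, ℂ)) {m N : ℕ} (hmN : m ≤ N) (hf : DistOrderLE f m) :
    ∃ C, 0 ≤ C ∧ ∀ ξ : Ω, ‖localFourier φ f ξ‖ ≤
      C * ((w (0, (ξ : Rd d)))⁻¹ *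
        ‖op a ha (TemperedDistribution.smulLeftCLM ℂ χ f) (modulate ξ (b ξ))‖ +
        (1 + ‖(ξ : Rd d)‖) ^ (-ρ') * peetre N (localFourier χ f) ξ) := by
  obtain ⟨C₀, hC₀, hg⟩ := hf.localFourier_le χ
  have hχc : HasCompactSupport χ := hasCompactSupport_of_eq_zero hT hχ
  obtain ⟨M, hM⟩ := SymbolClass.unifSmooth_cutoff_sub hρ'0 hρ' hρ'1 hw ha h hT hχ
  obtain ⟨H, hH, hHt⟩ := ((hb.unif.comp (fun p : Ω × Rd d => p.1)).mul
    (hM.comp (fun p : Ω × Rd d => ((p.1 : Rd d), p.2)))).exists_testFamily hK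
    (fun p x hx => by rw [hb.supp p.1 x hx, zero_mul])
  obtain ⟨C, hC, hdec⟩ := hHt.exists_decay hK (N + (d + 1) + M)
  have hc := fourierConst_pos d
  set I := ∫ x : Rd d, (1 + ‖x‖) ^ (-(d + 1 : ℝ)) with hI
  have hI0 : 0 ≤ I := integral_nonneg fun x => by positivity
  refine ⟨fourierConst d + fourierConst d ^ 2 * (C * I), by positivity, fun ξ => ?_⟩
  set g := localFourier χ f with hgdef
  have hw0 := hw.pos (0, (ξ : Rd d))
  have hρp : 0 < (1 + ‖(ξ : Rd d)‖) ^ (-ρ') := Real.rpow_pos_of_pos (one_add_norm_pos _) _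
  -- The error kernel `∫ e^{i⟨x,η-ξ⟩} b_ξ(x) (a(x,η) - a(x,ξ)) dx`. The inverse `fourierConst d`
  -- removes the normalization of `angularFourierInv`.
  set J : Rd d → ℂ := fun η => HasUniformTemperateGrowth.oscIntegral a (modulate ξ (b ξ)) η -
    (w (0, (ξ : Rd d)) : ℂ) * ((fourierConst d : ℂ)⁻¹ * angularFourierInv (modulate ξ φ) η) with hJ
  have hcne : (fourierConst d : ℂ) ≠ 0 := by exact_mod_cast hc.ne'
  have hJe : ∀ η, J η = ((w (0, (ξ : Rd d)) * (1 + ‖(ξ : Rd d)‖) ^ (-ρ') *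
      (1 + ‖(ξ : Rd d) - η‖) ^ M : ℝ) : ℂ) * ∫ x, phase (η - (ξ : Rd d)) x * H (ξ, η) x := by
    intro η
    have hs : 0 < w (0, (ξ : Rd d)) * (1 + ‖(ξ : Rd d)‖) ^ (-ρ') * (1 + ‖(ξ : Rd d) - η‖) ^ M :=
      mul_pos (mul_pos hw0 hρp) (pow_pos (one_add_norm_pos _) _)
    simp only [hJ]
    rw [angularFourierInv_apply, ← mul_assoc (fourierConst d : ℂ)⁻¹, inv_mul_cancel₀ hcne,
      one_mul, oscIntegral_eq_phase, ← integral_const_mul, ← integral_const_mul, ← integral_sub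
        (integrable_phase_mul ha (modulate ξ (b ξ)) η)
        ((integrable_phase_mul_schwartz (modulate ξ φ) η).const_mul _)]
    congr 1
    ext x
    have h1 := hab ξ x
    -- `b_ξ` lives where `χ = 1`, so `χ` can be inserted to bring in the uniformly bounded family of
    -- symbol differences.
    have h2 : b ξ x * χ x = b ξ x := by
      by_cases hx : x ∈ K
      · rw [hχK x hx, mul_one]
      · rw [hb.supp ξ x hx, zero_mul]
    rw [modulate_apply, modulate_apply, hH, sub_eq_add_neg η, phase_add]
    set s := w (0, (ξ : Rd d)) * (1 + ‖(ξ : Rd d)‖) ^ (-ρ') * (1 + ‖(ξ : Rd d) - η‖) ^ M with hsdef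
    have hs' : (s : ℂ) ≠ 0 := by exact_mod_cast hs.ne'
    change phase η x * (phase (-(ξ : Rd d)) x * b ξ x) * a (x, η) -
      (w (0, (ξ : Rd d)) : ℂ) * (phase η x * (phase (-(ξ : Rd d)) x * φ x)) =
      s * (phase η x * phase (-(ξ : Rd d)) x *
        (b ξ x * (χ x * (((s⁻¹ : ℝ) : ℂ) * (a (x, η) - a (x, ξ))))))
    rw [Complex.ofReal_inv, ← mul_assoc (b ξ x), h2]
    field_simp
    linear_combination phase η x * phase (-(ξ : Rd d)) x * h1
  have hJb : ∀ η, ‖J η‖ ≤ C * (w (0, (ξ : Rd d)) * (1 + ‖(ξ : Rd d)‖) ^ (-ρ')) *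
      ((1 + ‖(ξ : Rd d) - η‖) ^ (N + (d + 1)))⁻¹ := by
    intro η
    have hp := one_add_norm_pos ((ξ : Rd d) - η)
    rw [hJe, norm_mul, Complex.norm_real, Real.norm_of_nonneg (by positivity)]
    calc _ ≤ (w (0, (ξ : Rd d)) * (1 + ‖(ξ : Rd d)‖) ^ (-ρ') * (1 + ‖(ξ : Rd d) - η‖) ^ M) *
          (C * ((1 + ‖(ξ : Rd d) - η‖) ^ (N + (d + 1) + M))⁻¹) := by
          gcongr
          exact hdec (ξ, η) ξ η
      _ = _ := by
        rw [pow_add _ _ M]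
        field_simp
  have hJi := norm_integral_mul_le_peetre hmN hC₀ hg hJb
  have hrep := (localFourier_spec hχc f).2
  have i1 : Integrable fun η => g η * HasUniformTemperateGrowth.oscIntegral a (modulate ξ (b ξ)) η :=
    (hrep (ha.oscIntegralCLM a (modulate ξ (b ξ)))).1
  have i2 : Integrable fun η => g η * ((w (0, (ξ : Rd d)) : ℂ) *
      ((fourierConst d : ℂ)⁻¹ * angularFourierInv (modulate ξ φ) η)) := by
    refine (((hrep (angularFourierInv (modulate ξ φ))).1).const_mul
      ((w (0, (ξ : Rd d)) : ℂ) * (fourierConst d : ℂ)⁻¹)).congr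
      (Filter.Eventually.of_forall fun η => ?_)
    change _ * (localFourier χ f η * _) = localFourier χ f η * _
    ring
  have e1 : ∫ η, g η * J η =
      (∫ η, g η * HasUniformTemperateGrowth.oscIntegral a (modulate ξ (b ξ)) η) -
      (w (0, (ξ : Rd d)) : ℂ) * ((fourierConst d : ℂ)⁻¹ *
        ∫ η, g η * angularFourierInv (modulate ξ φ) η) := by
    rw [← integral_const_mul, ← integral_const_mul]
    simp only [hJ, mul_sub]
    rw [integral_sub i1 i2]
    congr 2
    ext η
    ring
  have e2 : modulate ξ φ = SchwartzMap.smulLeftCLM ℂ χ (modulate ξ φ) := by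
    ext x
    rw [SchwartzMap.smulLeftCLM_apply_apply χ.hasTemperateGrowth, modulate_apply, smul_eq_mul]
    by_cases hx : x ∈ K
    · rw [hχK x hx, one_mul]
    · rw [hφ x hx, mul_zero, mul_zero]
  have e3 : localFourier φ f ξ =
      fourierConst d * ∫ η, g η * angularFourierInv (modulate ξ φ) η := by
    rw [localFourier, e2, smul_apply_eq_integral hχc, ← e2]
  have e4 := op_smul_apply_eq_integral ha hχc f (modulate ξ (b ξ))
  have hw0' : (w (0, (ξ : Rd d)) : ℂ) ≠ 0 := by exact_mod_cast hw0.ne'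
  -- The identity solved for the unknown: principal term minus freezing error.
  have e5 : localFourier φ f ξ = (w (0, (ξ : Rd d)) : ℂ)⁻¹ *
      (fourierConst d * op a ha (TemperedDistribution.smulLeftCLM ℂ χ f) (modulate ξ (b ξ)) -
        fourierConst d ^ 2 * ∫ η, g η * J η) := by
    rw [e1, e3, e4]
    field_simp
    ring
  rw [e5, norm_mul, norm_inv, Complex.norm_real, Real.norm_of_nonneg hw0.le]
  set U := ‖op a ha (TemperedDistribution.smulLeftCLM ℂ χ f) (modulate ξ (b ξ))‖ with hU
  have hP := peetre_nonneg N g ξ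
  calc _ ≤ (w (0, (ξ : Rd d)))⁻¹ * (fourierConst d * U + fourierConst d ^ 2 *
        (C * (w (0, (ξ : Rd d)) * (1 + ‖(ξ : Rd d)‖) ^ (-ρ')) * I * peetre N g ξ)) := by
        gcongr
        refine (norm_sub_le _ _).trans ?_
        rw [norm_mul, norm_mul, norm_pow, Complex.norm_real, Real.norm_of_nonneg hc.le]
        gcongr
    _ = fourierConst d * ((w (0, (ξ : Rd d)))⁻¹ * U) + fourierConst d ^ 2 * (C * I) *
        ((1 + ‖(ξ : Rd d)‖) ^ (-ρ') * peetre N g ξ) := by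
        field_simp
    _ ≤ _ := by
        rw [add_mul]
        have h1 : 0 ≤ (w (0, (ξ : Rd d)))⁻¹ * U := by positivity
        have h2 : 0 ≤ (1 + ‖(ξ : Rd d)‖) ^ (-ρ') * peetre N g ξ := by positivity
        gcongr
        · linarith
        · linarith

end estimates

end FourierBF

end

noncomputable section

namespace FourierBF

/-! ### Moderate weights -/

section weights
variable {d : ℕ}

theorem IsPolyModerate.slice_zero {w : Rd d × Rd d → ℝ} (hw : IsPolyModerate w) :
    IsPolyModerate fun ξ : Rd d => w (0, ξ) := by
  obtain ⟨C, N, hC, h⟩ := hw.exists_pos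
  refine ⟨hw.measurable.comp measurable_prodMk_left, fun ξ => hw.pos _, C, N, fun ξ η => ?_⟩
  simpa [Prod.norm_def] using h (0, ξ) (0, η)

theorem IsPolyModerate.mul {F : Type*} [NormedAddCommGroup F] [MeasurableSpace F] {w w' : F → ℝ}
    (hw : IsPolyModerate w) (hw' : IsPolyModerate w') : IsPolyModerate fun x => w x * w' x := by
  obtain ⟨C, N, hC, h⟩ := hw.exists_pos
  obtain ⟨C', N', hC', h'⟩ := hw'.exists_pos
  refine ⟨hw.measurable.mul hw'.measurable, fun x => mul_pos (hw.pos x) (hw'.pos x), C * C',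
    N + N', fun x y => ?_⟩
  have h1 := (hw.pos x).le
  have h2 := (hw'.pos (x + y)).le
  calc w (x + y) * w' (x + y) ≤ (C * w x * (1 + ‖y‖) ^ N) * (C' * w' x * (1 + ‖y‖) ^ N') := by
        gcongr
        · exact h x y
        · exact h' x y
    _ = _ := by
        rw [pow_add]
        ring

theorem IsPolyModerate.inv {F : Type*} [NormedAddCommGroup F] [MeasurableSpace F] {w : F → ℝ}
    (hw : IsPolyModerate w) : IsPolyModerate fun x => (w x)⁻¹ := by
  obtain ⟨C, N, hC, h⟩ := hw.exists_pos
  refine ⟨hw.measurable.inv, fun x => inv_pos.2 (hw.pos x), C, N, fun x y => ?_⟩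
  have h1 := hw.pos x
  have h2 := hw.pos (x + y)
  have h3 := h (x + y) (-y)
  rw [add_neg_cancel_right, norm_neg] at h3
  rw [inv_eq_one_div, div_le_iff₀ h2, mul_assoc, mul_assoc, ← div_eq_inv_mul, mul_div_assoc',
    le_div_iff₀ h1, one_mul]
  exact h3.trans (le_of_eq (by ring))

theorem IsPolyModerate.div {F : Type*} [NormedAddCommGroup F] [MeasurableSpace F] {w w' : F → ℝ}
    (hw : IsPolyModerate w) (hw' : IsPolyModerate w') : IsPolyModerate fun x => w x / w' x := by
  simpa only [div_eq_mul_inv] using hw.mul hw'.inv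

theorem isPolyModerate_rpow {s : ℝ} (hs : 0 ≤ s) :
    IsPolyModerate fun ξ : Rd d => (1 + ‖ξ‖) ^ (-s) := by
  have h : IsPolyModerate fun ξ : Rd d => (1 + ‖ξ‖) ^ s := by
    obtain ⟨n, hn⟩ := exists_nat_ge s
    refine ⟨by fun_prop, fun ξ => Real.rpow_pos_of_pos (one_add_norm_pos ξ) s, 1, n,
      fun x y => ?_⟩
    rw [one_mul, ← Real.rpow_natCast]
    calc (1 + ‖x + y‖) ^ s ≤ ((1 + ‖x‖) * (1 + ‖y‖)) ^ s := by
          gcongr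
          exact one_add_norm_add_le x y
      _ = (1 + ‖x‖) ^ s * (1 + ‖y‖) ^ s := Real.mul_rpow (by positivity) (by positivity)
      _ ≤ _ := by
          gcongr
          exact one_le_one_add_norm y
  convert h.inv using 2 with ξ
  exact Real.rpow_neg (one_add_norm_pos ξ).le s

theorem IsOpenCone.inter {Γ Γ' : Set (Rd d)} (h : IsOpenCone Γ) (h' : IsOpenCone Γ') :
    IsOpenCone (Γ ∩ Γ') :=
  ⟨h.isOpen.inter h'.isOpen, fun h0 => h.zero_notMem h0.1,
    fun ξ hξ t ht => ⟨h.smul_mem ξ hξ.1 t ht, h'.smul_mem ξ hξ.2 t ht⟩⟩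

theorem exists_ball_cutoff (x₀ : Rd d) {r s : ℝ} (hrs : r < s) : ∃ χ : 𝓢(Rd d, ℂ),
    (∀ᶠ x in 𝓝ˢ (Metric.closedBall x₀ r), χ x = 1) ∧ ∀ x, x ∉ Metric.closedBall x₀ s → χ x = 0 :=
  exists_cutoff (isCompact_closedBall x₀ r) (isCompact_closedBall x₀ s)
    (Metric.closedBall_subset_ball hrs |>.trans Metric.ball_subset_interior_closedBall)

theorem exists_ball_ne_zero {φ : 𝓢(Rd d, ℂ)} {x₀ : Rd d} (h : φ x₀ ≠ 0) :
    ∃ r > 0, ∀ x ∈ Metric.closedBall x₀ r, φ x ≠ 0 :=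
  Metric.nhds_basis_closedBall.mem_iff.1 (φ.continuous.continuousAt.eventually_ne h)

theorem DistOrderLE.mono {f : 𝓢'(Rd d, ℂ)} {m n : ℕ} (hmn : m ≤ n) (hf : DistOrderLE f m) :
    DistOrderLE f n := by
  obtain ⟨C, hC, h⟩ := hf
  refine ⟨C, hC, fun ψ A hA hψ => h ψ A hA fun i hi x => le_trans ?_ (hψ i (hi.trans hmn) x)⟩
  gcongr
  exact one_le_one_add_norm x

theorem testFamily_const (P : Type*) {K : Set (Rd d)} (hK : IsCompact K) {φ : 𝓢(Rd d, ℂ)}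
    (hφ : ∀ x, x ∉ K → φ x = 0) : TestFamily K fun _ : P => φ :=
  ⟨UnifSmooth.of_hasCompactSupport (φ.smooth ⊤) (hasCompactSupport_of_eq_zero hK hφ),
    fun _ => hφ⟩

end weights

/-! ### The two inclusions -/

section inclusions

set_option linter.unusedSectionVars false
variable {d : ℕ} {B : Type*} [NormedAddCommGroup B] [NormedSpace ℂ B] [CompleteSpace B]
  {v : Rd d → ℝ} {ι : B →ₗ[ℂ] (Rd d →ₘ[(volume : Measure (Rd d))] ℂ)}

/-- Localization: regularity of `φ f` passes to `χ f` if `φ ≠ 0` on the support of `χ`. -/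
theorem IsDominated.localize (hB : IsTranslationInvariantBFSpace v ι) {φ χ : 𝓢(Rd d, ℂ)}
    (hφ : HasCompactSupport φ) {K : Set (Rd d)} (hK : IsCompact K) (hχ : ∀ x, x ∉ K → χ x = 0)
    (hφK : ∀ x ∈ K, φ x ≠ 0) (f : 𝓢'(Rd d, ℂ)) {w : Rd d → ℝ} (hw : IsPolyModerate w)
    {Γ Γ' : Set (Rd d)} (hΓ : IsConicSubset Γ' Γ)
    (h : IsDominated ι (Γ.indicator fun ξ => ‖localFourier φ f ξ‖ * w ξ)) :
    IsDominated ι (Γ'.indicator fun ξ => ‖localFourier χ f ξ‖ * w ξ) := by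
  obtain ⟨m, hm⟩ := exists_distOrderLE f
  obtain ⟨N₀, hN₀⟩ := h.peetre hB hφ f hw hΓ
  obtain ⟨ψ, hψ, hψφ⟩ := exists_schwartz_div hK hχ hφK
  obtain ⟨C, hC, hb⟩ := (testFamily_const Unit hK hψ).norm_apply_modulate_le hK (H := fun _ => χ)
    hφ (fun _ => hψφ) f (le_max_right N₀ m) hm
  have hc := (fourierConst_pos d).le
  refine ((hN₀ (max N₀ m) (le_max_left _ _)).const_mul (c := fourierConst d * C)
    (by positivity)).mono fun ξ => ?_
  by_cases hξ : ξ ∈ Γ'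
  · rw [Set.indicator_of_mem hξ, Set.indicator_of_mem hξ, localFourier, norm_mul,
      Complex.norm_real, Real.norm_of_nonneg hc, ← mul_assoc, mul_assoc (fourierConst d) C]
    have := (hw.pos ξ).le
    gcongr
    exact hb () ξ
  · rw [Set.indicator_of_notMem hξ, Set.indicator_of_notMem hξ, mul_zero]

/-- The analytic content of the first inclusion: the part of `f` away from `x₀` contributes a
rapidly decreasing function, and the local part is at most `ω₀(0,ξ)` times a maximal function, which
the weight `ω / ω₀` turns into `ω`. -/
theorem isDominated_op (hB : IsTranslationInvariantBFSpace v ι) {ρ : ℝ} (hρ : 0 < ρ)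
    {ω ω₀ : Rd d × Rd d → ℝ} (hω : IsPolyModerate ω) (hω₀ : IsPolyModerate ω₀)
    {a : Rd d × Rd d → ℂ} (h : SymbolClass ρ 0 ω₀ a) (ha : HasUniformTemperateGrowth a)
    (f : 𝓢'(Rd d, ℂ)) {x₀ ξ₀ : Rd d} {φ : 𝓢(Rd d, ℂ)} (hφ : HasCompactSupport φ) (hφ₀ : φ x₀ ≠ 0)
    {Γ : Set (Rd d)} (hΓ : IsOpenCone Γ) (hξ₀ : ξ₀ ∈ Γ)
    (hreg : IsDominated ι (Γ.indicator fun ξ => ‖localFourier φ f ξ‖ * ω (0, ξ))) :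
    ∃ φ' : 𝓢(Rd d, ℂ), HasCompactSupport φ' ∧ φ' x₀ ≠ 0 ∧ ∃ Γ', IsOpenCone Γ' ∧ ξ₀ ∈ Γ' ∧
      IsDominated ι (Γ'.indicator fun ξ => ‖localFourier φ' (op a ha f) ξ‖ *
        (ω (0, ξ) / ω₀ (0, ξ))) := by
  obtain ⟨r, hr, hφr⟩ := exists_ball_ne_zero hφ₀
  obtain ⟨χ, hχ1, hχ0⟩ := exists_ball_cutoff x₀ (half_lt_self hr)
  obtain ⟨φ', hφ'1, hφ'0⟩ := exists_ball_cutoff x₀ (half_pos hr)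
  have hχc : HasCompactSupport χ := hasCompactSupport_of_eq_zero (isCompact_closedBall x₀ r) hχ0
  have hK := isCompact_closedBall x₀ (r / 2)
  -- The cone shrinks twice: once in passing from `φ f` to `χ f`, once in passing to the maximal
  -- function.
  obtain ⟨Γ₁, hΓ₁, hξ₁, hsub₁⟩ := hΓ.exists_isConicSubset hξ₀
  obtain ⟨Γ₂, hΓ₂, hξ₂, hsub₂⟩ := hΓ₁.exists_isConicSubset hξ₁
  have hw := hω.slice_zero
  have h1 := hreg.localize hB hφ (isCompact_closedBall x₀ r) hχ0 hφr f hw hsub₁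
  obtain ⟨N₀, hN₀⟩ := h1.peetre hB hχc f hw hsub₂
  obtain ⟨m, hm⟩ := exists_distOrderLE f
  obtain ⟨L, hL⟩ := hB.exists_isDominated_decay
  obtain ⟨C₁, L₁, hC₁, hb₁⟩ := (hw.div hω₀.slice_zero).le_mul_pow
  have hfo := h.finiteOrder hρ.le hω₀
  -- Decay of order `L₁ + L`: `L₁` against the growth of `ω / ω₀`, and `L` to land in the dominated
  -- function `(1 + |ξ|)^{-L}`.
  obtain ⟨C₂, hC₂, hb₂⟩ := hfo.op_sub_op_cutoff_decay (lt_min hρ one_pos) (min_le_right _ _) hK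
    (testFamily_const Unit hK hφ'0) f hχc hχ1 (L₁ + L)
  obtain ⟨C₃, hC₃, hb₃⟩ := norm_op_smul_apply_modulate_le hω₀ ha h hK hφ'0 hχc f
    (le_max_right N₀ m) hm
  have hc := (fourierConst_pos d).le
  refine ⟨φ', hasCompactSupport_of_eq_zero hK hφ'0, ?_, Γ₂, hΓ₂, hξ₂, ?_⟩
  · rw [hφ'1.self_of_nhdsSet x₀ (Metric.mem_closedBall_self le_rfl)]
    exact one_ne_zero
  refine (((hN₀ _ (le_max_left N₀ m)).const_mul (c := fourierConst d * C₃) (by positivity)).add hB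
    (hL.const_mul (c := fourierConst d * C₂ * C₁) (by positivity))).mono fun ξ => ?_
  by_cases hξ : ξ ∈ Γ₂
  · rw [Set.indicator_of_mem hξ, Set.indicator_of_mem hξ, localFourier, norm_mul,
      Complex.norm_real, Real.norm_of_nonneg hc]
    have hw0 := hω.pos (0, ξ)
    have hw1 := hω₀.pos (0, ξ)
    have hp := one_add_norm_pos ξ
    set u := op a ha f (modulate ξ φ') with hu
    set u' := op a ha (TemperedDistribution.smulLeftCLM ℂ χ f) (modulate ξ φ') with hu'
    have h2 : ‖u - u'‖ ≤ C₂ * ((1 + ‖ξ‖) ^ (L₁ + L))⁻¹ := by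
      rw [← div_eq_mul_inv, le_div_iff₀ (by positivity), mul_comm]
      exact hb₂ () ξ
    have h3 : ‖u‖ ≤ ‖u'‖ + ‖u - u'‖ := by
      have := norm_add_le u' (u - u')
      rwa [add_sub_cancel] at this
    have h4 := hb₃ ξ
    have h5 := hb₁ ξ
    have h6 : 0 < ω (0, ξ) / ω₀ (0, ξ) := by positivity
    calc fourierConst d * ‖u‖ * (ω (0, ξ) / ω₀ (0, ξ))
        ≤ fourierConst d * (C₃ * ω₀ (0, ξ) * FourierBF.peetre (max N₀ m) (localFourier χ f) ξ +
          C₂ * ((1 + ‖ξ‖) ^ (L₁ + L))⁻¹) * (ω (0, ξ) / ω₀ (0, ξ)) := by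
          gcongr
          exact h3.trans (add_le_add h4 h2)
      _ = fourierConst d * C₃ * (FourierBF.peetre (max N₀ m) (localFourier χ f) ξ * ω (0, ξ)) +
          fourierConst d * C₂ * ((1 + ‖ξ‖) ^ (L₁ + L))⁻¹ * (ω (0, ξ) / ω₀ (0, ξ)) := by
          field_simp
      _ ≤ fourierConst d * C₃ * (FourierBF.peetre (max N₀ m) (localFourier χ f) ξ * ω (0, ξ)) +
          fourierConst d * C₂ * ((1 + ‖ξ‖) ^ (L₁ + L))⁻¹ * (C₁ * (1 + ‖ξ‖) ^ L₁) := by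
          gcongr
      _ = _ := by
          rw [pow_add]
          field_simp
  · rw [Set.indicator_of_notMem hξ, Set.indicator_of_notMem hξ]
    positivity

end inclusions

end FourierBF

end

noncomputable section

namespace FourierBF

/-! ### Elliptic regularity -/

section elliptic
variable {d : ℕ} {B : Type*} [NormedAddCommGroup B] [NormedSpace ℂ B] [CompleteSpace B]
  {v : Rd d → ℝ} {ι : B →ₗ[ℂ] (Rd d →ₘ[(volume : Measure (Rd d))] ℂ)}

set_option linter.unusedSectionVars false

/-- On the frequencies where `a` is elliptic, `φ f` is controlled by `Op(a) f` and by the gain `ρ'`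
over a larger localization `χ f`. -/
theorem exists_norm_localFourier_le_of_elliptic {ρ : ℝ} (hρ : 0 < ρ) {ω₀ : Rd d × Rd d → ℝ}
    (hω₀ : IsPolyModerate ω₀) {a : Rd d × Rd d → ℂ} (h : SymbolClass ρ 0 ω₀ a)
    (ha : HasUniformTemperateGrowth a) (f : 𝓢'(Rd d, ℂ)) {K T : Set (Rd d)} (hK : IsCompact K)
    (hT : IsCompact T) {χ φ φ' : 𝓢(Rd d, ℂ)} (hχK : ∀ᶠ x in 𝓝ˢ K, χ x = 1)
    (hχ : ∀ x, x ∉ T → χ x = 0) (hφ : ∀ x, x ∉ K → φ x = 0) (hφ' : HasCompactSupport φ')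
    (hφ'T : ∀ x ∈ T, φ' x ≠ 0) {Ω : Set (Rd d)} {c : ℝ} (hc : 0 < c)
    (hell : ∀ x ∈ T, ∀ ξ ∈ Ω, c * ω₀ (x, ξ) ≤ ‖a (x, ξ)‖) {m N : ℕ} (hmN : m ≤ N)
    (hf : DistOrderLE f m) (hu : DistOrderLE (op a ha f) m) (L : ℕ) :
    ∃ C, 0 ≤ C ∧ ∀ ξ ∈ Ω, ‖localFourier φ f ξ‖ ≤
      C * ((ω₀ (0, ξ))⁻¹ * (peetre N (localFourier φ' (op a ha f)) ξ + ((1 + ‖ξ‖) ^ L)⁻¹) +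
        (1 + ‖ξ‖) ^ (-min ρ 1) * peetre N (localFourier χ f) ξ) := by
  have hχK' : ∀ x ∈ K, χ x = 1 := fun x hx => hχK.self_of_nhdsSet x hx
  have hχc : HasCompactSupport χ := hasCompactSupport_of_eq_zero hT hχ
  obtain ⟨b, hb, hab⟩ := SymbolClass.exists_parametrix hω₀ ha h hK hT hχK' hχ hφ hc hell
  have hρ1 : 0 < min ρ 1 := lt_min hρ one_pos
  obtain ⟨C₁, hC₁, h₁⟩ := exists_norm_localFourier_le hρ1.le (min_le_left ρ 1) (min_le_right ρ 1)
    hω₀ ha h hK hT hχK' hχ hφ hb hab f hmN hf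
  obtain ⟨C₂, hC₂, h₂⟩ := (h.finiteOrder hρ.le hω₀).op_sub_op_cutoff_decay hρ1 (min_le_right ρ 1)
    hK hb f hχc hχK L
  -- Since `φ' ψ = χ` and `χ = 1` on `K`, one has `b = φ' (b ψ)`. Testing `Op(a) f` on `b` therefore
  -- only sees the localization `φ' Op(a) f`, whose regularity is known.
  obtain ⟨ψ, hψ, hψφ⟩ := exists_schwartz_div hT hχ hφ'T
  obtain ⟨b', hb'e, hb'⟩ := (hb.unif.mul (UnifSmooth.of_hasCompactSupport (ψ.smooth ⊤)
    (hasCompactSupport_of_eq_zero hT hψ))).exists_testFamily hK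
    (fun p x hx => by rw [hb.supp p x hx, zero_mul])
  obtain ⟨C₃, hC₃, h₃⟩ := hb'.norm_apply_modulate_le hK (H := b) hφ' (fun p x => by
    rw [hb'e]
    by_cases hx : x ∈ K
    · linear_combination b p x * hψφ x + b p x * hχK' x hx
    · rw [hb.supp p x hx]
      ring) (op a ha f) hmN hu
  refine ⟨C₁ * (1 + C₂ + C₃), by positivity, fun ξ hξ => (h₁ ⟨ξ, hξ⟩).trans ?_⟩
  have hw0 := hω₀.pos (0, ξ)
  have hp := one_add_norm_pos ξ
  have hP₁ := peetre_nonneg N (localFourier φ' (op a ha f)) ξ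
  have hP₂ := peetre_nonneg N (localFourier χ f) ξ
  set u := op a ha f (modulate ξ (b ⟨ξ, hξ⟩)) with hudef
  set u' := op a ha (TemperedDistribution.smulLeftCLM ℂ χ f) (modulate ξ (b ⟨ξ, hξ⟩)) with hu'
  have h4 : ‖u - u'‖ ≤ C₂ * ((1 + ‖ξ‖) ^ L)⁻¹ := by
    rw [← div_eq_mul_inv, le_div_iff₀ (by positivity), mul_comm]
    exact h₂ ⟨ξ, hξ⟩ ξ
  have h5 : ‖u'‖ ≤ ‖u‖ + ‖u - u'‖ := by
    have := norm_sub_le u (u - u')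
    rwa [sub_sub_cancel] at this
  have h6 := h₃ ⟨ξ, hξ⟩ ξ
  set P₁ := peetre N (localFourier φ' (op a ha f)) ξ with hP₁def
  set P₂ := peetre N (localFourier χ f) ξ with hP₂def
  have hQ : 0 ≤ (1 + ‖ξ‖) ^ (-min ρ 1) * P₂ := by positivity
  have hq : 0 ≤ ((1 + ‖ξ‖) ^ L)⁻¹ := by positivity
  have h7 : ‖u'‖ ≤ (1 + C₂ + C₃) * (P₁ + ((1 + ‖ξ‖) ^ L)⁻¹) := by
    have : 0 ≤ C₂ * P₁ := by positivity
    have : 0 ≤ C₃ * ((1 + ‖ξ‖) ^ L)⁻¹ := by positivity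
    have : ‖u‖ ≤ C₃ * P₁ := h6
    nlinarith
  rw [mul_assoc C₁]
  refine mul_le_mul_of_nonneg_left ?_ hC₁
  calc (ω₀ (0, ξ))⁻¹ * ‖u'‖ + (1 + ‖ξ‖) ^ (-min ρ 1) * P₂
      ≤ (ω₀ (0, ξ))⁻¹ * ((1 + C₂ + C₃) * (P₁ + ((1 + ‖ξ‖) ^ L)⁻¹)) +
        (1 + C₂ + C₃) * ((1 + ‖ξ‖) ^ (-min ρ 1) * P₂) := by
        have h8 : 1 ≤ 1 + C₂ + C₃ := by linarith
        exact add_le_add (mul_le_mul_of_nonneg_left h7 (inv_pos.2 hw0).le)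
          (le_mul_of_one_le_left hQ h8)
    _ = _ := by ring

/-- Near `(x₀, ξ₀)`, `f` is regular up to a loss of `s` orders. -/
def IsRegularNear (ι : B →ₗ[ℂ] (Rd d →ₘ[(volume : Measure (Rd d))] ℂ)) (ω : Rd d × Rd d → ℝ)
    (f : 𝓢'(Rd d, ℂ)) (x₀ ξ₀ : Rd d) (s : ℝ) : Prop :=
  ∃ r > 0, ∃ Γ, IsOpenCone Γ ∧ ξ₀ ∈ Γ ∧ ∀ φ : 𝓢(Rd d, ℂ), (∀ x, x ∉ Metric.closedBall x₀ r → φ x = 0) →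
    IsDominated ι (Γ.indicator fun ξ => ‖localFourier φ f ξ‖ * (ω (0, ξ) * (1 + ‖ξ‖) ^ (-s)))

/-- The transforms of all `φ f` grow with one common power, the order of `f`. A large enough loss
pushes them below the dominated decaying function. -/
theorem exists_isRegularNear (hB : IsTranslationInvariantBFSpace v ι) {ω : Rd d × Rd d → ℝ}
    (hω : IsPolyModerate ω) (f : 𝓢'(Rd d, ℂ)) (x₀ : Rd d) {ξ₀ : Rd d} {Γ : Set (Rd d)}
    (hΓ : IsOpenCone Γ) (hξ₀ : ξ₀ ∈ Γ) : ∃ s₀, ∀ s ≥ s₀, IsRegularNear ι ω f x₀ ξ₀ s := by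
  obtain ⟨m, hm⟩ := exists_distOrderLE f
  obtain ⟨L, hL⟩ := hB.exists_isDominated_decay
  obtain ⟨C₁, L₁, hC₁, hb₁⟩ := hω.slice_zero.le_mul_pow
  refine ⟨((m + L₁ + L : ℕ) : ℝ), fun s hs => ⟨1, one_pos, Γ, hΓ, hξ₀, fun φ hφ => ?_⟩⟩
  obtain ⟨C₀, hC₀, hg⟩ := hm.localFourier_le φ
  refine (hL.const_mul (c := C₀ * C₁) (by positivity)).mono fun ξ => ?_
  have hp := one_add_norm_pos ξ
  by_cases hξ : ξ ∈ Γ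
  · rw [Set.indicator_of_mem hξ]
    have h1 : (1 + ‖ξ‖) ^ (-s) ≤ ((1 + ‖ξ‖) ^ (m + L₁ + L))⁻¹ := by
      rw [Real.rpow_neg hp.le, ← Real.rpow_natCast]
      gcongr
      exact one_le_one_add_norm ξ
    have h2 := (hω.pos (0, ξ)).le
    calc ‖localFourier φ f ξ‖ * (ω (0, ξ) * (1 + ‖ξ‖) ^ (-s))
        ≤ (C₀ * (1 + ‖ξ‖) ^ m) * ((C₁ * (1 + ‖ξ‖) ^ L₁) * ((1 + ‖ξ‖) ^ (m + L₁ + L))⁻¹) := by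
          gcongr
          · exact hg ξ
          · exact hb₁ ξ
      _ = _ := by
          rw [pow_add, pow_add]
          field_simp
  · rw [Set.indicator_of_notMem hξ]
    positivity

/-- One step of the bootstrap. The assumption bounds the maximal function of `χ f` with loss `s +
min ρ 1`; the factor `(1 + |ξ|)^{-min ρ 1}` in the elliptic estimate restores `min ρ 1` orders.
Since `χ` is a larger localization than `φ`, the ball shrinks, and regularity must be known for all
test functions supported in it. -/
theorem IsRegularNear.improve (hB : IsTranslationInvariantBFSpace v ι) {ρ : ℝ} (hρ : 0 < ρ)
    {ω ω₀ : Rd d × Rd d → ℝ} (hω : IsPolyModerate ω) (hω₀ : IsPolyModerate ω₀)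
    {a : Rd d × Rd d → ℂ} (h : SymbolClass ρ 0 ω₀ a) (ha : HasUniformTemperateGrowth a)
    (f : 𝓢'(Rd d, ℂ)) {x₀ ξ₀ : Rd d} {φ' : 𝓢(Rd d, ℂ)} (hφ' : HasCompactSupport φ')
    (hφ'₀ : φ' x₀ ≠ 0) {Γ : Set (Rd d)} (hΓ : IsOpenCone Γ) (hξ₀ : ξ₀ ∈ Γ)
    (hreg : IsDominated ι (Γ.indicator fun ξ => ‖localFourier φ' (op a ha f) ξ‖ *
      (ω (0, ξ) / ω₀ (0, ξ))))
    (hell : IsPsiInvertible ω₀ a x₀ ξ₀) {s : ℝ} (hs : 0 ≤ s)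
    (hf : IsRegularNear ι ω f x₀ ξ₀ (s + min ρ 1)) : IsRegularNear ι ω f x₀ ξ₀ s := by
  obtain ⟨r₀, hr₀, Γ₀, hΓ₀, hξ₀Γ₀, hdom⟩ := hf
  obtain ⟨r₁, hr₁, hφ'r⟩ := exists_ball_ne_zero hφ'₀
  obtain ⟨X, hX, Γe, hΓe, hξe, R, c, hR, hc, hell⟩ := hell
  obtain ⟨r₂, hr₂, hXr⟩ := Metric.nhds_basis_closedBall.mem_iff.1 hX
  -- On this ball `f` is regular with the larger loss, `φ'` has no zeros and `a` is elliptic.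
  set r := min r₀ (min r₁ r₂) with hr
  have hrp : 0 < r := lt_min hr₀ (lt_min hr₁ hr₂)
  obtain ⟨χ, hχ1, hχ0⟩ := exists_ball_cutoff x₀ (half_lt_self hrp)
  have hT := isCompact_closedBall x₀ r
  have hK := isCompact_closedBall x₀ (r / 2)
  have hχc : HasCompactSupport χ := hasCompactSupport_of_eq_zero hT hχ0
  have hT₀ : Metric.closedBall x₀ r ⊆ Metric.closedBall x₀ r₀ :=
    Metric.closedBall_subset_closedBall (min_le_left _ _)
  have hT₁ : Metric.closedBall x₀ r ⊆ Metric.closedBall x₀ r₁ :=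
    Metric.closedBall_subset_closedBall ((min_le_right _ _).trans (min_le_left _ _))
  have hT₂ : Metric.closedBall x₀ r ⊆ Metric.closedBall x₀ r₂ :=
    Metric.closedBall_subset_closedBall ((min_le_right _ _).trans (min_le_right _ _))
  have hρ1 : 0 < min ρ 1 := lt_min hρ one_pos
  obtain ⟨Γ₁, hΓ₁, hξ₁, hsub₁⟩ := hΓ₀.exists_isConicSubset hξ₀Γ₀
  obtain ⟨Γ₂, hΓ₂, hξ₂, hsub₂⟩ := hΓ.exists_isConicSubset hξ₀
  have hw := hω.slice_zero
  obtain ⟨N₁, hN₁⟩ := (hdom χ fun x hx => hχ0 x fun hx' => hx (hT₀ hx')).peetre hB hχc f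
    (hw.mul (isPolyModerate_rpow (by linarith))) hsub₁
  obtain ⟨N₂, hN₂⟩ := hreg.peetre hB hφ' (op a ha f) (hw.div hω₀.slice_zero) hsub₂
  obtain ⟨m₁, hm₁⟩ := exists_distOrderLE f
  obtain ⟨m₂, hm₂⟩ := exists_distOrderLE (op a ha f)
  set m := max m₁ m₂ with hm
  set N := max m (max N₁ N₂) with hN
  have hD₁ := hN₁ N ((le_max_left _ _).trans (le_max_right _ _))
  have hD₂ := hN₂ N ((le_max_right _ _).trans (le_max_right _ _))
  obtain ⟨L, hL⟩ := hB.exists_isDominated_decay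
  obtain ⟨C₁, L₁, hC₁, hb₁⟩ := (hw.div hω₀.slice_zero).le_mul_pow
  obtain ⟨C₂, L₂, hC₂, hb₂⟩ := hw.le_mul_pow
  refine ⟨r / 2, half_pos hrp, Γ₁ ∩ Γ₂ ∩ Γe, (hΓ₁.inter hΓ₂).inter hΓe, ⟨⟨hξ₁, hξ₂⟩, hξe⟩,
    fun φ hφ => ?_⟩
  obtain ⟨C, hC, hest⟩ := exists_norm_localFourier_le_of_elliptic hρ hω₀ h ha f hK hT hχ1 hχ0 hφ
    hφ' (fun x hx => hφ'r x (hT₁ hx)) (Ω := {ξ | ξ ∈ Γe ∧ R ≤ ‖ξ‖}) hc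
    (fun x hx ξ hξ => hell x (hXr (hT₂ hx)) ξ hξ.1 hξ.2) (le_max_left m (max N₁ N₂))
    (hm₁.mono (le_max_left _ _)) (hm₂.mono (le_max_right _ _)) (L₁ + L)
  obtain ⟨C₀, hC₀, hg⟩ := hm₁.localFourier_le φ
  -- Bounds the frequencies `|ξ| < R`, where ellipticity is not available but everything is bounded.
  set D := C₀ * C₂ * (1 + R) ^ (m₁ + L₂ + L) with hD
  refine (((hD₂.const_mul hC).add hB (hD₁.const_mul hC)).add hB
    (hL.const_mul (c := C * C₁ + D) (by positivity))).mono fun ξ => ?_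
  have hp := one_add_norm_pos ξ
  have hw0 := hω.pos (0, ξ)
  have hw1 := hω₀.pos (0, ξ)
  have hP₁ := peetre_nonneg N (localFourier χ f) ξ
  have hP₂ := peetre_nonneg N (localFourier φ' (op a ha f)) ξ
  have hs1 : (1 + ‖ξ‖) ^ (-s) ≤ 1 :=
    Real.rpow_le_one_of_one_le_of_nonpos (one_le_one_add_norm ξ) (by linarith)
  have hs0 : 0 < (1 + ‖ξ‖) ^ (-s) := Real.rpow_pos_of_pos hp _
  set P₁ := FourierBF.peetre N (localFourier χ f) ξ with hP₁d
  set P₂ := FourierBF.peetre N (localFourier φ' (op a ha f)) ξ with hP₂d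
  by_cases hξ : ξ ∈ Γ₁ ∩ Γ₂ ∩ Γe
  swap
  · rw [Set.indicator_of_notMem hξ]
    have i1 : 0 ≤ Γ₂.indicator (fun ξ => FourierBF.peetre N (localFourier φ' (op a ha f)) ξ *
      (ω (0, ξ) / ω₀ (0, ξ))) ξ := Set.indicator_nonneg (fun ξ _ =>
        mul_nonneg (peetre_nonneg _ _ _) (div_pos (hω.pos _) (hω₀.pos _)).le) ξ
    have i2 : 0 ≤ Γ₁.indicator (fun ξ => FourierBF.peetre N (localFourier χ f) ξ *
      (ω (0, ξ) * (1 + ‖ξ‖) ^ (-(s + min ρ 1)))) ξ := Set.indicator_nonneg (fun ξ _ =>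
        mul_nonneg (peetre_nonneg _ _ _) (mul_pos (hω.pos _)
          (Real.rpow_pos_of_pos (one_add_norm_pos ξ) _)).le) ξ
    positivity
  rw [Set.indicator_of_mem hξ, Set.indicator_of_mem hξ.1.1, Set.indicator_of_mem hξ.1.2]
  have hsplit : (1 + ‖ξ‖) ^ (-(s + min ρ 1)) = (1 + ‖ξ‖) ^ (-s) * (1 + ‖ξ‖) ^ (-min ρ 1) := by
    rw [← Real.rpow_add hp]
    congr 1
    ring
  have hρ0 : 0 < (1 + ‖ξ‖) ^ (-min ρ 1) := Real.rpow_pos_of_pos hp _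
  rcases le_or_gt R ‖ξ‖ with hRξ | hRξ
  · have h1 := hest ξ ⟨hξ.2, hRξ⟩
    have h2 := hb₁ ξ
    calc ‖localFourier φ f ξ‖ * (ω (0, ξ) * (1 + ‖ξ‖) ^ (-s))
        ≤ C * ((ω₀ (0, ξ))⁻¹ * (P₂ + ((1 + ‖ξ‖) ^ (L₁ + L))⁻¹) +
            (1 + ‖ξ‖) ^ (-min ρ 1) * P₁) * (ω (0, ξ) * (1 + ‖ξ‖) ^ (-s)) := by gcongr
      _ = C * ((P₂ * (ω (0, ξ) / ω₀ (0, ξ)) +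
            (ω (0, ξ) / ω₀ (0, ξ)) * ((1 + ‖ξ‖) ^ (L₁ + L))⁻¹) * (1 + ‖ξ‖) ^ (-s)) +
            C * (P₁ * (ω (0, ξ) * (1 + ‖ξ‖) ^ (-(s + min ρ 1)))) := by
          rw [hsplit]
          field_simp
      _ ≤ C * ((P₂ * (ω (0, ξ) / ω₀ (0, ξ)) +
            (C₁ * (1 + ‖ξ‖) ^ L₁) * ((1 + ‖ξ‖) ^ (L₁ + L))⁻¹) * 1) +
            C * (P₁ * (ω (0, ξ) * (1 + ‖ξ‖) ^ (-(s + min ρ 1)))) := by gcongr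
      _ = C * (P₂ * (ω (0, ξ) / ω₀ (0, ξ))) +
            C * (P₁ * (ω (0, ξ) * (1 + ‖ξ‖) ^ (-(s + min ρ 1)))) +
            (C * C₁) * ((1 + ‖ξ‖) ^ L)⁻¹ := by
          rw [pow_add]
          field_simp
          ring
      _ ≤ _ := by
          gcongr
          have : 0 ≤ D := by positivity
          linarith
  · have h1 : ‖localFourier φ f ξ‖ * (ω (0, ξ) * (1 + ‖ξ‖) ^ (-s)) ≤
        D * ((1 + ‖ξ‖) ^ L)⁻¹ := by
      have h2 : (1 + ‖ξ‖) ^ (m₁ + L₂ + L) ≤ (1 + R) ^ (m₁ + L₂ + L) := by gcongr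
      calc ‖localFourier φ f ξ‖ * (ω (0, ξ) * (1 + ‖ξ‖) ^ (-s))
          ≤ (C₀ * (1 + ‖ξ‖) ^ m₁) * ((C₂ * (1 + ‖ξ‖) ^ L₂) * 1) := by
            gcongr
            · exact hg ξ
            · exact hb₂ ξ
        _ = C₀ * C₂ * (1 + ‖ξ‖) ^ (m₁ + L₂ + L) * ((1 + ‖ξ‖) ^ L)⁻¹ := by
            rw [pow_add, pow_add]
            field_simp
        _ ≤ _ := by
            rw [hD]
            gcongr
    refine h1.trans ?_
    have i1 : 0 ≤ C * (P₂ * (ω (0, ξ) / ω₀ (0, ξ))) := by positivity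
    have i2 : 0 ≤ C * (P₁ * (ω (0, ξ) * (1 + ‖ξ‖) ^ (-(s + min ρ 1)))) := by
      rw [hsplit]
      positivity
    have i3 : 0 ≤ C * C₁ * ((1 + ‖ξ‖) ^ L)⁻¹ := by positivity
    rw [add_mul]
    linarith

/-- Descent from the initial finite loss to loss zero in steps of `min ρ 1`. The ball and the cone
may shrink each time, which is harmless since the number of steps is finite. -/
theorem isDominated_of_isPsiInvertible (hB : IsTranslationInvariantBFSpace v ι) {ρ : ℝ}
    (hρ : 0 < ρ) {ω ω₀ : Rd d × Rd d → ℝ} (hω : IsPolyModerate ω) (hω₀ : IsPolyModerate ω₀)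
    {a : Rd d × Rd d → ℂ} (h : SymbolClass ρ 0 ω₀ a) (ha : HasUniformTemperateGrowth a)
    (f : 𝓢'(Rd d, ℂ)) {x₀ ξ₀ : Rd d} {φ' : 𝓢(Rd d, ℂ)} (hφ' : HasCompactSupport φ')
    (hφ'₀ : φ' x₀ ≠ 0) {Γ : Set (Rd d)} (hΓ : IsOpenCone Γ) (hξ₀ : ξ₀ ∈ Γ)
    (hreg : IsDominated ι (Γ.indicator fun ξ => ‖localFourier φ' (op a ha f) ξ‖ *
      (ω (0, ξ) / ω₀ (0, ξ)))) (hell : IsPsiInvertible ω₀ a x₀ ξ₀) :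
    ∃ φ : 𝓢(Rd d, ℂ), HasCompactSupport φ ∧ φ x₀ ≠ 0 ∧ ∃ Γ', IsOpenCone Γ' ∧ ξ₀ ∈ Γ' ∧
      IsDominated ι (Γ'.indicator fun ξ => ‖localFourier φ f ξ‖ * ω (0, ξ)) := by
  have hρ1 : 0 < min ρ 1 := lt_min hρ one_pos
  have key : ∀ k : ℕ, IsRegularNear ι ω f x₀ ξ₀ (k * min ρ 1) →
      IsRegularNear ι ω f x₀ ξ₀ 0 := by
    intro k
    induction k with
    | zero => simp
    | succ k ih =>
      intro hk
      refine ih (IsRegularNear.improve hB hρ hω hω₀ h ha f hφ' hφ'₀ hΓ hξ₀ hreg hell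
        (by positivity) ?_)
      convert hk using 1
      push_cast
      ring
  -- The initial loss is rounded up to an integer multiple of the gain.
  obtain ⟨s₀, hs₀⟩ := exists_isRegularNear hB hω f x₀ hΓ hξ₀
  obtain ⟨k, hk⟩ := exists_nat_ge (s₀ / min ρ 1)
  obtain ⟨r, hr, Γ', hΓ', hξ', hdom⟩ := key k (hs₀ _ ((div_le_iff₀ hρ1).1 hk))
  obtain ⟨φ, hφ1, hφ0⟩ := exists_ball_cutoff x₀ hr
  refine ⟨φ, hasCompactSupport_of_eq_zero (isCompact_closedBall x₀ r) hφ0, ?_, Γ', hΓ', hξ', ?_⟩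
  · rw [hφ1.self_of_nhdsSet x₀ (Metric.mem_closedBall_self le_rfl)]
    exact one_ne_zero
  · simpa using hdom φ hφ0

end elliptic

end FourierBF

end

/-! ### The two inclusions of wave-front sets -/

open FourierBF in
theorem mainTheorem1 {d : ℕ} {ρ : ℝ} (hρ : 0 < ρ) {ω ω₀ : Rd d × Rd d → ℝ}
    (hω : IsPolyModerate ω) (hω₀ : WeightClass ρ 0 ω₀) {a : Rd d × Rd d → ℂ}
    (ha : SymbolClass ρ 0 ω₀ a) {B : Type*} [NormedAddCommGroup B] [NormedSpace ℂ B]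
    [CompleteSpace B] (ι : B →ₗ[ℂ] (Rd d →ₘ[(volume : Measure (Rd d))] ℂ))
    (hB : ∃ v : Rd d → ℝ, IsTranslationInvariantBFSpace v ι) (f : 𝓢'(Rd d, ℂ)) :
    waveFrontSet ι (fun z => ω z / ω₀ z)
        (op a (ha.hasUniformTemperateGrowth hρ.le hω₀.1) f) ⊆ waveFrontSet ι ω f ∧
      waveFrontSet ι ω f ⊆
        waveFrontSet ι (fun z => ω z / ω₀ z)
          (op a (ha.hasUniformTemperateGrowth hρ.le hω₀.1) f) ∪ charSet ω₀ a := by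
  obtain ⟨v, hB⟩ := hB
  have hg := ha.hasUniformTemperateGrowth hρ.le hω₀.1
  have hω' : IsPolyModerate fun z => ω z / ω₀ z := hω.div hω₀.1
  constructor
  -- By contraposition: a test function for which `ξ₀` is regular for `f` yields one for `Op(a) f`.
  · rintro ⟨x₀, ξ₀⟩ ⟨hξ₀, hWF⟩
    refine ⟨hξ₀, fun φ hφ hφc hφ₀ => ⟨hξ₀, fun hreg => ?_⟩⟩
    obtain ⟨Γ, hΓ, hξΓ, hdom⟩ := (mem_regularDirections_iff hB hω (φ := hφc.toSchwartzMap hφ)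
      hφc f ξ₀).1 hreg
    obtain ⟨φ', hφ'c, hφ'₀, Γ', hΓ', hξ', hdom'⟩ := isDominated_op hB hρ hω hω₀.1 ha hg f
      (φ := hφc.toSchwartzMap hφ) hφc hφ₀ hΓ hξΓ hdom
    exact (hWF φ' (φ'.smooth ⊤) hφ'c hφ'₀).2 ((mem_regularDirections_iff hB hω' hφ'c _ ξ₀).2
      ⟨Γ', hΓ', hξ', hdom'⟩)
  -- Outside the characteristic set `a` is elliptic near `(x₀, ξ₀)`, and regularity of `Op(a) f`
  -- there passes back to `f`.
  · rintro ⟨x₀, ξ₀⟩ ⟨hξ₀, hWF⟩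
    by_contra hnot
    rw [Set.mem_union, not_or] at hnot
    have hell : IsPsiInvertible ω₀ a x₀ ξ₀ := by
      by_contra hne
      exact hnot.2 ⟨hξ₀, hne⟩
    refine hnot.1 ⟨hξ₀, fun φ' hφ' hφ'c hφ'₀ => ⟨hξ₀, fun hreg => ?_⟩⟩
    obtain ⟨Γ, hΓ, hξΓ, hdom⟩ := (mem_regularDirections_iff hB hω' (φ := hφ'c.toSchwartzMap hφ')
      hφ'c _ ξ₀).1 hreg
    obtain ⟨φ, hφc, hφ₀, Γ', hΓ', hξ', hdom'⟩ := isDominated_of_isPsiInvertible hB hρ hω hω₀.1 ha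
      hg f (φ' := hφ'c.toSchwartzMap hφ') hφ'c hφ'₀ hΓ hξΓ hdom hell
    exact (hWF φ (φ.smooth ⊤) hφc hφ₀).2 ((mem_regularDirections_iff hB hω hφc f ξ₀).2
      ⟨Γ', hΓ', hξ', hdom'⟩)
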